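/- For an undirected simple graph $G$ and $A\subseteq V(G)$, write $\overline{A}=V(G)\setminus A$ and let the upper-mim-width $\mathrm{umim}(A)$ be the maximum size of an induced matching in the graph obtained from $G$ by deleting all edges with both endpoints in $\overline{A}$, every edge of the matching having one endpoint in $A$ and the other in $\overline{A}$. Let $\mathrm{omim}(A)=\min(\mathrm{umim}(A),\mathrm{umim}(\overline{A}))$. A branch decomposition of $G$ is a pair $(T,\delta)$ of a tree $T$ whose non-leaf nodes all have degree $3$ and a bijection $\delta$ from $V(G)$ to the leaves of $T$ (for $|V(G)|=1$, $T$ is a single node, which counts as a leaf). Its o-mim-width is the maximum, over the edges $e$ of $T$, of $\mathrm{omim}(A_e)$, where $A_e$ is the set of vertices mapped to one of the two components of $T-e$ (and $0$ if $T$ has no edge). **Theorem.** There are an algorithm and a constant $c$ such that, given an $n$-vertex graph $G$, a weight function $w:V(G)\to\mathbb{Z}_{\ge 0}$ and a branch decomposition of $G$ of o-mim-width $k$, the algorithm outputs an independent set of $G$ of maximum weight in time at most $c\cdot n^{c\max(k,1)}$, that is, in time $n^{O(k)}$ (read as $n^{O(1)}$ if $k=0$). Likewise, there are an algorithm and a constant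 $c$ such that, given the same input, the algorithm outputs, in time at most $c\cdot n^{c\max(k,1)}$, a feedback vertex set of $G$ of minimum weight, i.e. a set of minimum weight among the sets $S\subseteq V(G)$ for which $G\setminus S$ is a forest. Neither $c$ nor the algorithm depends on $n$, $k$, $G$, $w$ or the decomposition, and $k$ is not part of the input. Algorithms are programs of a unit-cost random access machine whose only arithmetic operations are addition and truncated subtraction of natural numbers, each weight occupying one memory cell. -/

import Mathlib

/-! ### Upper-mim-width and o-mim-width of a cut -/

namespace OMim

variable {V : Type*}

/-- `G - E(Aᶜ)`: the graph `G` without its edges having both endpoints outside `A`. -/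
def deleteOutside (G : SimpleGraph V) (A : Set V) : SimpleGraph V :=
  G.deleteEdges {e | ∀ v ∈ e, v ∉ A}

/-- `M` is an induced matching of `H` all of whose edges have one endpoint in `A` and the other
endpoint outside `A`. -/
def IsInducedCutMatching {H : SimpleGraph V} (A : Set V) (M : H.Subgraph) : Prop :=
  M.IsMatching ∧ M.IsInduced ∧ ∀ u v, M.Adj u v → (u ∈ A ↔ v ∉ A)

/-- The upper-mim-width of `A`: the maximum size of an induced `(A, Aᶜ)`-matching
in `G - E(Aᶜ)`. -/
noncomputable def umim (G : SimpleGraph V) (A : Set V) : ℕ :=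
  sSup {k | ∃ M : (deleteOutside G A).Subgraph, IsInducedCutMatching A M ∧ M.edgeSet.ncard = k}

/-- The cut function of o-mim-width. -/
noncomputable def omim (G : SimpleGraph V) (A : Set V) : ℕ :=
  min (umim G A) (umim G Aᶜ)

/-! ### Branch decompositions -/

/-- A branch decomposition on the vertex set `V`, whose tree has node set `N`: a tree in which
every node is a leaf (degree at most `1`) or has degree `3`, with a bijection from `V` onto the
leaves. (A node of degree `0` occurs only in the one-node tree, which serves a one-element `V`.) -/
structure BranchDecomposition (V N : Type*) [Fintype N] where
  tree : SimpleGraph N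
  isTree : tree.IsTree
  cubic : ∀ t, (tree.neighborSet t).ncard ≤ 1 ∨ (tree.neighborSet t).ncard = 3
  leaf : V → N
  leaf_injective : Function.Injective leaf
  range_leaf : Set.range leaf = {t | (tree.neighborSet t).ncard ≤ 1}

namespace BranchDecomposition

variable {N : Type*} [Fintype N]

/-- The elements of `V` mapped to leaves on the side of `s` when the edge `st` is removed. -/
def side (D : BranchDecomposition V N) (s t : N) : Set V :=
  {v | (D.tree.deleteEdges {s(s, t)}).Reachable s (D.leaf v)}

open Classical in
/-- The width with respect to a set function `f`: the maximum of `f` over the cuts given by the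
edges of the tree (`0` if the tree has no edge). Both sides of each cut are listed. -/
noncomputable def width (D : BranchDecomposition V N) (f : Set V → ℕ) : ℕ :=
  (Finset.univ.filter fun p : N × N => D.tree.Adj p.1 p.2).sup fun p => f (D.side p.1 p.2)

end BranchDecomposition

/-! ### The two optimization problems -/

/-- `S` is an independent set of maximum weight. -/
def IsMaxWeightIndepSet (G : SimpleGraph V) (w : V → ℕ) (S : Finset V) : Prop :=
  G.IsIndepSet (S : Set V) ∧
    ∀ S' : Finset V, G.IsIndepSet (S' : Set V) → ∑ v ∈ S', w v ≤ ∑ v ∈ S, w v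

/-- `S` is a feedback vertex set: its complement induces a forest. -/
def IsFeedbackVertexSet (G : SimpleGraph V) (S : Finset V) : Prop :=
  (G.induce ((S : Set V)ᶜ)).IsAcyclic

/-- `S` is a feedback vertex set of minimum weight. -/
def IsMinWeightFeedbackVertexSet (G : SimpleGraph V) (w : V → ℕ) (S : Finset V) : Prop :=
  IsFeedbackVertexSet G S ∧
    ∀ S' : Finset V, IsFeedbackVertexSet G S' → ∑ v ∈ S, w v ≤ ∑ v ∈ S', w v

end OMim

/-! ### A random access machine with a step count

Programs are finite texts over natural-number variables and unbounded arrays of natural numbers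
with indirect addressing. The only arithmetic operations are addition and truncated subtraction
(there is no multiplication, so that the unit-cost measure is polynomially equivalent to Turing
machine time). Each constant, variable access, array access, arithmetic operation, assignment and
test counts one step. -/

namespace RAM

/-- Expressions. `load a i` is the entry of array `a` at the address given by `i`. -/
inductive Expr where
  | const (c : ℕ)
  | var (x : ℕ)
  | load (a : ℕ) (i : Expr)
  | add (e₁ e₂ : Expr)
  | sub (e₁ e₂ : Expr)

/-- Programs. `cond e c d` executes `c` if `e` is nonzero and `d` otherwise; `loop e c` repeats
`c` as long as `e` is nonzero. -/
inductive Cmd where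
  | skip
  | assign (x : ℕ) (e : Expr)
  | store (a : ℕ) (i e : Expr)
  | seq (c d : Cmd)
  | cond (e : Expr) (c d : Cmd)
  | loop (e : Expr) (c : Cmd)

/-- Memory contents: the values of the variables and the entries of the arrays. -/
structure State where
  var : ℕ → ℕ
  arr : ℕ → ℕ → ℕ

/-- Value of an expression. -/
def Expr.eval (σ : State) : Expr → ℕ
  | .const c => c
  | .var x => σ.var x
  | .load a i => σ.arr a (i.eval σ)
  | .add e₁ e₂ => e₁.eval σ + e₂.eval σ
  | .sub e₁ e₂ => e₁.eval σ - e₂.eval σ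

/-- Number of steps for evaluating an expression. -/
def Expr.cost : Expr → ℕ
  | .const _ => 1
  | .var _ => 1
  | .load _ i => i.cost + 1
  | .add e₁ e₂ => e₁.cost + e₂.cost + 1
  | .sub e₁ e₂ => e₁.cost + e₂.cost + 1

/-- Write the value `a` to the variable `x`. -/
def State.setVar (σ : State) (x a : ℕ) : State :=
  { σ with var := Function.update σ.var x a }

/-- Write the value `b` to the entry `i` of array `a`. -/
def State.setArr (σ : State) (a i b : ℕ) : State :=
  { σ with arr := Function.update σ.arr a (Function.update (σ.arr a) i b) }

/-- `Run c σ t σ'`: started in memory `σ`, the program `c` halts after exactly `t` steps with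
memory `σ'`. -/
inductive Run : Cmd → State → ℕ → State → Prop
  | skip (σ : State) : Run .skip σ 1 σ
  | assign (x : ℕ) (e : Expr) (σ : State) :
      Run (.assign x e) σ (e.cost + 1) (σ.setVar x (e.eval σ))
  | store (a : ℕ) (i e : Expr) (σ : State) :
      Run (.store a i e) σ (i.cost + e.cost + 1) (σ.setArr a (i.eval σ) (e.eval σ))
  | seq {c d : Cmd} {σ σ' σ'' : State} {t t' : ℕ} :
      Run c σ t σ' → Run d σ' t' σ'' → Run (.seq c d) σ (t + t') σ''
  | condTrue {e : Expr} {c d : Cmd} {σ σ' : State} {t : ℕ} :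
      e.eval σ ≠ 0 → Run c σ t σ' → Run (.cond e c d) σ (e.cost + 1 + t) σ'
  | condFalse {e : Expr} {c d : Cmd} {σ σ' : State} {t : ℕ} :
      e.eval σ = 0 → Run d σ t σ' → Run (.cond e c d) σ (e.cost + 1 + t) σ'
  | loopTrue {e : Expr} {c : Cmd} {σ σ' σ'' : State} {t t' : ℕ} :
      e.eval σ ≠ 0 → Run c σ t σ' → Run (.loop e c) σ' t' σ'' →
        Run (.loop e c) σ (e.cost + 1 + t + t') σ''
  | loopFalse {e : Expr} {c : Cmd} {σ : State} :
      e.eval σ = 0 → Run (.loop e c) σ (e.cost + 1) σ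

end RAM

/-! ### Input and output format -/

namespace OMim

open Classical in
/-- Row-major adjacency matrix of a graph on `Fin n`: entry `n * u + v` is `1` if `u` and `v` are
adjacent; all other entries are `0`. -/
noncomputable def adjArray {n : ℕ} (G : SimpleGraph (Fin n)) (p : ℕ) : ℕ :=
  if ∃ u v : Fin n, G.Adj u v ∧ p = n * u + v then 1 else 0

/-- The array of the values of a function on `Fin n`, padded with `0`. -/
def funArray {n : ℕ} (f : Fin n → ℕ) (p : ℕ) : ℕ :=
  if h : p < n then f ⟨p, h⟩ else 0

/-- The initial memory for a weighted graph on `Fin n` and a branch decomposition with node set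
`Fin m`: variable `0` holds `n`, variable `1` holds `m`, array `0` the weights, array `1` the
adjacency matrix of the graph, array `2` the adjacency matrix of the tree, array `3` the leaf of
each vertex; everything else is `0`. -/
noncomputable def inputState {n m : ℕ} (G : SimpleGraph (Fin n)) (w : Fin n → ℕ)
    (D : BranchDecomposition (Fin n) (Fin m)) : RAM.State where
  var x := match x with
    | 0 => n
    | 1 => m
    | _ => 0
  arr a := match a with
    | 0 => funArray w
    | 1 => adjArray G
    | 2 => adjArray D.tree
    | 3 => funArray fun v => (D.leaf v : ℕ)
    | _ => fun _ => 0

/-- The vertex set described by array `4` of the final memory. -/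
def outputSet (n : ℕ) (σ : RAM.State) : Finset (Fin n) :=
  Finset.univ.filter fun v => σ.arr 4 v ≠ 0

end OMim

/-!
# Independent sets and feedback vertex sets under bounded o-mim-width

Both problems ask for a heaviest vertex set `S` that is good: the edges of `G` inside `S` form a
forest over an equivalence relation `r` (`ForestOver`, `Good`). For `r = ⊤` the good sets are the
independent sets (`good_top_iff`), for `r = ⊥` the sets inducing forests (`good_bot_iff`), whose
complements are the feedback vertex sets. So one algorithm, with a flag for `r`, solves both.

Let `A` be the side of a tree edge, and let `X ⊆ A` and `Y ⊆ Aᶜ` be such that `X ∪ Y` is good, hence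
induces a forest. Contracting a maximal matching between `X` and `Y` leaves a two-colourable graph,
so half of the matching is an induced matching whose two sides are irredundant sets of `A` and `Aᶜ`
(`CutMatching.exists_irredundant`). Irredundant sets of size `p` on both sides of a cut force
o-mim-width at least `p` (`le_width_of_hasIrredundant`). If the width is `κ`, then the matching has
at most `2κ` edges, and its endpoints cover all edges between `X` and `Y`. By the same kind of
argument, on one of the two sides the neighbourhood of the uncovered part is that of at most `2κ`
vertices (`exists_small_neighborhood`). A test consists of these `O(κ)` vertices and of the
connections that `Y` provides between covering vertices; `X` passes it, and every `X'` that passes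
it is compatible with `Y` (`exists_test`). There are `n ^ O(κ)` tests. Keeping a heaviest passing
candidate for each of them yields a family representing all partial solutions inside `A`
(`Represents.prune`), and such families are computed along the tree, since the union of the families
of the two children of a tree edge represents the disjoint union of their sides
(`Represents.union`). The families of the two sides of any edge finally yield an optimal solution
(`Represents.exists_union`).

The width is not needed as an input, and the algorithm does not compute it: it increases `κ` from
`0` until no cut has irredundant sets of size `κ + 1` on both sides, which happens at the latest
when `κ` is the width, and this is all that the exchange property needs. Tests and irredundant sets
are enumerated as numbers with `12κ + 1` digits in base `n + 1`, where the digit `n` stands for no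
vertex.

Programs are written in a language of bounded loops (`St`) whose semantics is a total function on
memories, so that invariants can be proved by induction on loops (`St.exec_forr`); products and sums
are expressions of that language. Its translation to the random access machine is correct, with a
time bound that is polynomial in the largest loop bound `W` (`St.comp_halts`,
`St.polyBounded_time`), and all loop bounds are at most `(n + 1) ^ (12k + 2)`.
-/

set_option linter.constructorNameAsVariable false

namespace OMim

/-! ### Forests over an equivalence relation -/

section Forest

variable {V : Type*}

/-- The equivalence relation generated by `r` and the edges in `E`: the connected components after
the edges `E` have been added to a graph with components `r`. -/
def joined (r : Setoid V) (E : Set (Sym2 V)) : Setoid V :=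
  Relation.EqvGen.setoid fun x y => r x y ∨ s(x, y) ∈ E

/-- Both endpoints of `e` lie in the same class of `r`. -/
def Within (r : Setoid V) (e : Sym2 V) : Prop :=
  ∀ x ∈ e, ∀ y ∈ e, r x y

/-- `E` is the edge set of a forest in the multigraph obtained by contracting the classes of `r`:
no edge has its endpoints connected by `r` and the other edges. For `r = ⊥` this is a forest in the
usual sense, for `r = ⊤` it says that `E` is empty. -/
def ForestOver (r : Setoid V) (E : Set (Sym2 V)) : Prop :=
  ∀ e ∈ E, ¬ Within (joined r (E \ {e})) e

variable {r r' : Setoid V} {E F : Set (Sym2 V)}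

@[simp]
lemma within_mk {a b : V} : Within r s(a, b) ↔ r a b := by
  constructor
  · intro h; exact h a (by simp) b (by simp)
  · intro h x hx y hy
    simp only [Sym2.mem_iff] at hx hy
    rcases hx with rfl | rfl <;> rcases hy with rfl | rfl
    · exact r.refl' _
    · exact h
    · exact r.symm' h
    · exact r.refl' _

lemma Within.mono (h : r ≤ r') {e : Sym2 V} (he : Within r e) : Within r' e :=
  fun x hx y hy => h (he x hx y hy)

lemma le_joined : r ≤ joined r E := fun _ _ h => Relation.EqvGen.rel _ _ (Or.inl h)

lemma joined_of_mem {a b : V} (h : s(a, b) ∈ E) : joined r E a b :=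
  Relation.EqvGen.rel _ _ (Or.inr h)

lemma joined_le (h : r ≤ r') (hE : ∀ a b, s(a, b) ∈ E → r' a b) : joined r E ≤ r' :=
  Setoid.eqvGen_le fun x y hxy => hxy.elim (fun g => h g) (hE x y)

lemma joined_mono (h : r ≤ r') (hE : E ⊆ F) : joined r E ≤ joined r' F :=
  joined_le (h.trans le_joined) fun _ _ hab => joined_of_mem (hE hab)

@[simp]
lemma joined_empty : joined r ∅ = r :=
  le_antisymm (joined_le le_rfl (by simp)) le_joined

lemma joined_joined : joined (joined r E) F = joined r (E ∪ F) := by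
  apply le_antisymm
  · exact joined_le (joined_mono le_rfl Set.subset_union_left)
      fun a b h => joined_of_mem (Set.mem_union_right _ h)
  · refine joined_le (le_joined.trans le_joined) fun a b h => ?_
    rcases h with h | h
    · exact le_joined (joined_of_mem h)
    · exact joined_of_mem h

lemma joined_singleton_iff {a b x y : V} :
    joined r {s(a, b)} x y ↔ r x y ∨ (r x a ∧ r b y) ∨ (r x b ∧ r a y) := by
  constructor
  · intro h
    induction h with
    | rel x y h =>
      rcases h with h | h
      · exact Or.inl h
      · simp only [Set.mem_singleton_iff, Sym2.eq_iff] at h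
        rcases h with ⟨rfl, rfl⟩ | ⟨rfl, rfl⟩
        · exact Or.inr (Or.inl ⟨r.refl' _, r.refl' _⟩)
        · exact Or.inr (Or.inr ⟨r.refl' _, r.refl' _⟩)
    | refl x => exact Or.inl (r.refl' _)
    | symm x y _ ih =>
      rcases ih with h | ⟨h, h'⟩ | ⟨h, h'⟩
      · exact Or.inl (r.symm' h)
      · exact Or.inr (Or.inr ⟨r.symm' h', r.symm' h⟩)
      · exact Or.inr (Or.inl ⟨r.symm' h', r.symm' h⟩)
    | trans x y z _ _ ih₁ ih₂ =>
      rcases ih₁ with h | ⟨h, h'⟩ | ⟨h, h'⟩ <;> rcases ih₂ with k | ⟨k, k'⟩ | ⟨k, k'⟩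
      · exact Or.inl (r.trans' h k)
      · exact Or.inr (Or.inl ⟨r.trans' h k, k'⟩)
      · exact Or.inr (Or.inr ⟨r.trans' h k, k'⟩)
      · exact Or.inr (Or.inl ⟨h, r.trans' h' k⟩)
      · exact Or.inl (r.trans' h (r.trans' (r.symm' (r.trans' h' k)) k'))
      · exact Or.inl (r.trans' h k')
      · exact Or.inr (Or.inr ⟨h, r.trans' h' k⟩)
      · exact Or.inl (r.trans' h k')
      · exact Or.inl (r.trans' h (r.trans' (r.symm' (r.trans' h' k)) k'))
  · have hab : joined r {s(a, b)} a b := joined_of_mem rfl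
    rintro (h | ⟨h, h'⟩ | ⟨h, h'⟩)
    · exact le_joined h
    · exact Setoid.trans' _ (le_joined h) (Setoid.trans' _ hab (le_joined h'))
    · exact Setoid.trans' _ (le_joined h)
        (Setoid.trans' _ (Setoid.symm' _ hab) (le_joined h'))

lemma joined_insert_iff {a b x y : V} :
    joined r (insert s(a, b) E) x y ↔ joined r E x y ∨
      (joined r E x a ∧ joined r E b y) ∨ (joined r E x b ∧ joined r E a y) := by
  rw [← joined_singleton_iff, joined_joined, Set.union_singleton]

lemma ForestOver.mono (hE : E ⊆ F) (hr : r ≤ r') (h : ForestOver r' F) : ForestOver r E :=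
  fun e he hw => h e (hE he) (hw.mono (joined_mono hr (Set.sdiff_subset_sdiff_left hE)))

lemma forestOver_empty : ForestOver r ∅ := fun _ h => h.elim

/-- Adding one edge to a forest gives a forest exactly when the edge joins two components. -/
lemma forestOver_insert {e : Sym2 V} (he : e ∉ E) :
    ForestOver r (insert e E) ↔ ForestOver r E ∧ ¬ Within (joined r E) e := by
  constructor
  · intro h
    refine ⟨h.mono (Set.subset_insert _ _) le_rfl, ?_⟩
    have := h e (Set.mem_insert _ _)
    rwa [Set.insert_sdiff_self_of_notMem he] at this
  · rintro ⟨h, hn⟩ f hf hw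
    rcases hf with rfl | hf
    · rw [Set.insert_sdiff_self_of_notMem he] at hw
      exact hn hw
    · have hne : e ≠ f := fun h => he (h ▸ hf)
      have hset : insert e E \ {f} = insert e (E \ {f}) := by
        rw [Set.insert_sdiff_of_notMem]; simpa using hne
      rw [hset] at hw
      have hm : joined r (E \ {f}) ≤ joined r E := joined_mono le_rfl Set.sdiff_subset
      induction e with | h a b =>
      induction f with | h c d =>
      have hcd : joined r E c d := joined_of_mem hf
      rw [within_mk, joined_insert_iff] at hw
      rw [within_mk] at hn
      rcases hw with hw | ⟨h₁, h₂⟩ | ⟨h₁, h₂⟩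
      · exact h _ hf (within_mk.2 hw)
      · exact hn (Setoid.trans' _ (Setoid.symm' _ (hm h₁))
          (Setoid.trans' _ hcd (Setoid.symm' _ (hm h₂))))
      · exact hn (Setoid.trans' _ (hm h₂) (Setoid.trans' _ (Setoid.symm' _ hcd) (hm h₁)))

/-- The edges of a forest can be added in two rounds. -/
lemma forestOver_union (hF : F.Finite) (hd : Disjoint E F) :
    ForestOver r (E ∪ F) ↔ ForestOver r E ∧ ForestOver (joined r E) F := by
  induction F, hF using Set.Finite.induction_on with
  | empty => simp [forestOver_empty]
  | @insert e F he _ ih =>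
    rw [Set.disjoint_insert_right] at hd
    rw [Set.union_insert, forestOver_insert (by simp [he, hd.1]), ih hd.2, forestOver_insert he,
      joined_joined, and_assoc]

/-- Connectivity inside `S` by edges inside `S` depends only on the given relation inside `S`. -/
lemma joined_congr {S : Set V} (hrr : ∀ x ∈ S, ∀ y ∈ S, r x y ↔ r' x y) (hE : E.Finite)
    (hS : ∀ e ∈ E, ∀ x ∈ e, x ∈ S) :
    ∀ x ∈ S, ∀ y ∈ S, joined r E x y ↔ joined r' E x y := by
  induction E, hE using Set.Finite.induction_on with
  | empty => intro x hx y hy; rw [joined_empty, joined_empty]; exact hrr x hx y hy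
  | @insert e F he _ ih =>
    intro x hx y hy
    have ih' := ih fun f hf => hS f (Set.mem_insert_of_mem _ hf)
    induction e with | h a b =>
    have ha : a ∈ S := hS _ (Set.mem_insert _ _) a (by simp)
    have hb : b ∈ S := hS _ (Set.mem_insert _ _) b (by simp)
    simp only [joined_insert_iff, ih' x hx y hy, ih' x hx a ha, ih' b hb y hy, ih' x hx b hb,
      ih' a ha y hy]

lemma forestOver_congr {S : Set V} (hrr : ∀ x ∈ S, ∀ y ∈ S, r x y ↔ r' x y) (hE : E.Finite)
    (hS : ∀ e ∈ E, ∀ x ∈ e, x ∈ S) (h : ForestOver r E) : ForestOver r' E := by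
  intro e he hw
  refine h e he fun x hx y hy => ?_
  rw [joined_congr hrr (hE.subset Set.sdiff_subset) (fun f hf => hS f hf.1) x (hS e he x hx) y
    (hS e he y hy)]
  exact hw x hx y hy

/-- A forest over `r` has a proper two-colouring which is constant on the classes of `r`. -/
lemma ForestOver.exists_two_coloring (hE : E.Finite) (h : ForestOver r E) :
    ∃ f : V → Bool, (∀ x y, r x y → f x = f y) ∧ ∀ x y, s(x, y) ∈ E → f x ≠ f y := by
  classical
  induction E, hE using Set.Finite.induction_on with
  | empty => exact ⟨fun _ => true, by simp, by simp⟩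
  | @insert e F he _ ih =>
    rw [forestOver_insert he] at h
    obtain ⟨f, hf, hf'⟩ := ih h.1
    induction e with | h a b =>
    rw [within_mk] at h
    by_cases hab : f a = f b
    · -- Recolour the component of `a`, which does not contain `b`.
      refine ⟨fun x => if joined r F x a then !f x else f x, fun x y hxy => ?_,
        fun x y hxy => ?_⟩
      · have hiff : joined r F x a ↔ joined r F y a :=
          ⟨fun g => Setoid.trans' _ (Setoid.symm' _ (le_joined hxy)) g,
            fun g => Setoid.trans' _ (le_joined hxy) g⟩
        simp only [hiff, hf x y hxy]
      · have hb : ¬ joined r F b a := fun g => h.2 (Setoid.symm' _ g)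
        have ha : joined r F a a := Setoid.refl' _ _
        rcases hxy with hxy | hxy
        · rcases Sym2.eq_iff.1 hxy with ⟨rfl, rfl⟩ | ⟨rfl, rfl⟩ <;> simp [hb, hab]
        · have hj : joined r F x y := joined_of_mem hxy
          have hiff : joined r F x a ↔ joined r F y a :=
            ⟨fun g => Setoid.trans' _ (Setoid.symm' _ hj) g, fun g => Setoid.trans' _ hj g⟩
          have := hf' x y hxy
          simp only [hiff]
          split_ifs <;> simpa using this
    · refine ⟨f, hf, fun x y hxy => ?_⟩
      rcases hxy with hxy | hxy
      · rcases Sym2.eq_iff.1 hxy with ⟨rfl, rfl⟩ | ⟨rfl, rfl⟩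
        · exact hab
        · exact fun g => hab g.symm
      · exact hf' x y hxy

lemma joined_bot_iff_reachable (H : SimpleGraph V) {x y : V} :
    joined ⊥ H.edgeSet x y ↔ H.Reachable x y := by
  constructor
  · have : joined ⊥ H.edgeSet ≤ H.reachableSetoid :=
      joined_le bot_le fun a b hab => SimpleGraph.Adj.reachable hab
    exact fun h => this h
  · rintro ⟨p⟩
    induction p with
    | nil => exact Setoid.refl' _ _
    | cons h _ ih => exact Setoid.trans' _ (joined_of_mem h) ih

lemma forestOver_bot_iff_isAcyclic (H : SimpleGraph V) :
    ForestOver ⊥ H.edgeSet ↔ H.IsAcyclic := by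
  rw [SimpleGraph.isAcyclic_iff_forall_adj_isBridge]
  constructor
  · intro h v w hvw
    rw [SimpleGraph.isBridge_iff, ← joined_bot_iff_reachable, SimpleGraph.edgeSet_deleteEdges,
      ← within_mk]
    exact h _ hvw
  · intro h e he
    induction e with | h v w =>
    have := h he
    rwa [SimpleGraph.isBridge_iff, ← joined_bot_iff_reachable, SimpleGraph.edgeSet_deleteEdges,
      ← within_mk] at this

end Forest

/-! ### The two graph properties -/

section Good

variable {V : Type*}

/-- The edges of `G` with both endpoints in `S`. -/
def edgesIn (G : SimpleGraph V) (S : Set V) : Set (Sym2 V) :=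
  {e ∈ G.edgeSet | ∀ x ∈ e, x ∈ S}

@[simp]
lemma mk_mem_edgesIn {G : SimpleGraph V} {S : Set V} {x y : V} :
    s(x, y) ∈ edgesIn G S ↔ G.Adj x y ∧ x ∈ S ∧ y ∈ S := by
  simp [edgesIn]

lemma edgesIn_mono {G : SimpleGraph V} {S S' : Set V} (h : S ⊆ S') :
    edgesIn G S ⊆ edgesIn G S' := fun _ he => ⟨he.1, fun x hx => h (he.2 x hx)⟩

/-- `S` induces a forest over `r`: a forest if `r = ⊥`, and an independent set if `r = ⊤`. -/
def Good (r : Setoid V) (G : SimpleGraph V) (S : Set V) : Prop :=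
  ForestOver r (edgesIn G S)

lemma Good.mono {r : Setoid V} {G : SimpleGraph V} {S S' : Set V} (h : S ⊆ S')
    (hg : Good r G S') : Good r G S :=
  ForestOver.mono (edgesIn_mono h) le_rfl hg

lemma good_top_iff {G : SimpleGraph V} {S : Set V} : Good ⊤ G S ↔ G.IsIndepSet S := by
  constructor
  · intro h x hx y hy _ hxy
    exact h s(x, y) (by simp [hx, hy, hxy]) fun _ _ _ _ => le_joined trivial
  · intro h e he
    induction e with | h x y =>
    simp only [mk_mem_edgesIn] at he
    exact (h he.2.1 he.2.2 he.1.ne he.1).elim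

lemma good_bot_iff {G : SimpleGraph V} {S : Set V} : Good ⊥ G S ↔ (G.induce S).IsAcyclic := by
  have hE : edgesIn G S = (G.induce S).spanningCoe.edgeSet := by
    ext e
    induction e with | h x y =>
    simp only [mk_mem_edgesIn, SimpleGraph.mem_edgeSet, SimpleGraph.spanningCoe,
      SimpleGraph.map_adj, SimpleGraph.comap_adj, Function.Embedding.subtype_apply]
    constructor
    · rintro ⟨h, hx, hy⟩
      exact ⟨⟨x, hx⟩, ⟨y, hy⟩, h, rfl, rfl⟩
    · rintro ⟨a, b, h, rfl, rfl⟩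
      exact ⟨h, a.2, b.2⟩
  rw [Good, hE, forestOver_bot_iff_isAcyclic]
  constructor
  · exact fun h => SimpleGraph.IsAcyclic.of_map _ h
  · intro h v c hc
    -- All vertices of a cycle lie on edges, hence in `S`, so that the cycle lives in `G.induce S`.
    have hsub : ∀ x ∈ c.support, x ∈ S := by
      intro x hx
      obtain ⟨e, he, hxe⟩ := (SimpleGraph.Walk.mem_support_iff_exists_mem_edges_of_not_nil
        (fun hn => hc.ne_nil (SimpleGraph.Walk.eq_nil_iff_nil.2 hn))).1 hx
      have := c.edges_subset_edgeSet he
      rw [← hE] at this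
      exact this.2 x hxe
    have hcyc : (c.induce S hsub).IsCycle := by
      rw [← c.map_induce hsub] at hc
      exact hc.of_map
    rw [← SimpleGraph.induce_spanningCoe (G := G.induce S)] at h
    exact h _ hcyc

end Good

/-! ### Irredundant sets and small covers -/

section Irredundant

variable {V : Type*} {G : SimpleGraph V} {A : Set V}

/-- `R` is an independent subset of `A` in which every vertex has a private neighbour outside `A`.
These are the `A`-sides of the induced matchings measured by `umim G A`. -/
def Irredundant (G : SimpleGraph V) (A : Set V) (R : Finset V) : Prop :=
  (∀ r ∈ R, r ∈ A) ∧ (∀ r ∈ R, ∀ r' ∈ R, ¬ G.Adj r r') ∧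
    ∀ r ∈ R, ∃ y, y ∉ A ∧ G.Adj r y ∧ ∀ r' ∈ R, G.Adj r' y → r' = r

/-- `A` contains an irredundant set of size `p`. -/
def HasIrredundant (G : SimpleGraph V) (A : Set V) (p : ℕ) : Prop :=
  ∃ R : Finset V, Irredundant G A R ∧ R.card = p

lemma Irredundant.subset {R R' : Finset V} (h : Irredundant G A R) (hR : R' ⊆ R) :
    Irredundant G A R' := by
  refine ⟨fun r hr => h.1 r (hR hr), fun r hr r' hr' => h.2.1 r (hR hr) r' (hR hr'),
    fun r hr => ?_⟩
  obtain ⟨y, hy, hry, hp⟩ := h.2.2 r (hR hr)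
  exact ⟨y, hy, hry, fun r' hr' => hp r' (hR hr')⟩

lemma Irredundant.card_le {R : Finset V} {p : ℕ} (h : Irredundant G A R)
    (hp : ¬ HasIrredundant G A (p + 1)) : R.card ≤ p := by
  by_contra hc
  obtain ⟨R', hR', hcard⟩ := Finset.exists_subset_card_eq (show p + 1 ≤ R.card by omega)
  exact hp ⟨R', h.subset hR', hcard⟩

lemma exists_half_filter {α : Type*} (P : Finset α) (f : α → Bool) :
    ∃ b, P.card ≤ 2 * (P.filter fun x => f x = b).card := by
  have h := Finset.card_filter_add_card_filter_not (s := P) (fun x => f x = true)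
  simp only [Bool.not_eq_true] at h
  by_cases hc : P.card ≤ 2 * (P.filter fun x => f x = true).card
  · exact ⟨true, hc⟩
  · exact ⟨false, by omega⟩

/-- `P` is a matching of edges from `X` to `Y`, given as pairs of endpoints. -/
structure CutMatching (G : SimpleGraph V) (X Y : Set V) (P : Finset (V × V)) : Prop where
  fst_mem : ∀ p ∈ P, p.1 ∈ X
  snd_mem : ∀ p ∈ P, p.2 ∈ Y
  adj : ∀ p ∈ P, G.Adj p.1 p.2
  fst_inj : ∀ p ∈ P, ∀ q ∈ P, p.1 = q.1 → p = q
  snd_inj : ∀ p ∈ P, ∀ q ∈ P, p.2 = q.2 → p = q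

variable [Fintype V] [DecidableEq V]

/-- In a forest, half of the edges of a matching across a cut form an induced matching: contracting
the matching leaves a two-colourable graph. So the two sides of that half are irredundant. -/
lemma CutMatching.exists_irredundant {X Y : Set V} {P : Finset (V × V)}
    (hP : CutMatching G X Y P) (hX : X ⊆ A) (hY : Y ⊆ Aᶜ) (hg : Good ⊥ G (X ∪ Y)) :
    ∃ p, P.card ≤ 2 * p ∧ HasIrredundant G A p ∧ HasIrredundant G Aᶜ p := by
  set M : Set (Sym2 V) := {e | ∃ p ∈ P, e = s(p.1, p.2)} with hM
  have hME : M ⊆ edgesIn G (X ∪ Y) := by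
    rintro _ ⟨p, hp, rfl⟩
    simp [hP.adj p hp, hP.fst_mem p hp, hP.snd_mem p hp]
  have hsplit : ForestOver ⊥ (M ∪ edgesIn G (X ∪ Y) \ M) := by
    rwa [Set.union_sdiff_cancel hME]
  obtain ⟨f, hf, hf'⟩ := ForestOver.exists_two_coloring (Set.toFinite _)
    ((forestOver_union (Set.toFinite _) Set.disjoint_sdiff_right).1 hsplit).2
  have hfM : ∀ p ∈ P, f p.1 = f p.2 := fun p hp => hf _ _ (joined_of_mem ⟨p, hp, rfl⟩)
  obtain ⟨b, hb⟩ := exists_half_filter P fun p => f p.1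
  set Q := P.filter fun p => f p.1 = b
  have hQP : ∀ p ∈ Q, p ∈ P := fun p hp => (Finset.mem_filter.1 hp).1
  have hQ₁ : ∀ p ∈ Q, f p.1 = b := fun p hp => (Finset.mem_filter.1 hp).2
  have hQ₂ : ∀ p ∈ Q, f p.2 = b := fun p hp => by rw [← hfM p (hQP p hp)]; exact hQ₁ p hp
  have hx : ∀ p ∈ Q, p.1 ∈ X := fun p hp => hP.fst_mem p (hQP p hp)
  have hy : ∀ p ∈ Q, p.2 ∈ Y := fun p hp => hP.snd_mem p (hQP p hp)
  have hAx : ∀ p ∈ Q, p.1 ∈ A := fun p hp => hX (hx p hp)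
  have hAy : ∀ p ∈ Q, p.2 ∉ A := fun p hp => hY (hy p hp)
  -- Edges between vertices of the same colour belong to the matching.
  have key : ∀ u v, u ∈ X ∪ Y → v ∈ X ∪ Y → f u = f v → G.Adj u v → s(u, v) ∈ M := by
    intro u v hu hv huv hadj
    by_contra hn
    exact hf' u v ⟨mk_mem_edgesIn.2 ⟨hadj, hu, hv⟩, hn⟩ huv
  have hcross : ∀ p ∈ Q, ∀ q ∈ Q, G.Adj p.1 q.2 → p = q := by
    intro p hp q hq h
    obtain ⟨t, ht, hte⟩ := key _ _ (Or.inl (hx p hp)) (Or.inr (hy q hq))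
      ((hQ₁ p hp).trans (hQ₂ q hq).symm) h
    rcases Sym2.eq_iff.1 hte with ⟨h₁, h₂⟩ | ⟨h₁, h₂⟩
    · exact (hP.fst_inj p (hQP p hp) t ht h₁).trans (hP.snd_inj q (hQP q hq) t ht h₂).symm
    · exact absurd (hX (hP.fst_mem t ht)) (h₂ ▸ hAy q hq)
  have hxx : ∀ p ∈ Q, ∀ q ∈ Q, ¬ G.Adj p.1 q.1 := by
    intro p hp q hq h
    obtain ⟨t, ht, hte⟩ := key _ _ (Or.inl (hx p hp)) (Or.inl (hx q hq))
      ((hQ₁ p hp).trans (hQ₁ q hq).symm) h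
    rcases Sym2.eq_iff.1 hte with ⟨h₁, h₂⟩ | ⟨h₁, h₂⟩
    · exact hY (hP.snd_mem t ht) (h₂ ▸ hAx q hq)
    · exact hY (hP.snd_mem t ht) (h₁ ▸ hAx p hp)
  have hyy : ∀ p ∈ Q, ∀ q ∈ Q, ¬ G.Adj p.2 q.2 := by
    intro p hp q hq h
    obtain ⟨t, ht, hte⟩ := key _ _ (Or.inr (hy p hp)) (Or.inr (hy q hq))
      ((hQ₂ p hp).trans (hQ₂ q hq).symm) h
    rcases Sym2.eq_iff.1 hte with ⟨h₁, h₂⟩ | ⟨h₁, h₂⟩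
    · exact hAy p hp (h₁ ▸ hX (hP.fst_mem t ht))
    · exact hAy q hq (h₂ ▸ hX (hP.fst_mem t ht))
  refine ⟨Q.card, hb, ⟨Q.image Prod.fst, ⟨?_, ?_, ?_⟩, ?_⟩, ⟨Q.image Prod.snd, ⟨?_, ?_, ?_⟩, ?_⟩⟩
  · simp only [Finset.mem_image]
    rintro _ ⟨p, hp, rfl⟩
    exact hAx p hp
  · simp only [Finset.mem_image]
    rintro _ ⟨p, hp, rfl⟩ _ ⟨q, hq, rfl⟩
    exact hxx p hp q hq
  · simp only [Finset.mem_image]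
    rintro _ ⟨p, hp, rfl⟩
    refine ⟨p.2, hAy p hp, hP.adj p (hQP p hp), ?_⟩
    rintro _ ⟨q, hq, rfl⟩ h
    rw [hcross q hq p hp h]
  · exact Finset.card_image_of_injOn fun p hp q hq h => hP.fst_inj p (hQP p hp) q (hQP q hq) h
  · simp only [Finset.mem_image]
    rintro _ ⟨p, hp, rfl⟩
    exact hAy p hp
  · simp only [Finset.mem_image]
    rintro _ ⟨p, hp, rfl⟩ _ ⟨q, hq, rfl⟩
    exact hyy p hp q hq
  · simp only [Finset.mem_image]
    rintro _ ⟨p, hp, rfl⟩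
    refine ⟨p.1, fun h => h (hAx p hp), (hP.adj p (hQP p hp)).symm, ?_⟩
    rintro _ ⟨q, hq, rfl⟩ h
    rw [hcross p hp q hq h.symm]
  · exact Finset.card_image_of_injOn fun p hp q hq h => hP.snd_inj p (hQP p hp) q (hQP q hq) h

/-- The endpoints of a maximal matching cover all edges between `X` and `Y`. -/
lemma exists_cutMatching_cover (G : SimpleGraph V) (X Y : Set V) :
    ∃ P, CutMatching G X Y P ∧
      ∀ x ∈ X, ∀ y ∈ Y, G.Adj x y → x ∈ P.image Prod.fst ∨ y ∈ P.image Prod.snd := by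
  classical
  obtain ⟨P, hP, hmax⟩ := Finset.exists_max_image
    (Finset.univ.filter fun P => CutMatching G X Y P) Finset.card
    ⟨∅, by simpa using ⟨by simp, by simp, by simp, by simp, by simp⟩⟩
  simp only [Finset.mem_filter, Finset.mem_univ, true_and] at hP hmax
  refine ⟨P, hP, fun x hx y hy hxy => ?_⟩
  by_contra hc
  simp only [Finset.mem_image, not_or, not_exists, not_and] at hc
  have hn : (x, y) ∉ P := fun h => hc.1 _ h rfl
  have := hmax (insert (x, y) P) ?_
  · rw [Finset.card_insert_of_notMem hn] at this
    omega
  · constructor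
    · simpa [hx] using hP.fst_mem
    · simpa [hy] using hP.snd_mem
    · simpa [hxy] using hP.adj
    · intro p hp q hq h
      rcases Finset.mem_insert.1 hp with rfl | hp <;> rcases Finset.mem_insert.1 hq with rfl | hq
      · rfl
      · exact (hc.1 q hq h.symm).elim
      · exact (hc.1 p hp h).elim
      · exact hP.fst_inj p hp q hq h
    · intro p hp q hq h
      rcases Finset.mem_insert.1 hp with rfl | hp <;> rcases Finset.mem_insert.1 hq with rfl | hq
      · rfl
      · exact (hc.2 q hq h.symm).elim
      · exact (hc.2 p hp h).elim
      · exact hP.snd_inj p hp q hq h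

/-- If `A` has no large irredundant set, the neighbourhood outside `A` of a set `X ⊆ A` inducing a
forest is the neighbourhood of a small subset: in a minimal such subset every vertex has a private
neighbour, and one colour class of a two-colouring of it is independent. -/
lemma exists_small_neighborhood {X : Set V} {κ : ℕ} (hX : X ⊆ A) (hg : Good ⊥ G X)
    (hκ : ¬ HasIrredundant G A (κ + 1)) :
    ∃ R : Finset V, R.card ≤ 2 * κ ∧ (∀ r ∈ R, r ∈ X) ∧
      ∀ y, y ∉ A → ∀ x ∈ X, G.Adj x y → ∃ r ∈ R, G.Adj r y := by
  classical
  obtain ⟨R, hR, hmin⟩ := Finset.exists_min_image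
    (Finset.univ.filter fun R : Finset V => (∀ r ∈ R, r ∈ X) ∧
      ∀ y, y ∉ A → ∀ x ∈ X, G.Adj x y → ∃ r ∈ R, G.Adj r y) Finset.card
    ⟨X.toFinset, by simpa using fun y _ x hx h => ⟨x, hx, h⟩⟩
  simp only [Finset.mem_filter, Finset.mem_univ, true_and] at hR hmin
  refine ⟨R, ?_, hR.1, hR.2⟩
  obtain ⟨f, -, hf⟩ := ForestOver.exists_two_coloring (Set.toFinite _) hg
  obtain ⟨b, hb⟩ := exists_half_filter R f
  have hirr : Irredundant G A (R.filter fun x => f x = b) := by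
    refine ⟨fun r hr => hX (hR.1 r (Finset.mem_filter.1 hr).1), fun r hr r' hr' h => ?_,
      fun r hr => ?_⟩
    · rw [Finset.mem_filter] at hr hr'
      exact hf r r' (mk_mem_edgesIn.2 ⟨h, hR.1 r hr.1, hR.1 r' hr'.1⟩) (hr.2.trans hr'.2.symm)
    · rw [Finset.mem_filter] at hr
      by_contra hno
      push Not at hno
      have hlt := Finset.card_erase_lt_of_mem hr.1
      have := hmin (R.erase r) ⟨fun r' hr' => hR.1 r' (Finset.mem_of_mem_erase hr'), ?_⟩
      · omega
      · intro y hy x hx hxy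
        obtain ⟨r', hr', hry⟩ := hR.2 y hy x hx hxy
        by_cases hrr : r' = r
        · subst hrr
          obtain ⟨r'', hr'', h₁, h₂⟩ := hno y hy hry
          exact ⟨r'', Finset.mem_erase.2 ⟨h₂, (Finset.mem_filter.1 hr'').1⟩, h₁⟩
        · exact ⟨r', Finset.mem_erase.2 ⟨hrr, hr'⟩, hry⟩
  have := hirr.card_le hκ
  omega

end Irredundant

/-! ### Tests for partial solutions -/

section Test

variable {V : Type*}

/-- A test for partial solutions `X ⊆ A`. It describes a partial solution `Y` outside `A` up to what
matters for the combination of the two: `bd` is a small set covering all edges between the two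
sides, `lab` records which vertices are connected through `Y`, and `R` determines which vertices of
`A` have a neighbour in the uncovered part of `Y`. If `outer`, then `R` has the neighbourhood in `A`
of that part of `Y`; otherwise it has the neighbourhood outside `A` of the uncovered part of the
partial solutions that pass. -/
structure Test (V : Type*) where
  outer : Prop
  bd : Set V
  lab : V → ℕ
  R : Set V

open Classical in
/-- `v` has no neighbour in `R` if `R` is on the other side of the cut `A`, and only neighbours of
`R` as neighbours outside `A` otherwise. -/
def Unblocked (G : SimpleGraph V) (A : Set V) (outer : Prop) (R : Set V) (v : V) : Prop :=
  if outer then ∀ u ∈ R, ¬ G.Adj u v else ∀ y, y ∉ A → G.Adj v y → ∃ u ∈ R, G.Adj u y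

/-- The vertices allowed in a partial solution passing the test. -/
def Test.allowed (G : SimpleGraph V) (A : Set V) (T : Test V) : Set V :=
  {v | v ∈ A ∧ (v ∈ T.bd ∨ Unblocked G A T.outer T.R v)}

/-- The edges inside `X` and between `X` and the part of `D` outside `A`. -/
def testEdges (G : SimpleGraph V) (A D X : Set V) : Set (Sym2 V) :=
  {e | ∃ x y, e = s(x, y) ∧ G.Adj x y ∧ x ∈ X ∧ (y ∈ X ∨ (y ∈ D ∧ y ∉ A))}

/-- The partial solution `X` passes the test `T` for the cut `A`. -/
def Test.Passes (G : SimpleGraph V) (A : Set V) (T : Test V) (X : Set V) : Prop :=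
  X ⊆ T.allowed G A ∧ ForestOver (Setoid.ker T.lab) (testEdges G A T.bd X)

variable [Fintype V] [DecidableEq V] {G : SimpleGraph V} {A : Set V}

/-- The test with the given data; vertices outside `bd` are labelled by themselves. -/
def Test.mk' (outer : Prop) (bd R : Finset V) (l : V → V) (base : V → ℕ) : Test V :=
  ⟨outer, bd, fun v => base (if v ∈ bd then l v else v), R⟩

/-- The exchange property: for compatible partial solutions `X` and `Y` there is a small test
passed by `X` all of whose passing sets are compatible with `Y`. -/
theorem exists_test {X Y : Set V} {κ : ℕ} (base : V → ℕ)
    (hbase : Setoid.ker base = ⊥ ∨ Setoid.ker base = ⊤)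
    (hκ : ¬ HasIrredundant G A (κ + 1) ∨ ¬ HasIrredundant G Aᶜ (κ + 1))
    (hX : X ⊆ A) (hY : Y ⊆ Aᶜ) (hg : Good (Setoid.ker base) G (X ∪ Y)) :
    ∃ (outer : Prop) (bd R : Finset V) (l : V → V), bd.card ≤ 4 * κ ∧ R.card ≤ 4 * κ ∧
      (Test.mk' outer bd R l base).Passes G A X ∧
      ∀ X', (Test.mk' outer bd R l base).Passes G A X' → Good (Setoid.ker base) G (X' ∪ Y) := by
  have hg' : Good ⊥ G (X ∪ Y) := ForestOver.mono subset_rfl bot_le hg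
  obtain ⟨P, hP, hcov⟩ := exists_cutMatching_cover G X Y
  obtain ⟨p, hPp, hp, hp'⟩ := hP.exists_irredundant hX hY hg'
  have hpκ : p ≤ κ := by
    rcases hκ with hκ | hκ
    · obtain ⟨R, hR, rfl⟩ := hp
      exact hR.card_le hκ
    · obtain ⟨R, hR, rfl⟩ := hp'
      exact hR.card_le hκ
  set B := P.image Prod.fst with hB
  set D := P.image Prod.snd with hD
  have hBX : ∀ b ∈ B, b ∈ X := by
    simp only [hB, Finset.mem_image]; rintro _ ⟨q, hq, rfl⟩; exact hP.fst_mem q hq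
  have hDY : ∀ d ∈ D, d ∈ Y := by
    simp only [hD, Finset.mem_image]; rintro _ ⟨q, hq, rfl⟩; exact hP.snd_mem q hq
  have hBc : B.card ≤ P.card := Finset.card_image_le
  have hDc : D.card ≤ P.card := Finset.card_image_le
  have hbdc : (B ∪ D).card ≤ 4 * κ := (Finset.card_union_le _ _).trans (by omega)
  have hbdA : ∀ v ∈ B ∪ D, v ∈ A → v ∈ B := fun v hv hvA =>
    (Finset.mem_union.1 hv).resolve_right fun h => hY (hDY v h) hvA
  have hbdA' : ∀ v ∈ B ∪ D, v ∉ A → v ∈ D := fun v hv hvA =>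
    (Finset.mem_union.1 hv).resolve_left fun h => hvA (hX (hBX v h))
  obtain ⟨outer, R, hRc, hRX, hRY⟩ : ∃ (outer : Prop) (R : Finset V), R.card ≤ 4 * κ ∧
      (∀ x ∈ X, x ∉ B → Unblocked G A outer R x) ∧
      (∀ x ∈ A, Unblocked G A outer R x → ∀ y ∈ Y, y ∉ D → ¬ G.Adj x y) := by
    rcases hκ with hκ | hκ
    · obtain ⟨R, hRc, hRX, hR⟩ := exists_small_neighborhood (X := X \ B)
        (Set.sdiff_subset.trans hX)
        (hg'.mono (Set.sdiff_subset.trans Set.subset_union_left)) hκ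
      refine ⟨False, R, by omega, fun x hx hxB => ?_, fun x hx h y hy hyD hxy => ?_⟩
      · rw [Unblocked, if_neg not_false]
        exact fun y hy hxy => hR y hy x ⟨hx, hxB⟩ hxy
      · rw [Unblocked, if_neg not_false] at h
        obtain ⟨u, hu, huy⟩ := h y (hY hy) hxy
        rcases hcov u (hRX u hu).1 y hy huy with h | h
        · exact (hRX u hu).2 h
        · exact hyD h
    · obtain ⟨R, hRc, hRY, hR⟩ := exists_small_neighborhood (X := Y \ D)
        (Set.sdiff_subset.trans hY)
        (hg'.mono (Set.sdiff_subset.trans Set.subset_union_right)) hκ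
      refine ⟨True, R, by omega, fun x hx hxB => ?_, fun x hx h y hy hyD hxy => ?_⟩
      · rw [Unblocked, if_pos trivial]
        intro u hu hux
        rcases hcov x hx u (hRY u hu).1 hux.symm with h | h
        · exact hxB h
        · exact (hRY u hu).2 h
      · rw [Unblocked, if_pos trivial] at h
        obtain ⟨u, hu, hux⟩ := hR x (fun hn => hn hx) y ⟨hy, hyD⟩ hxy.symm
        exact h u hu hux
  set r₀ := Setoid.ker base
  set EX : Set V → Set (Sym2 V) := testEdges G A (B ∪ D : Finset V) with hEX
  -- The edges inside `X ∪ Y` that do not depend on `X`, apart from its covered part.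
  set EY := edgesIn G (X ∪ Y) \ EX X with hEY
  have hEXsub : EX X ⊆ edgesIn G (X ∪ Y) := by
    rintro _ ⟨x, y, rfl, hxy, hx, hy | ⟨hy, hyA⟩⟩
    · simp [hxy, hx, hy]
    · simp [hxy, hx, hDY y (hbdA' y hy hyA)]
  have hEYends : ∀ a b, s(a, b) ∈ EY → a ∈ A → a ∈ B := by
    rintro a b ⟨hab, hn⟩ ha
    rw [mk_mem_edgesIn] at hab
    obtain ⟨hab, haXY, hbXY⟩ := hab
    have haX : a ∈ X := haXY.resolve_right fun h => hY h ha
    rcases hbXY with hb | hb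
    · exact (hn ⟨a, b, rfl, hab, haX, Or.inl hb⟩).elim
    · refine (hcov a haX b hb hab).resolve_right fun hbD => hn ⟨a, b, rfl, hab, haX, Or.inr ?_⟩
      exact ⟨Finset.mem_coe.2 (Finset.mem_union_right _ hbD), hY hb⟩
  set r₁ := joined r₀ EY with hr₁
  let l : V → V := fun v => (Quotient.mk r₁ v).out
  have hl : ∀ v, r₁ (l v) v := fun v => Quotient.exact (Quotient.out_eq _)
  set T := Test.mk' outer (B ∪ D) R l base with hT
  -- On `A` and the boundary, the labels describe connectivity through `Y`.
  have hagree : ∀ x ∈ A ∪ D, ∀ y ∈ A ∪ (D : Set V), r₁ x y ↔ Setoid.ker T.lab x y := by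
    intro x hx y hy
    have hrep : ∀ v, r₁ v (if v ∈ B ∪ D then l v else v) := by
      intro v
      split_ifs
      · exact r₁.symm' (hl v)
      · exact r₁.refl' v
    have hiff : Setoid.ker T.lab x y ↔ r₀ (if x ∈ B ∪ D then l x else x)
        (if y ∈ B ∪ D then l y else y) := Iff.rfl
    rw [hiff]
    constructor
    · intro h
      rcases hbase with hb | hb
      swap
      · rw [show r₀ = ⊤ from hb]; trivial
      have hisol : ∀ v ∈ A ∪ (D : Set V), v ∉ B ∪ D → ∀ u, r₁ v u → u = v := by
        intro v hv hvn u hvu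
        have hvA : v ∈ A := hv.resolve_right fun h => hvn (Finset.mem_union_right _ h)
        have hvB : v ∉ B := fun h => hvn (Finset.mem_union_left _ h)
        have hle : r₁ ≤ Setoid.ker fun w => w = v := by
          refine joined_le (by rw [show r₀ = ⊥ from hb]; exact bot_le) fun a b hab => ?_
          rw [Setoid.ker_def]
          have h₁ : a ≠ v := fun h => hvB (h ▸ hEYends a b hab (h ▸ hvA))
          have h₂ : b ≠ v := fun h => hvB (h ▸ hEYends b a (Sym2.eq_swap ▸ hab) (h ▸ hvA))
          simp [h₁, h₂]
        have := hle hvu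
        rw [Setoid.ker_def] at this
        simpa using this
      by_cases hxb : x ∈ B ∪ D
      · by_cases hyb : y ∈ B ∪ D
        · rw [if_pos hxb, if_pos hyb]
          have : l x = l y := congrArg Quotient.out (Quotient.sound (s := r₁) h)
          rw [this]
        · have := hisol y hy hyb x (r₁.symm' h)
          subst this
          exact (hyb hxb).elim
      · have := hisol x hx hxb y h
        subst this
        exact r₀.refl' _
    · intro h
      exact r₁.trans' (hrep x) (r₁.trans' (le_joined h) (r₁.symm' (hrep y)))
  have hends : ∀ X', X' ⊆ A → ∀ e ∈ EX X', ∀ v ∈ e, v ∈ A ∪ (D : Set V) := by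
    rintro X' hX' _ ⟨x, y, rfl, -, hx, hy⟩ v hv
    rcases Sym2.mem_iff.1 hv with rfl | rfl
    · exact Or.inl (hX' hx)
    · rcases hy with hy | ⟨hy, hyA⟩
      · exact Or.inl (hX' hy)
      · exact Or.inr (hbdA' _ hy hyA)
  have hforest : ForestOver r₀ EY ∧ ForestOver r₁ (EX X) := by
    rw [← forestOver_union (Set.toFinite _) Set.disjoint_sdiff_left,
    Set.sdiff_union_of_subset hEXsub]
    exact hg
  refine ⟨outer, B ∪ D, R, l, hbdc, hRc, ⟨fun x hx => ⟨hX hx, ?_⟩, ?_⟩, ?_⟩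
  · by_cases hxB : x ∈ B
    · exact Or.inl (Finset.mem_coe.2 (Finset.mem_union_left _ hxB))
    · exact Or.inr (hRX x hx hxB)
  · exact forestOver_congr hagree (Set.toFinite _) (hends X hX) hforest.2
  · rintro X' ⟨hall, hf⟩
    have hX'A : X' ⊆ A := fun x hx => (hall hx).1
    have hdisj : Disjoint EY (EX X') := by
      rw [Set.disjoint_left]
      rintro _ he ⟨x, y, rfl, hxy, hx, hy⟩
      have hxX : x ∈ X := hBX x (hEYends x y he (hX'A hx))
      refine he.2 ⟨x, y, rfl, hxy, hxX, hy.imp_left fun hy => ?_⟩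
      exact hBX y (hEYends y x (Sym2.eq_swap ▸ he) (hX'A hy))
    have hun : ForestOver r₀ (EY ∪ EX X') := by
      rw [forestOver_union (Set.toFinite _) hdisj]
      exact ⟨hforest.1, forestOver_congr (fun x hx y hy => (hagree x hx y hy).symm)
        (Set.toFinite _) (hends X' hX'A) hf⟩
    refine hun.mono (fun e he => ?_) le_rfl
    induction e with | h a b =>
    rw [mk_mem_edgesIn] at he
    obtain ⟨hab, ha, hb⟩ := he
    have hmix : ∀ a b, G.Adj a b → a ∈ X' → b ∈ Y → s(a, b) ∈ EY ∪ EX X' := by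
      intro a b hab ha hb
      by_cases hbD : b ∈ D
      · exact Or.inr ⟨a, b, rfl, hab, ha,
          Or.inr ⟨Finset.mem_coe.2 (Finset.mem_union_right _ hbD), hY hb⟩⟩
      · left
        have haB : a ∈ B := by
          rcases (hall ha).2 with h | h
          · exact hbdA a h (hX'A ha)
          · exact (hRY a (hX'A ha) h b hb hbD hab).elim
        refine ⟨mk_mem_edgesIn.2 ⟨hab, Or.inl (hBX a haB), Or.inr hb⟩, ?_⟩
        rintro ⟨x, y, he, -, hx, hy⟩
        rcases Sym2.eq_iff.1 he with ⟨rfl, rfl⟩ | ⟨rfl, rfl⟩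
        · rcases hy with hy | ⟨hy, hyA⟩
          · exact hY hb (hX hy)
          · exact hbD (hbdA' _ hy hyA)
        · exact hY hb (hX hx)
    rcases ha with ha | ha <;> rcases hb with hb | hb
    · exact Or.inr ⟨a, b, rfl, hab, ha, Or.inl hb⟩
    · exact hmix a b hab ha hb
    · rw [Sym2.eq_swap]; exact hmix b a hab.symm hb ha
    · left
      refine ⟨mk_mem_edgesIn.2 ⟨hab, Or.inr ha, Or.inr hb⟩, ?_⟩
      rintro ⟨x, y, he, -, hx, -⟩
      rcases Sym2.eq_iff.1 he with ⟨rfl, rfl⟩ | ⟨rfl, rfl⟩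
      · exact hY ha (hX hx)
      · exact hY hb (hX hx)

end Test

/-! ### Representative families -/

section Represents

variable {V : Type*} {G : SimpleGraph V} {A A₁ A₂ : Set V} {r : Setoid V} {w : V → ℕ}

/-- In the search for a good set of maximum weight, only the members of `F` need to be considered
as its part inside `A`. -/
def Represents (r : Setoid V) (G : SimpleGraph V) (w : V → ℕ) (A : Set V)
    (F : Set (Finset V)) : Prop :=
  ∀ (X : Finset V) (Y : Set V), (X : Set V) ⊆ A → Y ⊆ Aᶜ → Good r G (X ∪ Y) →
    ∃ X' ∈ F, (X' : Set V) ⊆ A ∧ ∑ v ∈ X, w v ≤ ∑ v ∈ X', w v ∧ Good r G (X' ∪ Y)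

/-- The tests `τ` detect compatibility across the cut `A`. -/
def CompleteTests {ι : Type*} (r : Setoid V) (G : SimpleGraph V) (A : Set V)
    (τ : ι → Test V) : Prop :=
  ∀ X Y : Set V, X ⊆ A → Y ⊆ Aᶜ → Good r G (X ∪ Y) →
    ∃ i, (τ i).Passes G A X ∧ ∀ X', (τ i).Passes G A X' → Good r G (X' ∪ Y)

/-- Keeping a heaviest passing candidate for every test yields a representative family. The empty
set serves as the default choice. -/
lemma Represents.prune {ι : Type*} {τ : ι → Test V} (hτ : CompleteTests r G A τ)
    {C : Set (Finset V)} (hC : Represents r G w A (insert ∅ C)) {K : ι → Finset V}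
    (hK : ∀ i, K i = ∅ ∨ (τ i).Passes G A (K i))
    (hmax : ∀ i, ∀ X ∈ C, (τ i).Passes G A X → ∑ v ∈ X, w v ≤ ∑ v ∈ K i, w v) :
    Represents r G w A (Set.range K) := by
  intro X Y hX hY hg
  obtain ⟨X', hX', hX'A, hw, hg'⟩ := hC X Y hX hY hg
  obtain ⟨i, hi, hgood⟩ := hτ X' Y hX'A hY hg'
  refine ⟨K i, ⟨i, rfl⟩, ?_, hw.trans ?_, ?_⟩
  · rcases hK i with h | h
    · simp [h]
    · exact fun x hx => (h.1 hx).1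
  · rcases hX' with rfl | hX'
    · simp
    · exact hmax i X' hX' hi
  · rcases hK i with h | h
    · rw [h]; exact hg.mono (by simp)
    · exact hgood _ h

lemma Represents.mono {F F' : Set (Finset V)} (h : Represents r G w A F) (hF : F ⊆ F') :
    Represents r G w A F' := by
  intro X Y hX hY hg
  obtain ⟨X', hX', h'⟩ := h X Y hX hY hg
  exact ⟨X', hF hX', h'⟩

/-- The unions of the members of two families. -/
def unions [DecidableEq V] (F₁ F₂ : Set (Finset V)) : Set (Finset V) :=
  {X | ∃ X₁ ∈ F₁, ∃ X₂ ∈ F₂, X = X₁ ∪ X₂}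

lemma Represents.union [DecidableEq V] {F₁ F₂ : Set (Finset V)}
    (h₁ : Represents r G w A₁ F₁) (h₂ : Represents r G w A₂ F₂) (hd : Disjoint A₁ A₂) :
    Represents r G w (A₁ ∪ A₂) (unions F₁ F₂) := by
  classical
  intro X Y hX hY hg
  set X₁ := X.filter (· ∈ A₁) with hX₁
  set X₂ := X.filter (· ∉ A₁) with hX₂
  have hXX : X₁ ∪ X₂ = X := Finset.filter_union_filter_not_eq _ _
  have hsub₁ : (X₁ : Set V) ⊆ A₁ := fun x hx => (Finset.mem_filter.1 hx).2
  have hsub₂ : (X₂ : Set V) ⊆ A₂ := fun x hx =>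
    (hX (Finset.mem_filter.1 hx).1).resolve_left (Finset.mem_filter.1 hx).2
  have hY₁ : ∀ y ∈ Y, y ∉ A₁ := fun y hy h => hY hy (Or.inl h)
  have hY₂ : ∀ y ∈ Y, y ∉ A₂ := fun y hy h => hY hy (Or.inr h)
  obtain ⟨X₁', hX₁', hA₁, hw₁, hg₁⟩ := h₁ X₁ (X₂ ∪ Y) hsub₁
    (fun y hy => hy.elim (fun hy => (Finset.mem_filter.1 hy).2) (hY₁ y))
    (by rw [← Set.union_assoc, ← Finset.coe_union, hXX]; exact hg)
  obtain ⟨X₂', hX₂', hA₂, hw₂, hg₂⟩ := h₂ X₂ (X₁' ∪ Y) hsub₂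
    (fun y hy => hy.elim (fun hy => Set.disjoint_left.1 hd (hA₁ hy)) (hY₂ y))
    (by rwa [← Set.union_assoc, Set.union_comm (X₂ : Set V), Set.union_assoc])
  have hdis : Disjoint X₁' X₂' := by
    rw [Finset.disjoint_left]
    exact fun x hx hx' => Set.disjoint_left.1 hd (hA₁ hx) (hA₂ hx')
  have hdis' : Disjoint X₁ X₂ := Finset.disjoint_filter_filter_not _ _ _
  refine ⟨X₁' ∪ X₂', ⟨X₁', hX₁', X₂', hX₂', rfl⟩, ?_, ?_, ?_⟩
  · rw [Finset.coe_union]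
    exact Set.union_subset_union hA₁ hA₂
  · rw [← hXX, Finset.sum_union hdis, Finset.sum_union hdis']
    exact Nat.add_le_add hw₁ hw₂
  · rwa [Finset.coe_union, Set.union_comm (X₁' : Set V), Set.union_assoc]

lemma represents_singleton (v : V) : Represents r G w {v} (insert ∅ {{v}}) := by
  intro X Y hX _ hg
  rcases Finset.subset_singleton_iff.1 (Finset.coe_subset_singleton.1 hX) with rfl | rfl
  · exact ⟨∅, by simp, hX, le_rfl, hg⟩
  · exact ⟨{v}, by simp, hX, le_rfl, hg⟩

lemma Represents.exists_union [DecidableEq V] {F₁ F₂ : Set (Finset V)}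
    (h₁ : Represents r G w A F₁) (h₂ : Represents r G w Aᶜ F₂) (S : Finset V) (hS : Good r G S) :
    ∃ X ∈ unions F₁ F₂, ∑ v ∈ S, w v ≤ ∑ v ∈ X, w v ∧ Good r G X := by
  have h := h₁.union h₂ disjoint_compl_right
  rw [Set.union_compl_self] at h
  obtain ⟨X, hX, -, hw, hg⟩ := h S ∅ (Set.subset_univ _) (by simp) (by simpa using hS)
  exact ⟨X, hX, hw, by simpa using hg⟩

end Represents

/-! ### The cuts of a branch decomposition -/

namespace BranchDecomposition

variable {V N : Type*} [Fintype N] (D : BranchDecomposition V N)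

/-- The nodes on the side of `s` when the edge `st` is removed. -/
def nodeSide (s t : N) : Set N :=
  {x | (D.tree.deleteEdges {s(s, t)}).Reachable s x}

lemma mem_side_iff {s t : N} {v : V} : v ∈ D.side s t ↔ D.leaf v ∈ D.nodeSide s t := Iff.rfl

lemma self_mem_nodeSide (s t : N) : s ∈ D.nodeSide s t := SimpleGraph.Reachable.refl _

variable {D} {s t a b x y : N}

lemma nodeSide_of_adj (hx : x ∈ D.nodeSide s t) (h : (D.tree.deleteEdges {s(s, t)}).Adj x y) :
    y ∈ D.nodeSide s t :=
  SimpleGraph.Reachable.trans hx h.reachable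

/-- Removing an edge splits the tree into two parts. -/
lemma notMem_nodeSide_iff (h : D.tree.Adj s t) : x ∉ D.nodeSide s t ↔ x ∈ D.nodeSide t s := by
  set E := (D.tree.deleteEdges {s(s, t)}).edgeSet with hE
  have hins : D.tree.edgeSet = insert s(s, t) E := by
    rw [hE, SimpleGraph.edgeSet_deleteEdges, Set.insert_sdiff_singleton, Set.insert_eq_of_mem]
    exact h
  have h₁ : ∀ x, x ∈ D.nodeSide s t ↔ joined ⊥ E s x := fun x =>
    (joined_bot_iff_reachable _).symm
  have h₂ : ∀ x, x ∈ D.nodeSide t s ↔ joined ⊥ E t x := fun x => by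
    rw [hE, joined_bot_iff_reachable, Sym2.eq_swap]; rfl
  have hst : ¬ joined ⊥ E s t := by
    rw [hE, joined_bot_iff_reachable, ← SimpleGraph.isBridge_iff]
    exact SimpleGraph.isAcyclic_iff_forall_adj_isBridge.1 D.isTree.isAcyclic h
  have hx : joined ⊥ D.tree.edgeSet s x :=
    (joined_bot_iff_reachable _).2 (D.isTree.connected.preconnected s x)
  rw [hins, joined_insert_iff] at hx
  rw [h₁, h₂]
  constructor
  · intro hn
    rcases hx with hx | hx | hx
    · exact (hn hx).elim
    · exact hx.2
    · exact (hst hx.1).elim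
  · intro ht hs
    exact hst (Setoid.trans' _ hs (Setoid.symm' _ ht))

lemma side_compl (h : D.tree.Adj s t) : (D.side s t)ᶜ = D.side t s := by
  ext v
  exact notMem_nodeSide_iff h

lemma nodeSide_subset (h : D.tree.Adj s a) (hat : a ≠ t) : D.nodeSide a s ⊆ D.nodeSide s t := by
  rintro x ⟨p⟩
  have key : ∀ u v (p : (D.tree.deleteEdges {s(a, s)}).Walk u v), u ∈ D.nodeSide a s →
      u ∈ D.nodeSide s t → v ∈ D.nodeSide s t := by
    intro u v p
    induction p with
    | nil => exact fun _ h => h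
    | @cons u u' v huv _ ih =>
      intro hu hu'
      have hu'' := nodeSide_of_adj hu huv
      have hs : s ∉ D.nodeSide a s := (notMem_nodeSide_iff h.symm).2 (self_mem_nodeSide _ _ _)
      refine ih hu'' (nodeSide_of_adj hu' ?_)
      rw [SimpleGraph.deleteEdges_adj] at huv ⊢
      refine ⟨huv.1, fun he => ?_⟩
      rcases Sym2.eq_iff.1 (Set.mem_singleton_iff.1 he) with ⟨rfl, rfl⟩ | ⟨rfl, rfl⟩
      · exact hs hu
      · exact hs hu''
  refine key a x p (self_mem_nodeSide _ _ _) (nodeSide_of_adj (self_mem_nodeSide _ _ _) ?_)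
  rw [SimpleGraph.deleteEdges_adj]
  refine ⟨h, fun he => ?_⟩
  rcases Sym2.eq_iff.1 (Set.mem_singleton_iff.1 he) with ⟨-, h'⟩ | ⟨-, rfl⟩
  · exact hat h'
  · exact h.ne rfl

/-- The part on the side of `s` consists of `s` and the parts hanging off its other neighbours. -/
lemma mem_nodeSide_iff : x ∈ D.nodeSide s t ↔
    x = s ∨ ∃ a, D.tree.Adj s a ∧ a ≠ t ∧ x ∈ D.nodeSide a s := by
  constructor
  · rintro ⟨p⟩
    have key : ∀ u v (p : (D.tree.deleteEdges {s(s, t)}).Walk u v),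
        (u = s ∨ ∃ a, D.tree.Adj s a ∧ a ≠ t ∧ u ∈ D.nodeSide a s) →
        v = s ∨ ∃ a, D.tree.Adj s a ∧ a ≠ t ∧ v ∈ D.nodeSide a s := by
      intro u v p
      induction p with
      | nil => exact id
      | @cons u u' v huv _ ih =>
        rw [SimpleGraph.deleteEdges_adj, Set.mem_singleton_iff] at huv
        intro hu
        apply ih
        rcases hu with rfl | ⟨a, hsa, hat, hu⟩
        · exact Or.inr ⟨u', huv.1, fun h => huv.2 (h ▸ rfl), self_mem_nodeSide _ _ _⟩
        · by_cases he : s(u, u') = s(a, s)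
          · rcases Sym2.eq_iff.1 he with ⟨rfl, rfl⟩ | ⟨rfl, rfl⟩
            · exact Or.inl rfl
            · exact Or.inr ⟨u', hsa, hat, self_mem_nodeSide _ _ _⟩
          · refine Or.inr ⟨a, hsa, hat, nodeSide_of_adj hu ?_⟩
            rw [SimpleGraph.deleteEdges_adj]
            exact ⟨huv.1, he⟩
    exact key s x p (Or.inl rfl)
  · rintro (rfl | ⟨a, hsa, hat, hx⟩)
    · exact self_mem_nodeSide _ _ _
    · exact nodeSide_subset hsa hat hx

lemma nodeSide_disjoint (ha : D.tree.Adj s a) (hb : D.tree.Adj s b) (hab : a ≠ b) :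
    Disjoint (D.nodeSide a s) (D.nodeSide b s) := by
  rw [Set.disjoint_left]
  intro x hx hx'
  exact (notMem_nodeSide_iff ha.symm).2 (nodeSide_subset hb hab.symm hx') hx

lemma ncard_nodeSide_lt (ha : D.tree.Adj s a) (hat : a ≠ t) :
    (D.nodeSide a s).ncard < (D.nodeSide s t).ncard := by
  refine Set.ncard_lt_ncard ⟨nodeSide_subset ha hat, fun h => ?_⟩ (Set.toFinite _)
  exact (notMem_nodeSide_iff ha.symm).2 (self_mem_nodeSide _ _ _) (h (self_mem_nodeSide D s t))

/-- Every directed edge `st` of the tree starts in the leaf of some `v`, or in an inner node with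
two further neighbours. -/
lemma leaf_or_children (h : D.tree.Adj s t) :
    (∃ v, D.leaf v = s ∧ D.side s t = {v} ∧ ∀ a, D.tree.Adj s a → a = t) ∨
    ((∀ v, D.leaf v ≠ s) ∧ ∃ a b, D.tree.Adj s a ∧ D.tree.Adj s b ∧ a ≠ b ∧ a ≠ t ∧ b ≠ t ∧
      D.side s t = D.side a s ∪ D.side b s ∧ Disjoint (D.side a s) (D.side b s)) := by
  classical
  have hleaf : ∀ v, (D.tree.neighborSet (D.leaf v)).ncard ≤ 1 := fun v => by
    have : D.leaf v ∈ Set.range D.leaf := ⟨v, rfl⟩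
    rwa [D.range_leaf] at this
  rcases D.cubic s with hs | hs
  · left
    have hmem : s ∈ Set.range D.leaf := by rw [D.range_leaf]; exact hs
    obtain ⟨v, rfl⟩ := hmem
    have hnb : ∀ a, D.tree.Adj (D.leaf v) a → a = t := fun a ha =>
      (Set.ncard_le_one (Set.toFinite _)).1 hs a ha t h
    refine ⟨v, rfl, ?_, hnb⟩
    ext u
    rw [mem_side_iff, mem_nodeSide_iff, Set.mem_singleton_iff]
    constructor
    · rintro (hu | ⟨a, ha, hat, -⟩)
      · exact D.leaf_injective hu
      · exact (hat (hnb a ha)).elim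
    · rintro rfl
      exact Or.inl rfl
  · right
    have hnl : ∀ v, D.leaf v ≠ s := by
      rintro v rfl
      have := hleaf v
      omega
    refine ⟨hnl, ?_⟩
    have hc : (D.tree.neighborSet s \ {t}).ncard = 2 := by
      rw [Set.ncard_sdiff_singleton_of_mem (show t ∈ D.tree.neighborSet s from h), hs]
    obtain ⟨a, b, hab, hset⟩ := Set.ncard_eq_two.1 hc
    have ha : a ∈ D.tree.neighborSet s \ {t} := by rw [hset]; simp
    have hb : b ∈ D.tree.neighborSet s \ {t} := by rw [hset]; simp
    refine ⟨a, b, ha.1, hb.1, hab, ha.2, hb.2, ?_, ?_⟩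
    · ext u
      simp only [mem_side_iff, Set.mem_union]
      rw [mem_nodeSide_iff]
      constructor
      · rintro (hu | ⟨c, hc, hct, hu⟩)
        · exact (hnl u hu).elim
        · have : c ∈ D.tree.neighborSet s \ {t} := ⟨hc, hct⟩
          rw [hset] at this
          rcases this with rfl | rfl
          · exact Or.inl hu
          · exact Or.inr hu
      · rintro (hu | hu)
        · exact Or.inr ⟨a, ha.1, ha.2, hu⟩
        · exact Or.inr ⟨b, hb.1, hb.2, hu⟩
    · have := nodeSide_disjoint ha.1 hb.1 hab
      rw [Set.disjoint_left] at this ⊢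
      exact fun u hu hu' => this hu hu'

/-- Counting the edges of the tree through its degrees bounds the number of its nodes. -/
lemma card_add_two_le [Fintype V] (D : BranchDecomposition V N) :
    Fintype.card N + 2 ≤ 3 * Fintype.card V := by
  classical
  have hedge := D.isTree.card_edgeFinset
  have hsum := D.tree.sum_degrees_eq_twice_card_edges
  have hdeg : ∀ x, (D.tree.neighborSet x).ncard = D.tree.degree x := fun x => by
    rw [Set.ncard_eq_toFinset_card', ← SimpleGraph.neighborFinset_def,
      SimpleGraph.card_neighborFinset_eq_degree]
  set L := Finset.univ.filter fun x : N => (D.tree.neighborSet x).ncard ≤ 1 with hL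
  have hLc : L.card ≤ Fintype.card V := by
    have : L = Finset.univ.image D.leaf := by
      ext x
      have := Set.ext_iff.1 D.range_leaf x
      simp only [hL, Finset.mem_filter, Finset.mem_univ, true_and, Finset.mem_image]
      exact this.symm
    rw [this]
    exact Finset.card_image_le
  have hlow : ∑ x : N, (if x ∈ L then 0 else 3) ≤ ∑ x : N, D.tree.degree x := by
    refine Finset.sum_le_sum fun x _ => ?_
    rw [← hdeg]
    split_ifs with hx
    · exact Nat.zero_le _
    · have : ¬ (D.tree.neighborSet x).ncard ≤ 1 := by simpa [hL] using hx
      have := D.cubic x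
      omega
  rw [Finset.sum_ite, Finset.sum_const_zero, zero_add, Finset.sum_const, smul_eq_mul] at hlow
  have hc := Finset.card_filter_add_card_filter_not (s := (Finset.univ : Finset N)) (· ∈ L)
  rw [Finset.filter_mem_eq_inter, Finset.univ_inter, Finset.card_univ] at hc
  omega

lemma le_width {f : Set V → ℕ} (h : D.tree.Adj s t) : f (D.side s t) ≤ D.width f := by
  classical
  unfold width
  exact Finset.le_sup (f := fun p : N × N => f (D.side p.1 p.2)) (b := (s, t)) (by simp [h])

end BranchDecomposition

/-! ### Irredundant sets bound the upper-mim-width from below -/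

lemma HasIrredundant.le_umim {V : Type*} [Finite V] {G : SimpleGraph V} {A : Set V} {p : ℕ}
    (h : HasIrredundant G A p) : p ≤ umim G A := by
  classical
  have := Fintype.ofFinite V
  obtain ⟨R, ⟨hA, hind, hpriv⟩, rfl⟩ := h
  choose! g hgA hg hgp using hpriv
  have hdel : ∀ u v, (deleteOutside G A).Adj u v ↔ G.Adj u v ∧ (u ∈ A ∨ v ∈ A) := by
    intro u v
    simp only [deleteOutside, SimpleGraph.deleteEdges_adj, Set.mem_ofPred_eq, Sym2.mem_iff,
      forall_eq_or_imp, forall_eq]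
    tauto
  have hginj : ∀ r ∈ R, ∀ r' ∈ R, g r = g r' → r = r' := fun r hr r' hr' h =>
    hgp r' hr' r hr (h ▸ hg r hr)
  let M : (deleteOutside G A).Subgraph :=
    { verts := {v | ∃ r ∈ R, v = r ∨ v = g r}
      Adj := fun u v => ∃ r ∈ R, (u = r ∧ v = g r) ∨ (u = g r ∧ v = r)
      adj_sub := by
        rintro u v ⟨r, hr, ⟨rfl, rfl⟩ | ⟨rfl, rfl⟩⟩
        · exact (hdel _ _).2 ⟨hg _ hr, Or.inl (hA _ hr)⟩
        · exact (hdel _ _).2 ⟨(hg _ hr).symm, Or.inr (hA _ hr)⟩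
      edge_vert := by
        rintro u v ⟨r, hr, ⟨rfl, rfl⟩ | ⟨rfl, rfl⟩⟩
        · exact ⟨_, hr, Or.inl rfl⟩
        · exact ⟨_, hr, Or.inr rfl⟩
      symm := ⟨by
        rintro u v ⟨r, hr, h⟩
        exact ⟨r, hr, by tauto⟩⟩ }
  have hcut : IsInducedCutMatching A M := by
    refine ⟨?_, ?_, ?_⟩
    · rintro v ⟨r, hr, rfl | rfl⟩
      · refine ⟨g v, ⟨v, hr, Or.inl ⟨rfl, rfl⟩⟩, ?_⟩
        rintro u ⟨r', hr', ⟨rfl, rfl⟩ | ⟨h, rfl⟩⟩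
        · rfl
        · exact (hgA _ hr' (h ▸ hA _ hr)).elim
      · refine ⟨r, ⟨r, hr, Or.inr ⟨rfl, rfl⟩⟩, ?_⟩
        rintro u ⟨r', hr', ⟨h, rfl⟩ | ⟨h, rfl⟩⟩
        · exact (hgA _ hr (h ▸ hA _ hr')).elim
        · exact hginj _ hr' _ hr h.symm
    · rintro u ⟨r, hr, hur⟩ v ⟨r', hr', hvr⟩ h
      rw [hdel] at h
      rcases hur with rfl | rfl <;> rcases hvr with rfl | rfl
      · exact (hind _ hr _ hr' h.1).elim
      · have := hgp _ hr' _ hr h.1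
        subst this
        exact ⟨_, hr, Or.inl ⟨rfl, rfl⟩⟩
      · have := hgp _ hr _ hr' h.1.symm
        subst this
        exact ⟨_, hr, Or.inr ⟨rfl, rfl⟩⟩
      · exact (h.2.elim (hgA _ hr) (hgA _ hr')).elim
    · rintro u v ⟨r, hr, ⟨rfl, rfl⟩ | ⟨rfl, rfl⟩⟩
      · simp [hA _ hr, hgA _ hr]
      · simp [hA _ hr, hgA _ hr]
  have hcard : M.edgeSet.ncard = R.card := by
    have : M.edgeSet = (fun r => s(r, g r)) '' (R : Set V) := by
      ext e
      induction e with | h u v =>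
      simp only [SimpleGraph.Subgraph.mem_edgeSet, Set.mem_image, Finset.mem_coe]
      constructor
      · rintro ⟨r, hr, ⟨rfl, rfl⟩ | ⟨rfl, rfl⟩⟩
        · exact ⟨_, hr, rfl⟩
        · exact ⟨_, hr, Sym2.eq_swap⟩
      · rintro ⟨r, hr, he⟩
        rcases Sym2.eq_iff.1 he with ⟨rfl, rfl⟩ | ⟨rfl, rfl⟩
        · exact ⟨_, hr, Or.inl ⟨rfl, rfl⟩⟩
        · exact ⟨_, hr, Or.inr ⟨rfl, rfl⟩⟩
    rw [this, Set.InjOn.ncard_image, Set.ncard_coe_finset]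
    intro r hr r' hr' he
    rcases Sym2.eq_iff.1 he with ⟨h, -⟩ | ⟨h, -⟩
    · exact h
    · exact (hgA r' hr' (h ▸ hA r hr)).elim
  unfold umim
  refine le_csSup ⟨Nat.card (Sym2 V), ?_⟩ ⟨M, hcut, hcard⟩
  rintro k ⟨M', -, rfl⟩
  exact Set.ncard_le_card _

lemma le_width_of_hasIrredundant {V N : Type*} [Finite V] [Fintype N] {G : SimpleGraph V}
    {D : BranchDecomposition V N} {s t : N} {p : ℕ} (h : D.tree.Adj s t)
    (h₁ : HasIrredundant G (D.side s t) p) (h₂ : HasIrredundant G (D.side s t)ᶜ p) :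
    p ≤ D.width (omim G) :=
  (le_min h₁.le_umim h₂.le_umim).trans (BranchDecomposition.le_width (f := omim G) h)

end OMim

namespace RAM

/-! ### A loop language with named registers

Programs are written in a small language of bounded loops, whose semantics is a total function on
memories, and then translated to `RAM.Cmd`. -/

/-- The registers. The first two hold the input sizes. -/
inductive Reg where
  | n | m | nn | kap | ell | len | num
  | fvs | flag | pow | rd | s | t | tau | a | b | i | j | v | x | y | z
  | q | quo | lx | ly | ok | wgt | best | k₁ | k₂ | k₃ | p₁ | p₂ | c₁ | c₂
  deriving DecidableEq

/-- The registers that may bound a loop. -/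
def Reg.lim : Reg → Bool
  | .n | .m | .nn | .kap | .ell | .len | .num => true
  | _ => false

/-- The arrays. The first four hold the input and the fifth the output. -/
inductive Arr where
  | wt | adj | tree | leaf | out | dig | inA | bd | lab₀ | alw | lab | cand | best | fam
  deriving DecidableEq

/-- The number of the variable used for a register. -/
def Reg.code (x : Reg) : ℕ := x.ctorIdx

/-- The number of the array used for an array name. -/
def Arr.code (a : Arr) : ℕ := a.ctorIdx

/-- Variables from this number on hold intermediate results. -/
def temp : ℕ := 64

lemma Reg.code_injective : Function.Injective Reg.code :=
  Function.LeftInverse.injective (g := Reg.ofNat) fun x => by cases x <;> rfl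

lemma Arr.code_injective : Function.Injective Arr.code :=
  Function.LeftInverse.injective (g := Arr.ofNat) fun x => by cases x <;> rfl

lemma Reg.code_lt (x : Reg) : x.code < temp := by cases x <;> decide

/-- Memory contents by register and array names. -/
structure Mem where
  var : Reg → ℕ
  arr : Arr → ℕ → ℕ

/-- Write the value `k` to the register `x`. -/
def Mem.setVar (σ : Mem) (x : Reg) (k : ℕ) : Mem :=
  { σ with var := Function.update σ.var x k }

/-- Write the value `k` to the entry `i` of array `a`. -/
def Mem.setArr (σ : Mem) (a : Arr) (i k : ℕ) : Mem :=
  { σ with arr := Function.update σ.arr a (Function.update (σ.arr a) i k) }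

@[simp]
lemma Mem.setVar_var (σ : Mem) (x y : Reg) (k : ℕ) :
    (σ.setVar x k).var y = if y = x then k else σ.var y := by
  simp [Mem.setVar, Function.update_apply]

@[simp]
lemma Mem.setVar_arr (σ : Mem) (x : Reg) (k : ℕ) : (σ.setVar x k).arr = σ.arr := rfl

@[simp]
lemma Mem.setArr_var (σ : Mem) (a : Arr) (i k : ℕ) : (σ.setArr a i k).var = σ.var := rfl

@[simp]
lemma Mem.setArr_arr (σ : Mem) (a b : Arr) (i j k : ℕ) :
    (σ.setArr a i k).arr b j = if b = a ∧ j = i then k else σ.arr b j := by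
  by_cases h : b = a
  · subst h; simp [Mem.setArr, Function.update_apply]
  · simp [Mem.setArr, h]

lemma Mem.setArr_arr_ne (σ : Mem) {a b : Arr} (i k : ℕ) (h : b ≠ a) :
    (σ.setArr a i k).arr b = σ.arr b := by
  simp [Mem.setArr, h]

/-- Expressions: `mul y e` is the product of the register `y` and `e`, and `sum x y e` is the sum of
the values of `e` with `0, 1, …` below the value of the register `y` for `x`. -/
inductive Ex where
  | c (k : ℕ)
  | v (x : Reg)
  | ld (a : Arr) (e : Ex)
  | add (e₁ e₂ : Ex)
  | sub (e₁ e₂ : Ex)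
  | ite (e e₁ e₂ : Ex)
  | mul (y : Reg) (e : Ex)
  | sum (x y : Reg) (e : Ex)

/-- Value of an expression. -/
def Ex.eval : Ex → Mem → ℕ
  | .c k, _ => k
  | .v x, σ => σ.var x
  | .ld a e, σ => σ.arr a (e.eval σ)
  | .add e₁ e₂, σ => e₁.eval σ + e₂.eval σ
  | .sub e₁ e₂, σ => e₁.eval σ - e₂.eval σ
  | .ite e e₁ e₂, σ => if e.eval σ ≠ 0 then e₁.eval σ else e₂.eval σ
  | .mul y e, σ => σ.var y * e.eval σ
  | .sum x y e, σ => ∑ i ∈ Finset.range (σ.var y), e.eval (σ.setVar x i)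

/-- Statements: `forr x y c` runs `c` with `0, 1, …` below the value of the register `y` for `x`. -/
inductive St where
  | skip
  | assign (x : Reg) (e : Ex)
  | store (a : Arr) (i e : Ex)
  | seq (c d : St)
  | ite (e : Ex) (c d : St)
  | forr (x y : Reg) (c : St)

/-- The result of applying `f 0, …, f (k - 1)` in turn. -/
def iter (f : ℕ → Mem → Mem) : ℕ → Mem → Mem
  | 0, σ => σ
  | k + 1, σ => f k (iter f k σ)

/-- The memory after the execution of a statement. -/
def St.exec : St → Mem → Mem
  | .skip, σ => σ
  | .assign x e, σ => σ.setVar x (e.eval σ)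
  | .store a i e, σ => σ.setArr a (i.eval σ) (e.eval σ)
  | .seq c d, σ => d.exec (c.exec σ)
  | .ite e c d, σ => if e.eval σ ≠ 0 then c.exec σ else d.exec σ
  | .forr x y c, σ =>
      (iter (fun i ρ => c.exec (ρ.setVar x i)) (σ.var y) σ).setVar x (σ.var y)

/-- Whether a statement writes a register. -/
def St.writes : St → Reg → Bool
  | .assign x _, z => x = z
  | .seq c d, z => c.writes z || d.writes z
  | .ite _ c d, z => c.writes z || d.writes z
  | .forr x _ c, z => x = z || c.writes z
  | _, _ => false

/-- Whether a statement writes an array. -/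
def St.stores : St → Arr → Bool
  | .store a _ _, b => a = b
  | .seq c d, b => c.stores b || d.stores b
  | .ite _ c d, b => c.stores b || d.stores b
  | .forr _ _ c, b => c.stores b
  | _, _ => false

/-- The expression has only sums and products bounded by limit registers. -/
def Ex.ok : Ex → Bool
  | .c _ | .v _ => true
  | .ld _ e => e.ok
  | .add e₁ e₂ | .sub e₁ e₂ => e₁.ok && e₂.ok
  | .ite e e₁ e₂ => e.ok && e₁.ok && e₂.ok
  | .mul y e => y.lim && e.ok
  | .sum x y e => y.lim && !x.lim && e.ok

/-- The statement does not write limit registers, and its loops are bounded by limit registers and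
do not change their counters. -/
def St.ok : St → Bool
  | .skip => true
  | .assign x e => !x.lim && e.ok
  | .store _ i e => i.ok && e.ok
  | .seq c d => c.ok && d.ok
  | .ite e c d => e.ok && c.ok && d.ok
  | .forr x y c => y.lim && !x.lim && !c.writes x && c.ok

lemma iter_var {f : ℕ → Mem → Mem} {z : Reg} (h : ∀ i σ, (f i σ).var z = σ.var z) (k : ℕ)
    (σ : Mem) : (iter f k σ).var z = σ.var z := by
  induction k with
  | zero => rfl
  | succ k ih => rw [iter, h, ih]

lemma iter_arr {f : ℕ → Mem → Mem} {a : Arr} (h : ∀ i σ, (f i σ).arr a = σ.arr a) (k : ℕ)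
    (σ : Mem) : (iter f k σ).arr a = σ.arr a := by
  induction k with
  | zero => rfl
  | succ k ih => rw [iter, h, ih]

lemma St.exec_var {c : St} {z : Reg} (h : c.writes z = false) (σ : Mem) :
    (c.exec σ).var z = σ.var z := by
  induction c generalizing σ with
  | skip => rfl
  | assign x e =>
    have : z ≠ x := fun hz => by simp [St.writes, hz] at h
    simp [St.exec, this]
  | store a i e => rfl
  | seq c d ihc ihd =>
    simp only [St.writes, Bool.or_eq_false_iff] at h
    rw [St.exec, ihd h.2, ihc h.1]
  | ite e c d ihc ihd =>
    simp only [St.writes, Bool.or_eq_false_iff] at h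
    rw [St.exec]
    split_ifs
    · exact ihc h.1 σ
    · exact ihd h.2 σ
  | forr x y c ih =>
    simp only [St.writes, Bool.or_eq_false_iff, decide_eq_false_iff_not] at h
    have hx : z ≠ x := fun hz => h.1 hz.symm
    rw [St.exec, Mem.setVar_var, if_neg hx]
    exact iter_var (fun i σ => by rw [ih h.2]; simp [hx]) _ _

lemma St.exec_arr {c : St} {a : Arr} (h : c.stores a = false) (σ : Mem) :
    (c.exec σ).arr a = σ.arr a := by
  induction c generalizing σ with
  | skip => rfl
  | assign x e => rfl
  | store b i e =>
    have : a ≠ b := fun hz => by simp [St.stores, hz] at h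
    exact Mem.setArr_arr_ne _ _ _ this
  | seq c d ihc ihd =>
    simp only [St.stores, Bool.or_eq_false_iff] at h
    rw [St.exec, ihd h.2, ihc h.1]
  | ite e c d ihc ihd =>
    simp only [St.stores, Bool.or_eq_false_iff] at h
    rw [St.exec]
    split_ifs
    · exact ihc h.1 σ
    · exact ihd h.2 σ
  | forr x y c ih =>
    rw [St.exec, Mem.setVar_arr]
    exact iter_arr (fun i σ => by rw [ih h]; rfl) _ _

/-! ### Translation to random access machine programs -/

/-- The program computing `e` into the variable `t`, using only variables from `t` on; the counter
of a sum is restored. -/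
def Ex.comp : Ex → ℕ → Cmd
  | .c k, t => .assign t (.const k)
  | .v x, t => .assign t (.var x.code)
  | .ld a e, t => .seq (e.comp t) (.assign t (.load a.code (.var t)))
  | .add e₁ e₂, t =>
      .seq (e₁.comp t) (.seq (e₂.comp (t + 1)) (.assign t (.add (.var t) (.var (t + 1)))))
  | .sub e₁ e₂, t =>
      .seq (e₁.comp t) (.seq (e₂.comp (t + 1)) (.assign t (.sub (.var t) (.var (t + 1)))))
  | .ite e e₁ e₂, t => .seq (e.comp t) (.cond (.var t) (e₁.comp t) (e₂.comp t))
  | .mul y e, t =>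
      .seq (e.comp (t + 1)) (.seq (.assign (t + 2) (.const 0)) (.seq (.assign t (.const 0))
        (.loop (.sub (.var y.code) (.var (t + 2)))
          (.seq (.assign t (.add (.var t) (.var (t + 1))))
            (.assign (t + 2) (.add (.var (t + 2)) (.const 1)))))))
  | .sum x y e, t =>
      .seq (.assign (t + 1) (.var x.code)) (.seq (.assign x.code (.const 0))
        (.seq (.assign t (.const 0)) (.seq
          (.loop (.sub (.var y.code) (.var x.code))
            (.seq (e.comp (t + 2)) (.seq (.assign t (.add (.var t) (.var (t + 2))))
              (.assign x.code (.add (.var x.code) (.const 1))))))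
          (.assign x.code (.var (t + 1))))))

/-- The program for a statement. -/
def St.comp : St → Cmd
  | .skip => .skip
  | .assign x e => .seq (e.comp temp) (.assign x.code (.var temp))
  | .store a i e => .seq (i.comp temp) (.seq (e.comp (temp + 1))
      (.store a.code (.var temp) (.var (temp + 1))))
  | .seq c d => .seq c.comp d.comp
  | .ite e c d => .seq (e.comp temp) (.cond (.var temp) c.comp d.comp)
  | .forr x y c => .seq (.assign x.code (.const 0))
      (.loop (.sub (.var y.code) (.var x.code))
        (.seq c.comp (.assign x.code (.add (.var x.code) (.const 1)))))

/-- Bound for the time of evaluating an expression if all limits are at most `W`. -/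
def Ex.time (W : ℕ) : Ex → ℕ
  | .c _ | .v _ => 2
  | .ld _ e => e.time W + 3
  | .add e₁ e₂ | .sub e₁ e₂ => e₁.time W + e₂.time W + 4
  | .ite e e₁ e₂ => e.time W + e₁.time W + e₂.time W + 2
  | .mul _ e => e.time W + (W * 12 + 8)
  | .sum _ _ e => W * (e.time W + 12) + 12

/-- Bound for the time of executing a statement if all limits are at most `W`. -/
def St.time (W : ℕ) : St → ℕ
  | .skip => 1
  | .assign _ e => e.time W + 2
  | .store _ i e => i.time W + e.time W + 3
  | .seq c d => c.time W + d.time W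
  | .ite e c d => e.time W + c.time W + d.time W + 2
  | .forr _ _ c => W * (c.time W + 8) + 6

/-- `c` leads from `τ` to `τ'` in at most `k` steps. -/
def Halts (c : Cmd) (τ : State) (k : ℕ) (τ' : State) : Prop :=
  ∃ t ≤ k, Run c τ t τ'

lemma Halts.mono {c : Cmd} {τ τ' : State} {k k' : ℕ} (h : Halts c τ k τ') (hk : k ≤ k') :
    Halts c τ k' τ' := by
  obtain ⟨t, ht, hr⟩ := h
  exact ⟨t, ht.trans hk, hr⟩

lemma Halts.seq {c d : Cmd} {τ τ' τ'' : State} {k k' : ℕ} (h : Halts c τ k τ')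
    (h' : Halts d τ' k' τ'') : Halts (.seq c d) τ (k + k') τ'' := by
  obtain ⟨t, ht, hr⟩ := h
  obtain ⟨t', ht', hr'⟩ := h'
  exact ⟨_, Nat.add_le_add ht ht', hr.seq hr'⟩

lemma halts_assign (x : ℕ) (e : Expr) (τ : State) :
    Halts (.assign x e) τ (e.cost + 1) (τ.setVar x (e.eval τ)) :=
  ⟨_, le_rfl, .assign x e τ⟩

lemma Halts.cond {e : Expr} {c d : Cmd} {τ τ' : State} {k : ℕ}
    (h : if e.eval τ ≠ 0 then Halts c τ k τ' else Halts d τ k τ') :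
    Halts (.cond e c d) τ (e.cost + 1 + k) τ' := by
  split_ifs at h with he
  · obtain ⟨t, ht, hr⟩ := h
    exact ⟨_, Nat.add_le_add_left ht _, .condTrue he hr⟩
  · obtain ⟨t, ht, hr⟩ := h
    exact ⟨_, Nat.add_le_add_left ht _, .condFalse (not_not.1 he) hr⟩

/-- A loop counting the variable `x` up to the value `N` of the variable `y`. -/
lemma halts_count {x y N k : ℕ} {c : Cmd} (I : ℕ → State → Prop)
    (hI : ∀ i τ, I i τ → τ.var x = i ∧ τ.var y = N)
    (hstep : ∀ i < N, ∀ τ, I i τ → ∃ τ', Halts c τ k τ' ∧ I (i + 1) τ') {τ : State} (h₀ : I 0 τ) :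
    ∃ τ', Halts (.loop (.sub (.var y) (.var x)) c) τ (N * (k + 4) + 4) τ' ∧ I N τ' := by
  have key : ∀ d i, i + d = N → ∀ τ, I i τ →
      ∃ τ', Halts (.loop (.sub (.var y) (.var x)) c) τ (d * (k + 4) + 4) τ' ∧ I N τ' := by
    intro d
    induction d with
    | zero =>
      intro i hi τ h
      have hi : i = N := by omega
      subst hi
      obtain ⟨hx, hy⟩ := hI _ _ h
      exact ⟨τ, ⟨4, by omega, .loopFalse (by simp [Expr.eval, hx, hy])⟩, h⟩
    | succ d ih =>
      intro i hi τ h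
      obtain ⟨hx, hy⟩ := hI _ _ h
      obtain ⟨τ₁, ⟨t₁, ht₁, hr₁⟩, h₁⟩ := hstep i (by omega) τ h
      obtain ⟨τ₂, ⟨t₂, ht₂, hr₂⟩, h₂⟩ := ih (i + 1) (by omega) τ₁ h₁
      refine ⟨τ₂, ⟨_, ?_, .loopTrue (by simp only [Expr.eval, hx, hy]; omega) hr₁ hr₂⟩, h₂⟩
      simp only [Expr.cost]
      rw [Nat.succ_mul]
      omega
  exact key N 0 (by omega) τ h₀

/-- The machine state `τ` holds the memory `σ`. -/
def Holding (σ : Mem) (τ : State) : Prop :=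
  (∀ x : Reg, τ.var x.code = σ.var x) ∧ ∀ a : Arr, τ.arr a.code = σ.arr a

/-- All limit registers have values at most `W`. -/
def Mem.Bounded (σ : Mem) (W : ℕ) : Prop := ∀ y : Reg, y.lim → σ.var y ≤ W

@[simp]
lemma State.setVar_var (τ : State) (x z k : ℕ) :
    (τ.setVar x k).var z = if z = x then k else τ.var z := by
  simp [State.setVar, Function.update_apply]

@[simp]
lemma State.setVar_arr (τ : State) (x k : ℕ) : (τ.setVar x k).arr = τ.arr := rfl

lemma Holding.setVar {σ : Mem} {τ : State} (h : Holding σ τ) (x : Reg) (k : ℕ) :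
    Holding (σ.setVar x k) (τ.setVar x.code k) := by
  refine ⟨fun z => ?_, h.2⟩
  simp only [State.setVar_var, Mem.setVar_var, Reg.code_injective.eq_iff, h.1]

lemma Holding.setArr {σ : Mem} {τ : State} (h : Holding σ τ) (a : Arr) (i k : ℕ) :
    Holding (σ.setArr a i k) (τ.setArr a.code i k) := by
  refine ⟨h.1, fun b => ?_⟩
  simp only [State.setArr, Mem.setArr, Function.update_apply, Arr.code_injective.eq_iff, h.2]

lemma Holding.of_agree {σ : Mem} {τ τ' : State} (h : Holding σ τ) (ha : τ'.arr = τ.arr)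
    (hv : ∀ z < temp, τ'.var z = τ.var z) : Holding σ τ' :=
  ⟨fun x => (hv _ x.code_lt).trans (h.1 x), fun a => by rw [ha, h.2]⟩

lemma Mem.Bounded.setVar {σ : Mem} {W : ℕ} (h : σ.Bounded W) {x : Reg} (hx : x.lim = false)
    (k : ℕ) : (σ.setVar x k).Bounded W := by
  intro y hy
  have : y ≠ x := fun h => by simp [h, hx] at hy
  simpa [this] using h y hy

lemma Ex.comp_halts {W : ℕ} (e : Ex) (hok : e.ok) {t : ℕ} (ht : temp ≤ t) {σ : Mem} {τ : State}
    (h : Holding σ τ) (hW : σ.Bounded W) :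
    ∃ τ', Halts (e.comp t) τ (e.time W) τ' ∧ τ'.var t = e.eval σ ∧ τ'.arr = τ.arr ∧
      ∀ z < t, τ'.var z = τ.var z := by
  induction e generalizing t σ τ with
  | c k =>
    exact ⟨_, halts_assign _ _ _, by simp [Ex.eval, Expr.eval], rfl, fun z hz => by simp [hz.ne]⟩
  | v x =>
    exact ⟨_, halts_assign _ _ _, by simp [Ex.eval, Expr.eval, h.1], rfl,
      fun z hz => by simp [hz.ne]⟩
  | ld a e ih =>
    obtain ⟨τ₁, h₁, hv₁, ha₁, hz₁⟩ := ih hok ht h hW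
    refine ⟨_, h₁.seq (halts_assign _ _ _), ?_, ha₁, fun z hz => by simp [hz.ne, hz₁ z hz]⟩
    simp [Ex.eval, Expr.eval, hv₁, ha₁, h.2]
  | add e₁ e₂ ih₁ ih₂ =>
    simp only [Ex.ok, Bool.and_eq_true] at hok
    obtain ⟨τ₁, h₁, hv₁, ha₁, hz₁⟩ := ih₁ hok.1 ht h hW
    obtain ⟨τ₂, h₂, hv₂, ha₂, hz₂⟩ := ih₂ hok.2 (t := t + 1) (by omega)
      (h.of_agree ha₁ fun z hz => hz₁ z (by omega)) hW
    refine ⟨_, (h₁.seq (h₂.seq (halts_assign _ _ _))).mono ?_, ?_, ha₂.trans ha₁, fun z hz => ?_⟩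
    · simp only [Expr.cost, Ex.time]; omega
    · simp [Ex.eval, Expr.eval, hv₂, hz₂ t (by omega), hv₁]
    · simp [hz.ne, hz₂ z (by omega), hz₁ z hz]
  | sub e₁ e₂ ih₁ ih₂ =>
    simp only [Ex.ok, Bool.and_eq_true] at hok
    obtain ⟨τ₁, h₁, hv₁, ha₁, hz₁⟩ := ih₁ hok.1 ht h hW
    obtain ⟨τ₂, h₂, hv₂, ha₂, hz₂⟩ := ih₂ hok.2 (t := t + 1) (by omega)
      (h.of_agree ha₁ fun z hz => hz₁ z (by omega)) hW
    refine ⟨_, (h₁.seq (h₂.seq (halts_assign _ _ _))).mono ?_, ?_, ha₂.trans ha₁, fun z hz => ?_⟩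
    · simp only [Expr.cost, Ex.time]; omega
    · simp [Ex.eval, Expr.eval, hv₂, hz₂ t (by omega), hv₁]
    · simp [hz.ne, hz₂ z (by omega), hz₁ z hz]
  | ite e e₁ e₂ ih ih₁ ih₂ =>
    simp only [Ex.ok, Bool.and_eq_true] at hok
    obtain ⟨τ₀, h₀, hv₀, ha₀, hz₀⟩ := ih hok.1.1 ht h hW
    have hh := h.of_agree ha₀ fun z hz => hz₀ z (by omega)
    by_cases hc : e.eval σ ≠ 0
    · obtain ⟨τ₁, h₁, hv₁, ha₁, hz₁⟩ := ih₁ hok.1.2 ht hh hW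
      refine ⟨τ₁, (h₀.seq (Halts.cond (k := e₁.time W) ?_)).mono ?_, ?_, ha₁.trans ha₀,
        fun z hz => (hz₁ z hz).trans (hz₀ z hz)⟩
      · rw [if_pos (by simpa [Expr.eval, hv₀] using hc)]; exact h₁
      · simp only [Expr.cost, Ex.time]; omega
      · rw [Ex.eval, if_pos hc, hv₁]
    · obtain ⟨τ₁, h₁, hv₁, ha₁, hz₁⟩ := ih₂ hok.2 ht hh hW
      refine ⟨τ₁, (h₀.seq (Halts.cond (k := e₂.time W) ?_)).mono ?_, ?_, ha₁.trans ha₀,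
        fun z hz => (hz₁ z hz).trans (hz₀ z hz)⟩
      · rw [if_neg (by simpa [Expr.eval, hv₀] using hc)]; exact h₁
      · simp only [Expr.cost, Ex.time]; omega
      · rw [Ex.eval, if_neg hc, hv₁]
  | mul y e ih =>
    simp only [Ex.ok, Bool.and_eq_true] at hok
    obtain ⟨τ₁, h₁, hv₁, ha₁, hz₁⟩ := ih hok.2 (t := t + 1) (by omega) h hW
    have hy : y.code < t := y.code_lt.trans_le ht
    set τ₂ := τ₁.setVar (t + 2) 0
    set τ₃ := τ₂.setVar t 0
    obtain ⟨τ₄, h₄, hI⟩ := halts_count (x := t + 2) (y := y.code) (N := σ.var y) (k := 8)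
      (c := .seq (.assign t (.add (.var t) (.var (t + 1))))
            (.assign (t + 2) (.add (.var (t + 2)) (.const 1))))
      (fun i ρ => ρ.var (t + 2) = i ∧ ρ.var (t + 1) = e.eval σ ∧ ρ.var t = i * e.eval σ ∧
        ρ.arr = τ.arr ∧ ∀ z < t, ρ.var z = τ.var z)
      (fun i ρ hρ => ⟨hρ.1, by rw [hρ.2.2.2.2 _ hy, h.1]⟩)
      (fun i _ ρ hρ => by
        obtain ⟨h1, h2, h3, h4, h5⟩ := hρ
        refine ⟨_, (halts_assign _ _ _).seq (halts_assign _ _ _), ?_, ?_, ?_, h4, fun z hz => ?_⟩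
        · simp [Expr.eval, h1]
        · simp [h2]
        · simp [Expr.eval, h2, h3, Nat.succ_mul]
        · simp [hz.ne, (show z ≠ t + 2 by omega), h5 z hz])
      (τ := τ₃) ⟨by simp [τ₃, τ₂], by simp [τ₃, τ₂, hv₁], by simp [τ₃], ha₁, fun z hz => by
        simp [τ₃, τ₂, hz.ne, (show z ≠ t + 2 by omega), hz₁ z (by omega)]⟩
    have hyW := hW y hok.1
    refine ⟨τ₄, (h₁.seq ((halts_assign _ _ _).seq ((halts_assign _ _ _).seq h₄))).mono ?_,
      hI.2.2.1, hI.2.2.2.1, hI.2.2.2.2⟩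
    simp only [Expr.cost, Ex.time]
    have := Nat.mul_le_mul_right 12 hyW
    omega
  | sum x y e ih =>
    simp only [Ex.ok, Bool.and_eq_true, Bool.not_eq_true'] at hok
    obtain ⟨⟨hy, hx⟩, he⟩ := hok
    have hxy : y ≠ x := fun h => by simp [h, hx] at hy
    have hyc : y.code ≠ x.code := Reg.code_injective.ne hxy
    have hct : ∀ r : Reg, r.code < t := fun r => r.code_lt.trans_le ht
    set τ₁ := τ.setVar (t + 1) (τ.var x.code)
    set τ₂ := τ₁.setVar x.code 0
    set τ₃ := τ₂.setVar t 0
    have hxt := hct x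
    obtain ⟨τ₄, h₄, hI⟩ := halts_count (x := x.code) (y := y.code) (N := σ.var y)
      (k := e.time W + 8)
      (c := .seq (e.comp (t + 2)) (.seq (.assign t (.add (.var t) (.var (t + 2))))
              (.assign x.code (.add (.var x.code) (.const 1)))))
      (fun i ρ => ρ.var x.code = i ∧ ρ.var (t + 1) = τ.var x.code ∧
        ρ.var t = ∑ l ∈ Finset.range i, e.eval (σ.setVar x l) ∧
        ρ.arr = τ.arr ∧ ∀ z < t, z ≠ x.code → ρ.var z = τ.var z)
      (fun i ρ hρ => ⟨hρ.1, by rw [hρ.2.2.2.2 _ (hct y) hyc, h.1]⟩)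
      (fun i _ ρ hρ => by
        obtain ⟨h1, h2, h3, h4, h5⟩ := hρ
        have hold : Holding (σ.setVar x i) ρ := by
          refine ⟨fun z => ?_, fun a => by rw [h4, h.2]; rfl⟩
          by_cases hz : z = x
          · subst hz; simp [h1]
          · simp [hz, h5 _ (hct z) (Reg.code_injective.ne hz), h.1]
        obtain ⟨ρ₁, g₁, gv, ga, gz⟩ := ih he (t := t + 2) (by omega) hold (hW.setVar hx i)
        refine ⟨_, (g₁.seq ((halts_assign _ _ _).seq (halts_assign _ _ _))).mono ?_, ?_, ?_, ?_,
          ga.trans h4, fun z hz hzx => ?_⟩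
        · simp only [Expr.cost]; omega
        · simp [Expr.eval, hxt.ne, gz x.code (by omega), h1]
        · simp [(show t + 1 ≠ x.code by omega), gz (t + 1) (by omega), h2]
        · simp [hxt.ne', Expr.eval, gv, gz t (by omega), h3, Finset.sum_range_succ]
        · simp [hzx, hz.ne, gz z (by omega), h5 z hz hzx])
      (τ := τ₃) ⟨by simp [τ₃, τ₂, hxt.ne], by simp [τ₃, τ₂, τ₁, (show t + 1 ≠ x.code by omega)],
        by simp [τ₃], rfl, fun z hz hzx => by
          simp [τ₃, τ₂, τ₁, hz.ne, hzx, (show z ≠ t + 1 by omega)]⟩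
    obtain ⟨h1, h2, h3, h4, h5⟩ := hI
    have hyW := hW y hy
    refine ⟨τ₄.setVar x.code (τ₄.var (t + 1)),
      ((halts_assign _ _ _).seq ((halts_assign _ _ _).seq ((halts_assign _ _ _).seq
      (h₄.seq (halts_assign x.code (.var (t + 1)) τ₄))))).mono ?_, ?_, h4, fun z hz => ?_⟩
    · simp only [Expr.cost, Ex.time]
      have : σ.var y * (e.time W + 8 + 4) ≤ W * (e.time W + 12) := Nat.mul_le_mul_right _ hyW
      omega
    · simp [Ex.eval, hxt.ne', h3]
    · by_cases hzx : z = x.code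
      · subst hzx; simp [h2]
      · simp [hzx, h5 z hz hzx]

lemma St.writes_of_lim {c : St} (hc : c.ok) {y : Reg} (hy : y.lim) : c.writes y = false := by
  induction c with
  | skip => rfl
  | assign x e =>
    simp only [St.ok, Bool.and_eq_true, Bool.not_eq_true'] at hc
    simp only [St.writes, decide_eq_false_iff_not]
    rintro rfl
    simp [hc.1] at hy
  | store a i e => rfl
  | seq c d ihc ihd =>
    simp only [St.ok, Bool.and_eq_true] at hc
    simp [St.writes, ihc hc.1, ihd hc.2]
  | ite e c d ihc ihd =>
    simp only [St.ok, Bool.and_eq_true] at hc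
    simp [St.writes, ihc hc.1.2, ihd hc.2]
  | forr x z c ih =>
    simp only [St.ok, Bool.and_eq_true, Bool.not_eq_true'] at hc
    simp only [St.writes, ih hc.2, Bool.or_false, decide_eq_false_iff_not]
    rintro rfl
    simp [hc.1.1.2] at hy

lemma Mem.Bounded.exec {c : St} (hc : c.ok) {W : ℕ} {σ : Mem} (hW : σ.Bounded W) :
    (c.exec σ).Bounded W := fun y hy => by
  rw [St.exec_var (St.writes_of_lim hc hy)]
  exact hW y hy

lemma St.assign_halts {W : ℕ} (x : Reg) (e : Ex) (hok : e.ok) {σ : Mem} {τ : State}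
    (h : Holding σ τ) (hW : σ.Bounded W) :
    ∃ τ', Halts (St.assign x e).comp τ ((St.assign x e).time W) τ' ∧
      Holding ((St.assign x e).exec σ) τ' := by
  obtain ⟨τ₁, h₁, hv₁, ha₁, hz₁⟩ := e.comp_halts hok le_rfl h hW
  refine ⟨_, h₁.seq (halts_assign _ _ _), ?_⟩
  have := (h.of_agree ha₁ hz₁).setVar x (e.eval σ)
  simpa [Expr.eval, hv₁, St.exec] using this

/-- The translated program simulates the statement within the time bound. -/
theorem St.comp_halts {W : ℕ} (c : St) (hok : c.ok) {σ : Mem} {τ : State} (h : Holding σ τ)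
    (hW : σ.Bounded W) :
    ∃ τ', Halts c.comp τ (c.time W) τ' ∧ Holding (c.exec σ) τ' := by
  induction c generalizing σ τ with
  | skip => exact ⟨τ, ⟨1, le_rfl, .skip τ⟩, h⟩
  | assign x e =>
    simp only [St.ok, Bool.and_eq_true] at hok
    exact St.assign_halts x e hok.2 h hW
  | store a i e =>
    simp only [St.ok, Bool.and_eq_true] at hok
    obtain ⟨τ₁, h₁, hv₁, ha₁, hz₁⟩ := i.comp_halts hok.1 le_rfl h hW
    obtain ⟨τ₂, h₂, hv₂, ha₂, hz₂⟩ := e.comp_halts hok.2 (t := temp + 1) (by omega)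
      (h.of_agree ha₁ hz₁) hW
    have hh := (h.of_agree ha₁ hz₁).of_agree ha₂ fun z hz => hz₂ z (by omega)
    refine ⟨_, (h₁.seq (h₂.seq ⟨_, le_rfl, .store _ _ _ _⟩)).mono ?_, ?_⟩
    · simp only [Expr.cost, St.time]; omega
    · have := hh.setArr a (i.eval σ) (e.eval σ)
      simpa [Expr.eval, hv₂, hz₂ temp (by omega), hv₁, St.exec] using this
  | seq c d ihc ihd =>
    simp only [St.ok, Bool.and_eq_true] at hok
    obtain ⟨τ₁, h₁, hh₁⟩ := ihc hok.1 h hW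
    obtain ⟨τ₂, h₂, hh₂⟩ := ihd hok.2 hh₁ (hW.exec hok.1)
    exact ⟨τ₂, h₁.seq h₂, hh₂⟩
  | ite e c d ihc ihd =>
    simp only [St.ok, Bool.and_eq_true] at hok
    obtain ⟨τ₁, h₁, hv₁, ha₁, hz₁⟩ := e.comp_halts hok.1.1 le_rfl h hW
    have hh := h.of_agree ha₁ hz₁
    by_cases hc : e.eval σ ≠ 0
    · obtain ⟨τ₂, h₂, hh₂⟩ := ihc hok.1.2 hh hW
      refine ⟨τ₂, (h₁.seq (Halts.cond (k := c.time W) ?_)).mono ?_, ?_⟩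
      · rw [if_pos (by simpa [Expr.eval, hv₁] using hc)]; exact h₂
      · simp only [Expr.cost, St.time]; omega
      · rwa [St.exec, if_pos hc]
    · obtain ⟨τ₂, h₂, hh₂⟩ := ihd hok.2 hh hW
      refine ⟨τ₂, (h₁.seq (Halts.cond (k := d.time W) ?_)).mono ?_, ?_⟩
      · rw [if_neg (by simpa [Expr.eval, hv₁] using hc)]; exact h₂
      · simp only [Expr.cost, St.time]; omega
      · rwa [St.exec, if_neg hc]
  | forr x y c ih =>
    simp only [St.ok, Bool.and_eq_true, Bool.not_eq_true'] at hok
    obtain ⟨⟨⟨hy, hx⟩, hcx⟩, hc⟩ := hok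
    have hxy : y ≠ x := fun h => by simp [h, hx] at hy
    set f := fun i ρ => c.exec (Mem.setVar ρ x i) with hf
    obtain ⟨τ₂, h₂, hb, hI⟩ := halts_count (x := x.code) (y := y.code) (N := σ.var y)
      (k := c.time W + 4)
      (c := .seq c.comp (.assign x.code (.add (.var x.code) (.const 1))))
      (fun i ρ => (((iter f i σ).setVar x i).Bounded W ∧ (iter f i σ).var y = σ.var y) ∧
        Holding ((iter f i σ).setVar x i) ρ)
      (fun i ρ hρ => ⟨by simp [hρ.2.1], by simp [hρ.2.1, hxy, hρ.1.2]⟩)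
      (fun i _ ρ hρ => by
        obtain ⟨⟨hb, hyv⟩, hρ⟩ := hρ
        obtain ⟨ρ₁, g₁, gh⟩ := ih hc hρ hb
        have hexec : iter f (i + 1) σ = c.exec ((iter f i σ).setVar x i) := rfl
        have hxv : ρ₁.var x.code = i := by
          rw [gh.1, St.exec_var hcx]; simp
        refine ⟨_, g₁.seq (halts_assign _ _ _), ⟨?_, ?_⟩, ?_⟩
        · rw [hexec]; exact (hb.exec hc).setVar hx _
        · rw [hexec, St.exec_var (St.writes_of_lim hc hy)]
          simp [hxy, hyv]
        · have := gh.setVar x (i + 1)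
          simpa [Expr.eval, hxv, hexec] using this)
      (τ := τ.setVar x.code 0) ⟨⟨hW.setVar hx 0, rfl⟩, h.setVar x 0⟩
    have hyW := hW y hy
    refine ⟨τ₂, ((halts_assign _ _ _).seq h₂).mono ?_, hI⟩
    simp only [Expr.cost, St.time]
    have : σ.var y * (c.time W + 4 + 4) ≤ W * (c.time W + 8) := Nat.mul_le_mul_right _ hyW
    omega

/-! ### Rules for reasoning about programs -/

section Eval

variable {σ : Mem}

@[simp] lemma eval_c {k : ℕ} : (Ex.c k).eval σ = k := rfl

@[simp] lemma eval_v {x : Reg} : (Ex.v x).eval σ = σ.var x := rfl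

@[simp] lemma eval_ld {a : Arr} {e : Ex} : (Ex.ld a e).eval σ = σ.arr a (e.eval σ) := rfl

@[simp] lemma eval_add {a b : Ex} : (Ex.add a b).eval σ = a.eval σ + b.eval σ := rfl

@[simp] lemma eval_sub {a b : Ex} : (Ex.sub a b).eval σ = a.eval σ - b.eval σ := rfl

@[simp] lemma eval_mul {y : Reg} {e : Ex} : (Ex.mul y e).eval σ = σ.var y * e.eval σ := rfl

@[simp] lemma eval_sum {x y : Reg} {e : Ex} :
    (Ex.sum x y e).eval σ = ∑ i ∈ Finset.range (σ.var y), e.eval (σ.setVar x i) := rfl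

end Eval

/-- `ρ` agrees with `σ` except where `c` may write. -/
structure Frame (c : St) (σ ρ : Mem) : Prop where
  var : ∀ z, c.writes z = false → ρ.var z = σ.var z
  arr : ∀ a, c.stores a = false → ρ.arr a = σ.arr a

lemma St.frame (c : St) (σ : Mem) : Frame c σ (c.exec σ) :=
  ⟨fun _ h => St.exec_var h σ, fun _ h => St.exec_arr h σ⟩

lemma Frame.refl (c : St) (σ : Mem) : Frame c σ σ := ⟨fun _ _ => rfl, fun _ _ => rfl⟩

lemma Frame.setVar {c : St} {σ ρ : Mem} (h : Frame c σ ρ) {x : Reg} (hx : c.writes x = true)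
    (k : ℕ) : Frame c σ (ρ.setVar x k) := by
  refine ⟨fun z hz => ?_, h.arr⟩
  have : z ≠ x := fun e => by simp [e, hx] at hz
  simp [this, h.var z hz]

/-- A frame of the body of a loop gives a frame of the loop. -/
lemma Frame.body {x y : Reg} {c : St} {σ ρ θ : Mem} {i : ℕ} (h : Frame (.forr x y c) σ ρ)
    (h' : Frame c (ρ.setVar x i) θ) : Frame (.forr x y c) σ θ := by
  refine ⟨fun z hz => ?_, fun a ha => (h'.arr a ha).trans (h.arr a ha)⟩
  have hz' := hz
  simp only [St.writes, Bool.or_eq_false_iff, decide_eq_false_iff_not] at hz'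
  rw [h'.var z hz'.2, Mem.setVar_var, if_neg (fun e => hz'.1 e.symm), h.var z hz]

/-- The invariant rule for loops. -/
lemma St.exec_forr {x y : Reg} {c : St} {σ : Mem} (I : ℕ → Mem → Prop) (h₀ : I 0 σ)
    (hs : ∀ i < σ.var y, ∀ ρ, Frame (.forr x y c) σ ρ → I i ρ → I (i + 1) (c.exec (ρ.setVar x i))) :
    ∃ ρ, I (σ.var y) ρ ∧ Frame (.forr x y c) σ ρ ∧
      (St.forr x y c).exec σ = ρ.setVar x (σ.var y) := by
  set f := fun i ρ => c.exec (Mem.setVar ρ x i)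
  have key : ∀ k ≤ σ.var y, I k (iter f k σ) ∧ Frame (.forr x y c) σ (iter f k σ) := by
    intro k hk
    induction k with
    | zero => exact ⟨h₀, Frame.refl _ _⟩
    | succ k ih =>
      obtain ⟨h, hF⟩ := ih (by omega)
      exact ⟨hs k hk _ hF h, hF.body (c.frame _)⟩
  obtain ⟨h, hF⟩ := key _ le_rfl
  exact ⟨_, h, hF, rfl⟩

/-- The invariant rule for an invariant that ignores the loop counter. -/
lemma St.exec_forr' {x y : Reg} {c : St} {σ : Mem} (I : ℕ → Mem → Prop)
    (hI : ∀ i ρ k, I i ρ → I i (ρ.setVar x k)) (h₀ : I 0 σ)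
    (hs : ∀ i < σ.var y, ∀ ρ, Frame (.forr x y c) σ ρ → I i ρ → ρ.var x = i →
      I (i + 1) (c.exec ρ)) :
    I (σ.var y) ((St.forr x y c).exec σ) := by
  obtain ⟨ρ, h, -, he⟩ := St.exec_forr (x := x) (y := y) (c := c) I h₀
    fun i hi ρ hF h => hs i hi _ (hF.setVar (by simp [St.writes]) i) (hI _ _ _ h) (by simp)
  rw [he]
  exact hI _ _ _ h

/-- Whether an expression reads an array. -/
def Ex.reads : Ex → Arr → Bool
  | .c _, _ | .v _, _ => false
  | .ld a e, b => a = b || e.reads b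
  | .add e₁ e₂, b | .sub e₁ e₂, b => e₁.reads b || e₂.reads b
  | .ite e e₁ e₂, b => e.reads b || e₁.reads b || e₂.reads b
  | .mul _ e, b | .sum _ _ e, b => e.reads b

lemma Ex.eval_congr {e : Ex} {σ ρ : Mem} (hv : ∀ z, σ.var z = ρ.var z)
    (ha : ∀ a, e.reads a = true → σ.arr a = ρ.arr a) : e.eval σ = e.eval ρ := by
  induction e generalizing σ ρ with
  | c k => rfl
  | v x => exact hv x
  | ld a e ih =>
    simp only [Ex.reads, Bool.or_eq_true, decide_eq_true_eq] at ha
    rw [Ex.eval, Ex.eval, ih hv fun b hb => ha b (Or.inr hb), ha a (Or.inl rfl)]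
  | add e₁ e₂ ih₁ ih₂ =>
    simp only [Ex.reads, Bool.or_eq_true] at ha
    rw [Ex.eval, Ex.eval, ih₁ hv fun b hb => ha b (Or.inl hb), ih₂ hv fun b hb => ha b (Or.inr hb)]
  | sub e₁ e₂ ih₁ ih₂ =>
    simp only [Ex.reads, Bool.or_eq_true] at ha
    rw [Ex.eval, Ex.eval, ih₁ hv fun b hb => ha b (Or.inl hb), ih₂ hv fun b hb => ha b (Or.inr hb)]
  | ite e e₁ e₂ ih ih₁ ih₂ =>
    simp only [Ex.reads, Bool.or_eq_true] at ha
    rw [Ex.eval, Ex.eval, ih hv fun b hb => ha b (Or.inl (Or.inl hb)),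
      ih₁ hv fun b hb => ha b (Or.inl (Or.inr hb)), ih₂ hv fun b hb => ha b (Or.inr hb)]
  | mul y e ih => rw [Ex.eval, Ex.eval, ih hv ha, hv]
  | sum x y e ih =>
    rw [Ex.eval, Ex.eval, hv]
    refine Finset.sum_congr rfl fun i _ => ih (fun z => ?_) ha
    simp [hv]

/-- Filling a segment of an array, starting at the value of the register `p`. -/
lemma St.exec_fillAt {x y p : Reg} {a : Arr} {e : Ex} (hpx : p ≠ x)
    (hr : e.reads a = false) (σ : Mem) :
    ((St.forr x y (.store a (.add (.v p) (.v x)) e)).exec σ).arr a = fun k =>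
      if σ.var p ≤ k ∧ k < σ.var p + σ.var y then e.eval (σ.setVar x (k - σ.var p))
      else σ.arr a k := by
  refine St.exec_forr' (fun i ρ => ρ.arr a = fun k =>
      if σ.var p ≤ k ∧ k < σ.var p + i then e.eval (σ.setVar x (k - σ.var p)) else σ.arr a k)
    (fun _ _ _ h => h) ?_ fun i hi ρ hF h hx => ?_
  · funext k
    rw [if_neg (by omega)]
  · have hw : ∀ z, z ≠ x → ρ.var z = σ.var z := fun z hz =>
      hF.var z (by simp [St.writes, hz.symm])
    have hst : ∀ b, b ≠ a → ρ.arr b = σ.arr b := fun b hb =>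
      hF.arr b (by simp [St.stores, hb.symm])
    have he : e.eval ρ = e.eval (σ.setVar x i) := by
      refine Ex.eval_congr (fun z => ?_) fun b hb => ?_
      · by_cases hz : z = x
        · simp [hz, hx]
        · simp [hz, hw z hz]
      · rw [hst b (fun h => by simp [h, hr] at hb)]; rfl
    funext k
    simp only [St.exec, Mem.setArr_arr, true_and, Ex.eval, hx, hw p hpx, h, he]
    by_cases hk : k = σ.var p + i
    · subst hk
      simp
    · rw [if_neg hk]
      by_cases hk' : σ.var p ≤ k ∧ k < σ.var p + i
      · rw [if_pos hk', if_pos (by omega)]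
      · rw [if_neg hk', if_neg (by omega)]

/-- Filling an array from its beginning. -/
lemma St.exec_fill {x y : Reg} {a : Arr} {e : Ex} (hr : e.reads a = false)
    (σ : Mem) {k : ℕ} (hk : k < σ.var y) :
    ((St.forr x y (.store a (.v x) e)).exec σ).arr a k = e.eval (σ.setVar x k) := by
  have := St.exec_forr' (x := x) (y := y) (c := .store a (.v x) e) (σ := σ)
    (fun i ρ => ∀ k < i, ρ.arr a k = e.eval (σ.setVar x k))
    (fun _ _ _ h => h) (by simp) fun i hi ρ hF h hx => ?_
  · exact this k hk
  · have hw : ∀ z, z ≠ x → ρ.var z = σ.var z := fun z hz =>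
      hF.var z (by simp [St.writes, hz.symm])
    have hst : ∀ b, b ≠ a → ρ.arr b = σ.arr b := fun b hb =>
      hF.arr b (by simp [St.stores, hb.symm])
    have he : e.eval ρ = e.eval (σ.setVar x i) := by
      refine Ex.eval_congr (fun z => ?_) fun b hb => ?_
      · by_cases hz : z = x
        · simp [hz, hx]
        · simp [hz, hw z hz]
      · rw [hst b (fun h => by simp [h, hr] at hb)]; rfl
    intro k hk
    simp only [St.exec, Mem.setArr_arr, true_and, Ex.eval, hx, he]
    by_cases hki : k = i
    · subst hki; simp
    · rw [if_neg hki]; exact h k (by omega)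

/-! ### Conditions -/

/-- The condition `e` is satisfied. -/
def Ex.Holds (e : Ex) (σ : Mem) : Prop := e.eval σ ≠ 0

instance (e : Ex) (σ : Mem) : Decidable (e.Holds σ) := inferInstanceAs (Decidable (_ ≠ 0))

/-- Equality of two expressions as a condition. -/
def Ex.eq (a b : Ex) : Ex := .sub (.c 1) (.add (.sub a b) (.sub b a))

/-- The condition `a < b`. -/
def Ex.lt (a b : Ex) : Ex := .sub b a

/-- The condition `a ≤ b`. -/
def Ex.le (a b : Ex) : Ex := .sub (.c 1) (.sub a b)

/-- Negation of a condition. -/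
def Ex.nt (a : Ex) : Ex := .sub (.c 1) a

/-- Conjunction of two conditions. -/
def Ex.an (a b : Ex) : Ex := .ite a b (.c 0)

/-- Disjunction of two conditions. -/
def Ex.or (a b : Ex) : Ex := .add a b

/-- The condition `e` holds for some value of `x` below the value of `y`. -/
def Ex.ex (x y : Reg) (e : Ex) : Ex := .sum x y e

/-- The condition `e` holds for all values of `x` below the value of `y`. -/
def Ex.al (x y : Reg) (e : Ex) : Ex := .nt (.ex x y (.nt e))

section Holds

variable {a b e : Ex} {σ : Mem}

lemma eval_ne_zero : e.eval σ ≠ 0 ↔ e.Holds σ := Iff.rfl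

@[simp]
lemma holds_v {x : Reg} : (Ex.v x).Holds σ ↔ σ.var x ≠ 0 := Iff.rfl

@[simp]
lemma holds_ld {a : Arr} : (Ex.ld a e).Holds σ ↔ σ.arr a (e.eval σ) ≠ 0 := Iff.rfl

@[simp]
lemma holds_eq : (Ex.eq a b).Holds σ ↔ a.eval σ = b.eval σ := by
  simp only [Ex.Holds, Ex.eq, Ex.eval]; omega

@[simp]
lemma holds_lt : (Ex.lt a b).Holds σ ↔ a.eval σ < b.eval σ := by
  simp only [Ex.Holds, Ex.lt, Ex.eval]; omega

@[simp]
lemma holds_le : (Ex.le a b).Holds σ ↔ a.eval σ ≤ b.eval σ := by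
  simp only [Ex.Holds, Ex.le, Ex.eval]; omega

@[simp]
lemma holds_nt : (Ex.nt a).Holds σ ↔ ¬ a.Holds σ := by
  simp only [Ex.Holds, Ex.nt, Ex.eval]; omega

@[simp]
lemma holds_an : (Ex.an a b).Holds σ ↔ a.Holds σ ∧ b.Holds σ := by
  simp only [Ex.Holds, Ex.an, Ex.eval]
  split_ifs with h <;> simp [h]

@[simp]
lemma holds_or : (Ex.or a b).Holds σ ↔ a.Holds σ ∨ b.Holds σ := by
  simp only [Ex.Holds, Ex.or, Ex.eval]; omega

@[simp]
lemma holds_ex {x y : Reg} :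
    (Ex.ex x y e).Holds σ ↔ ∃ i < σ.var y, e.Holds (σ.setVar x i) := by
  simp [Ex.Holds, Ex.ex]

@[simp]
lemma holds_al {x y : Reg} :
    (Ex.al x y e).Holds σ ↔ ∀ i < σ.var y, e.Holds (σ.setVar x i) := by
  simp [Ex.al]

@[simp]
lemma holds_ite {a b : Ex} :
    (Ex.ite e a b).Holds σ ↔ (e.Holds σ ∧ a.Holds σ) ∨ (¬ e.Holds σ ∧ b.Holds σ) := by
  simp only [Ex.Holds, Ex.eval]
  split_ifs with h <;> simp [h]

@[simp]
lemma eval_ite {a b : Ex} :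
    (Ex.ite e a b).eval σ = if e.Holds σ then a.eval σ else b.eval σ := rfl

lemma exec_ite {c d : St} :
    (St.ite e c d).exec σ = if e.Holds σ then c.exec σ else d.exec σ := rfl

end Holds

/-! ### Union of components along edges -/

open OMim

/-- Merging the labels of the endpoints of an edge. -/
lemma ker_relabel {V : Type*} (lab : V → ℕ) (i j : V) :
    Setoid.ker (fun v => if lab v = lab i then lab j else lab v) =
      joined (Setoid.ker lab) {s(i, j)} := by
  ext u v
  rw [joined_singleton_iff, Setoid.ker_def, Setoid.ker_def, Setoid.ker_def, Setoid.ker_def,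
    Setoid.ker_def, Setoid.ker_def]
  by_cases hu : lab u = lab i <;> by_cases hv : lab v = lab i
  · simp [hu, hv]
  · simp [hu, hv]
    grind
  · simp [hu, hv]
  · simp [hu, hv]
    grind

/-- The component labels `lab` are updated for all edges `xy` satisfying the condition `e`, where
`x` and `y` range over the numbers below the value of `r`; if an edge joins vertices of the same
component, then `ok` is set to `0`. -/
def unite (r : Reg) (e : Ex) : St :=
  .forr .x r (.forr .y r (.ite e
    (.seq (.assign .lx (.ld .lab (.v .x))) (.seq (.assign .ly (.ld .lab (.v .y)))
      (.seq (.ite (.eq (.v .lx) (.v .ly)) (.assign .ok (.c 0)) .skip)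
        (.forr .z r (.store .lab (.v .z)
          (.ite (.eq (.ld .lab (.v .z)) (.v .lx)) (.v .ly) (.ld .lab (.v .z))))))))
    .skip))

/-- The labels of the vertices `0, …, N - 1`. -/
def labels (N : ℕ) (σ : Mem) (i : Fin N) : ℕ := σ.arr .lab i

/-- The edges given by a relation on numbers. -/
def pairEdges (N : ℕ) (Q : ℕ → ℕ → Prop) : Set (Sym2 (Fin N)) :=
  {e | ∃ i j : Fin N, e = s(i, j) ∧ Q i j}

lemma labels_relabel {N : ℕ} {r : Reg} {σ : Mem} (hN : σ.var r = N) :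
    labels N ((St.forr .z r (.store .lab (.v .z)
          (.ite (.eq (.ld .lab (.v .z)) (.v .lx)) (.v .ly) (.ld .lab (.v .z))))).exec σ) =
      fun v => if labels N σ v = σ.var .lx then σ.var .ly else labels N σ v := by
  have := St.exec_forr' (x := .z) (y := r) (c := .store .lab (.v .z)
          (.ite (.eq (.ld .lab (.v .z)) (.v .lx)) (.v .ly) (.ld .lab (.v .z)))) (σ := σ)
    (fun i ρ => ∀ k, ρ.arr .lab k = if k < i ∧ σ.arr .lab k = σ.var .lx then σ.var .ly
      else σ.arr .lab k)
    (fun _ _ _ h => h) (by simp) fun i hi ρ hF h hx => ?_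
  · funext v
    simp only [labels]
    rw [this, hN]
    by_cases hc : σ.arr .lab v = σ.var .lx <;> simp [hc]
  · intro k
    have h₁ : ρ.var .lx = σ.var .lx := hF.var _ rfl
    have h₂ : ρ.var .ly = σ.var .ly := hF.var _ rfl
    simp only [St.exec, Mem.setArr_arr, true_and, eval_ite, holds_eq, eval_ld, eval_v, hx, h, h₁,
      h₂]
    by_cases hk : k = i
    · subst hk; simp
    · simp [hk, show k < i + 1 ↔ k < i by omega]

/-- The labels describe the components after adding the given edges, and `ok` tells whether these
edges formed a forest over the components at the beginning. -/
theorem unite_spec {N : ℕ} {r : Reg} {e : Ex} (hr : r.lim) {σ : Mem} (hN : σ.var r = N)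
    (P : ℕ → ℕ → Prop) (hP : ∀ i j, P i j → ¬ P j i)
    (he : ∀ ρ, Frame (unite r e) σ ρ → ρ.var .x < N → ρ.var .y < N →
      (e.Holds ρ ↔ P (ρ.var .x) (ρ.var .y))) :
    Setoid.ker (labels N ((unite r e).exec σ)) =
        joined (Setoid.ker (labels N σ)) (pairEdges N P) ∧
      (((unite r e).exec σ).var .ok ≠ 0 ↔
        σ.var .ok ≠ 0 ∧ ForestOver (Setoid.ker (labels N σ)) (pairEdges N P)) := by
  classical
  set J : (ℕ → ℕ → Prop) → Mem → Prop := fun Q ρ =>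
    Setoid.ker (labels N ρ) = joined (Setoid.ker (labels N σ)) (pairEdges N Q) ∧
      (ρ.var .ok ≠ 0 ↔ σ.var .ok ≠ 0 ∧ ForestOver (Setoid.ker (labels N σ)) (pairEdges N Q))
    with hJ
  have hJset : ∀ Q ρ (x : Reg) k, x ≠ .ok → J Q ρ → J Q (ρ.setVar x k) := by
    intro Q ρ x k hx h
    refine ⟨h.1, ?_⟩
    simpa [hx.symm] using h.2
  have hJcongr : ∀ Q Q' ρ, (∀ i < N, ∀ j < N, Q i j ↔ Q' i j) → J Q ρ → J Q' ρ := by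
    intro Q Q' ρ h hj
    have : pairEdges N Q = pairEdges N Q' := by
      ext e
      exact exists_congr fun i => exists_congr fun j => and_congr_right fun _ => h i i.2 j j.2
    simpa only [hJ, this] using hj
  have hrx : ∀ x : Reg, x.lim = false → r ≠ x := fun x hx h => by simp [← h, hr] at hx
  -- One edge.
  have hstep : ∀ Q ρ, ρ.var r = N → ρ.var .x < N → ρ.var .y < N →
      (¬ Q (ρ.var .x) (ρ.var .y) ∧ ¬ Q (ρ.var .y) (ρ.var .x)) → J Q ρ →
      J (fun i j => Q i j ∨ (i = ρ.var .x ∧ j = ρ.var .y)) ((St.seq (.assign .lx (.ld .lab (.v .x)))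
        (.seq (.assign .ly (.ld .lab (.v .y)))
      (.seq (.ite (.eq (.v .lx) (.v .ly)) (.assign .ok (.c 0)) .skip)
        (.forr .z r (.store .lab (.v .z)
          (.ite (.eq (.ld .lab (.v .z)) (.v .lx)) (.v .ly) (.ld .lab (.v .z)))))))).exec ρ) := by
    rintro Q ρ hρ hx hy ⟨hQ, hQ'⟩ ⟨h₁, h₂⟩
    set i : Fin N := ⟨ρ.var .x, hx⟩ with hi
    set j : Fin N := ⟨ρ.var .y, hy⟩ with hj
    have hset : pairEdges N (fun i j => Q i j ∨ (i = ρ.var .x ∧ j = ρ.var .y)) =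
        insert s(i, j) (pairEdges N Q) := by
      ext e
      constructor
      · rintro ⟨a, b, rfl, h | ⟨ha, hb⟩⟩
        · exact Or.inr ⟨a, b, rfl, h⟩
        · left
          rw [show a = i from Fin.ext ha, show b = j from Fin.ext hb]
      · rintro (rfl | ⟨a, b, rfl, h⟩)
        · exact ⟨i, j, rfl, Or.inr ⟨rfl, rfl⟩⟩
        · exact ⟨a, b, rfl, Or.inl h⟩
    have hnot : s(i, j) ∉ pairEdges N Q := by
      rintro ⟨a, b, hab, h⟩
      rcases Sym2.eq_iff.1 hab with ⟨rfl, rfl⟩ | ⟨rfl, rfl⟩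
      · exact hQ h
      · exact hQ' h
    set ρ₁ := (ρ.setVar .lx (ρ.arr .lab (ρ.var .x))).setVar .ly (ρ.arr .lab (ρ.var .y)) with hρ₁
    set ρ₂ := (St.ite (.eq (.v .lx) (.v .ly)) (.assign .ok (.c 0)) .skip).exec ρ₁ with hρ₂
    have hexec : ∀ c : St, (St.seq (.assign .lx (.ld .lab (.v .x)))
        (.seq (.assign .ly (.ld .lab (.v .y)))
      (.seq (.ite (.eq (.v .lx) (.v .ly)) (.assign .ok (.c 0)) .skip) c))).exec ρ =
        c.exec ρ₂ := by
      intro c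
      simp [St.exec, hρ₂, hρ₁]
    rw [hexec, hJ]
    have hlab₂ : labels N ρ₂ = labels N ρ := by
      have : ρ₂.arr .lab = ρ.arr .lab := (St.exec_arr rfl ρ₁).trans rfl
      funext v; simp only [labels, this]
    have hlx : ρ₂.var .lx = labels N ρ i := (St.exec_var rfl ρ₁).trans (by simp [hρ₁]; rfl)
    have hly : ρ₂.var .ly = labels N ρ j := (St.exec_var rfl ρ₁).trans (by simp [hρ₁]; rfl)
    have hr₂ : ρ₂.var r = N := by
      have hw := hrx .ok rfl
      rw [hρ₂, St.exec_var (by simp [St.writes, hw.symm]), hρ₁]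
      simp [hrx .lx rfl, hrx .ly rfl, hρ]
    have hok₂ : ρ₂.var .ok ≠ 0 ↔ ρ.var .ok ≠ 0 ∧ labels N ρ i ≠ labels N ρ j := by
      rw [hρ₂, exec_ite]
      have h1 : ρ₁.var .lx = labels N ρ i := by simp [hρ₁]; rfl
      have h2 : ρ₁.var .ly = labels N ρ j := by simp [hρ₁]; rfl
      simp only [holds_eq, Ex.eval, h1, h2]
      split_ifs with h
      · simp [St.exec, h]
      · simp [St.exec, h, hρ₁]
    refine ⟨?_, ?_⟩
    · rw [labels_relabel hr₂, hlab₂, hlx, hly, ker_relabel, h₁, joined_joined,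
        Set.union_singleton, hset]
    · rw [St.exec_var rfl, hok₂, h₂, hset, forestOver_insert hnot, within_mk, ← h₁, and_assoc]
      rfl
  -- All edges.
  have hmain := St.exec_forr' (x := .x) (y := r) (σ := σ)
    (c := .forr .y r (.ite e
    (.seq (.assign .lx (.ld .lab (.v .x))) (.seq (.assign .ly (.ld .lab (.v .y)))
      (.seq (.ite (.eq (.v .lx) (.v .ly)) (.assign .ok (.c 0)) .skip)
        (.forr .z r (.store .lab (.v .z)
          (.ite (.eq (.ld .lab (.v .z)) (.v .lx)) (.v .ly) (.ld .lab (.v .z))))))))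
    .skip))
    (fun k ρ => J (fun i j => P i j ∧ i < k) ρ)
    (fun i ρ k h => hJset _ _ _ _ (by simp) h) ?_ fun i hi ρ hF h hx => ?_
  · rw [hN] at hmain
    exact hJcongr _ P _ (fun i hi j _ => by simp [hi]) hmain
  · have : pairEdges N (fun i j => P i j ∧ i < 0) = ∅ := by
      ext e; simp [pairEdges]
    simp only [hJ, this, joined_empty, forestOver_empty, and_true, and_self]
  · rw [hN] at hi
    have hρr : ρ.var r = N := by
      rw [hF.var r ?_, hN]
      simp [St.writes, (hrx .x rfl).symm, (hrx .y rfl).symm, (hrx .lx rfl).symm,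
        (hrx .ly rfl).symm, (hrx .ok rfl).symm, (hrx .z rfl).symm]
    have hin := St.exec_forr' (x := .y) (y := r) (σ := ρ)
      (c := .ite e
    (.seq (.assign .lx (.ld .lab (.v .x))) (.seq (.assign .ly (.ld .lab (.v .y)))
      (.seq (.ite (.eq (.v .lx) (.v .ly)) (.assign .ok (.c 0)) .skip)
        (.forr .z r (.store .lab (.v .z)
          (.ite (.eq (.ld .lab (.v .z)) (.v .lx)) (.v .ly) (.ld .lab (.v .z))))))))
    .skip)
      (fun k θ => J (fun a b => P a b ∧ (a < i ∨ (a = i ∧ b < k))) θ)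
      (fun i ρ k h => hJset _ _ _ _ (by simp) h) ?_ fun j hj θ hF' h' hy => ?_
    · rw [hρr] at hin
      refine hJcongr _ _ _ (fun a ha b hb => ?_) hin
      simp only [hb, and_true]
      exact and_congr_right fun _ => by omega
    · refine hJcongr _ _ _ (fun a ha b hb => ?_) h
      simp
    · rw [hρr] at hj
      have hθx : θ.var .x = i := by rw [hF'.var .x rfl, hx]
      have hθr : θ.var r = N := by
        rw [hF'.var r ?_, hρr]
        simp [St.writes, (hrx .y rfl).symm, (hrx .lx rfl).symm,
          (hrx .ly rfl).symm, (hrx .ok rfl).symm, (hrx .z rfl).symm]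
      have hFθ : Frame (unite r e) σ θ := by
        have hρ' : ρ.setVar .x i = ρ := by
          cases ρ; simp only [Mem.setVar]
          congr
          exact Function.update_eq_self_iff.2 hx.symm
        exact hF.body (i := i) (by rw [hρ']; exact hF')
      have hiff := he θ hFθ (by rw [hθx]; exact hi) (by rw [hy]; exact hj)
      rw [hθx, hy] at hiff
      rw [exec_ite]
      split_ifs with hh
      · have hPij := hiff.1 hh
        have := hstep (fun a b => P a b ∧ (a < i ∨ (a = i ∧ b < j))) θ hθr (by omega) (by omega)
          (by rw [hθx, hy]; exact ⟨fun h => by omega, fun h => hP _ _ hPij h.1⟩) h'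
        refine hJcongr _ _ _ (fun a ha b hb => ?_) this
        simp only [hθx, hy]
        constructor
        · rintro (⟨h1, h2⟩ | ⟨rfl, rfl⟩)
          · exact ⟨h1, by omega⟩
          · exact ⟨hPij, by omega⟩
        · rintro ⟨h1, h2⟩
          by_cases hab : a = i ∧ b = j
          · exact Or.inr hab
          · exact Or.inl ⟨h1, by omega⟩
      · refine hJcongr _ _ _ (fun a ha b hb => and_congr_right fun hab => ?_) h'
        have : ¬ (a = i ∧ b = j) := by
          rintro ⟨rfl, rfl⟩
          exact hh (hiff.2 hab)
        omega

/-! ### The input in memory -/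

section Input

variable {n m f : ℕ} {G : SimpleGraph (Fin n)} {w : Fin n → ℕ}
  {D : BranchDecomposition (Fin n) (Fin m)} {σ ρ : Mem}

/-- The memory holds the input, `n + 1`, and the flag `f` for the problem to be solved. -/
structure Inp (f : ℕ) (G : SimpleGraph (Fin n)) (w : Fin n → ℕ)
    (D : BranchDecomposition (Fin n) (Fin m)) (σ : Mem) : Prop where
  var_n : σ.var .n = n
  var_m : σ.var .m = m
  var_nn : σ.var .nn = n + 1
  var_fvs : σ.var .fvs = f
  arr_wt : σ.arr .wt = funArray w
  arr_adj : σ.arr .adj = adjArray G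
  arr_tree : σ.arr .tree = adjArray D.tree
  arr_leaf : σ.arr .leaf = funArray fun v => (D.leaf v : ℕ)

/-- The statement does not write the input. -/
def St.pure (c : St) : Bool :=
  !c.writes .n && !c.writes .m && !c.writes .nn && !c.writes .fvs &&
    !c.stores .wt && !c.stores .adj && !c.stores .tree && !c.stores .leaf

lemma Inp.frame {c : St} (h : Inp f G w D σ) (hF : Frame c σ ρ) (hc : c.pure = true) :
    Inp f G w D ρ := by
  simp only [St.pure, Bool.and_eq_true, Bool.not_eq_true'] at hc
  obtain ⟨⟨⟨⟨⟨⟨⟨h1, h2⟩, h3⟩, h4⟩, h5⟩, h6⟩, h7⟩, h8⟩ := hc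
  exact ⟨(hF.var _ h1).trans h.var_n, (hF.var _ h2).trans h.var_m, (hF.var _ h3).trans h.var_nn,
    (hF.var _ h4).trans h.var_fvs, (hF.arr _ h5).trans h.arr_wt, (hF.arr _ h6).trans h.arr_adj,
    (hF.arr _ h7).trans h.arr_tree, (hF.arr _ h8).trans h.arr_leaf⟩

lemma Inp.exec {c : St} (h : Inp f G w D σ) (hc : c.pure = true) : Inp f G w D (c.exec σ) :=
  h.frame (c.frame σ) hc

lemma Inp.setVar (h : Inp f G w D σ) {x : Reg} (k : ℕ)
    (hx : (St.assign x (.c 0)).pure = true := by rfl) : Inp f G w D (σ.setVar x k) :=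
  h.frame (c := .assign x (.c 0)) ((Frame.refl _ _).setVar (by simp [St.writes]) k) hx

lemma adjArray_ne_zero_iff {N : ℕ} {H : SimpleGraph (Fin N)} {u v : ℕ} (hv : v < N) :
    adjArray H (N * u + v) ≠ 0 ↔ ∃ hu : u < N, H.Adj ⟨u, hu⟩ ⟨v, hv⟩ := by
  have h01 : adjArray H (N * u + v) ≠ 0 ↔ ∃ a b : Fin N, H.Adj a b ∧ N * u + v = N * a + b := by
    unfold adjArray
    split_ifs with h <;> simp [h]
  rw [h01]
  constructor
  · rintro ⟨a, b, hab, he⟩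
    have hN : 0 < N := by omega
    have h₁ : u = a := by
      have := congrArg (· / N) he
      simpa [Nat.mul_add_div hN, Nat.div_eq_of_lt hv, Nat.div_eq_of_lt b.2] using this
    subst h₁
    have h₂ : v = b := by omega
    subst h₂
    exact ⟨a.2, hab⟩
  · rintro ⟨hu, h⟩
    exact ⟨_, _, h, rfl⟩

/-- Adjacency in the graph. -/
def gadj (u v : Ex) : Ex := .ld .adj (.add (.mul .n u) v)

/-- Adjacency in the tree. -/
def tadj (u v : Ex) : Ex := .ld .tree (.add (.mul .m u) v)

lemma Inp.holds_gadj (h : Inp f G w D σ) {u v : Ex} (hv : v.eval σ < n) :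
    (gadj u v).Holds σ ↔ ∃ hu : u.eval σ < n, G.Adj ⟨u.eval σ, hu⟩ ⟨v.eval σ, hv⟩ := by
  simp only [gadj, holds_ld, eval_add, eval_mul, h.var_n, h.arr_adj]
  exact adjArray_ne_zero_iff hv

lemma Inp.holds_tadj (h : Inp f G w D σ) {u v : Ex} (hu : u.eval σ < m) (hv : v.eval σ < m) :
    (tadj u v).Holds σ ↔ D.tree.Adj ⟨u.eval σ, hu⟩ ⟨v.eval σ, hv⟩ := by
  simp only [tadj, holds_ld, eval_add, eval_mul, h.var_m, h.arr_tree]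
  rw [adjArray_ne_zero_iff hv]
  exact ⟨fun ⟨_, h⟩ => h, fun h => ⟨hu, h⟩⟩

lemma Inp.leaf_eq (h : Inp f G w D σ) (v : Fin n) : σ.arr .leaf v = D.leaf v := by
  simp [h.arr_leaf, funArray]

lemma Inp.wt_eq (h : Inp f G w D σ) (v : Fin n) : σ.arr .wt v = w v := by
  simp [h.arr_wt, funArray]

/-- The set of vertices described by the segment of the array `a` starting at `p`. -/
def bits (n : ℕ) (σ : Mem) (a : Arr) (p : ℕ) : Finset (Fin n) :=
  Finset.univ.filter fun v => σ.arr a (p + v) ≠ 0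

@[simp]
lemma mem_bits {a : Arr} {p : ℕ} {v : Fin n} : v ∈ bits n σ a p ↔ σ.arr a (p + v) ≠ 0 := by
  simp [bits]

lemma bits_congr {a b : Arr} {p q : ℕ} (h : ∀ v < n, σ.arr a (p + v) = ρ.arr b (q + v)) :
    bits n σ a p = bits n ρ b q := by
  ext v
  simp [h v v.2]

/-! ### The side of a tree edge -/

/-- Compute in `inA` the side of `s` of the tree edge `st`, through the components of the tree
without this edge. -/
def sideProg : St :=
  .seq (.forr .v .m (.store .lab (.v .v) (.v .v)))
    (.seq (unite .m (.an (.lt (.v .x) (.v .y)) (.an (tadj (.v .x) (.v .y))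
        (.nt (.or (.an (.eq (.v .x) (.v .s)) (.eq (.v .y) (.v .t)))
          (.an (.eq (.v .x) (.v .t)) (.eq (.v .y) (.v .s))))))))
      (.forr .v .n (.store .inA (.v .v)
        (.eq (.ld .lab (.ld .leaf (.v .v))) (.ld .lab (.v .s))))))

theorem sideProg_spec (h : Inp f G w D σ) {s t : Fin m} (hs : σ.var .s = s) (ht : σ.var .t = t) :
    (bits n (sideProg.exec σ) .inA 0 : Set (Fin n)) = D.side s t := by
  set σ₁ := (St.forr .v .m (.store .lab (.v .v) (.v .v))).exec σ with hσ₁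
  set cu := unite .m (.an (.lt (.v .x) (.v .y)) (.an (tadj (.v .x) (.v .y))
        (.nt (.or (.an (.eq (.v .x) (.v .s)) (.eq (.v .y) (.v .t)))
          (.an (.eq (.v .x) (.v .t)) (.eq (.v .y) (.v .s))))))) with hcu
  have h₁ : Inp f G w D σ₁ := h.exec rfl
  have hker : Setoid.ker (labels m σ₁) = ⊥ := by
    rw [Setoid.ker_eq_bot_iff]
    intro i j hij
    have hl : ∀ i : Fin m, labels m σ₁ i = i := fun i => by
      rw [labels, hσ₁, St.exec_fill rfl _ (by rw [h.var_m]; exact i.2)]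
      simp
    rw [hl, hl] at hij
    exact Fin.ext hij
  have hs₁ : σ₁.var .s = s := (St.exec_var rfl _).trans hs
  have ht₁ : σ₁.var .t = t := (St.exec_var rfl _).trans ht
  obtain ⟨hlab, -⟩ := unite_spec (N := m) (r := .m) (e := (.an (.lt (.v .x) (.v .y))
        (.an (tadj (.v .x) (.v .y))
        (.nt (.or (.an (.eq (.v .x) (.v .s)) (.eq (.v .y) (.v .t)))
          (.an (.eq (.v .x) (.v .t)) (.eq (.v .y) (.v .s)))))))) rfl h₁.var_m
    (fun i j => i < j ∧ (∃ (hi : i < m) (hj : j < m), D.tree.Adj ⟨i, hi⟩ ⟨j, hj⟩) ∧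
      ¬ ((i = s ∧ j = t) ∨ (i = t ∧ j = s))) (fun i j h h' => by omega)
    (fun ρ hF hx hy => by
      have hρ : Inp f G w D ρ := h₁.frame hF rfl
      have e₁ : ρ.var .s = s := (hF.var _ rfl).trans hs₁
      have e₂ : ρ.var .t = t := (hF.var _ rfl).trans ht₁
      simp only [holds_an, holds_lt, holds_nt, holds_or, holds_eq, eval_v, e₁, e₂,
        hρ.holds_tadj (u := .v .x) (v := .v .y) hx hy]
      constructor
      · rintro ⟨h1, h2, h3⟩
        exact ⟨h1, ⟨hx, hy, h2⟩, h3⟩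
      · rintro ⟨h1, ⟨_, _, h2⟩, h3⟩
        exact ⟨h1, h2, h3⟩)
  have hE : pairEdges m (fun i j => i < j ∧ (∃ (hi : i < m) (hj : j < m),
      D.tree.Adj ⟨i, hi⟩ ⟨j, hj⟩) ∧ ¬ ((i = s ∧ j = t) ∨ (i = t ∧ j = s))) =
      (D.tree.deleteEdges {s(s, t)}).edgeSet := by
    ext e
    induction e with | h a b =>
    rw [SimpleGraph.mem_edgeSet, SimpleGraph.deleteEdges_adj, Set.mem_singleton_iff, Sym2.eq_iff]
    have key : ∀ a b : Fin m, a < b → D.tree.Adj a b → ¬ ((a = s ∧ b = t) ∨ (a = t ∧ b = s)) →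
        s(a, b) ∈ pairEdges m (fun i j => i < j ∧ (∃ (hi : i < m) (hj : j < m),
      D.tree.Adj ⟨i, hi⟩ ⟨j, hj⟩) ∧ ¬ ((i = s ∧ j = t) ∨ (i = t ∧ j = s))) := by
      intro a b hab hadj hn
      refine ⟨a, b, rfl, hab, ⟨a.2, b.2, hadj⟩, ?_⟩
      simpa only [← Fin.ext_iff] using hn
    constructor
    · rintro ⟨i, j, he, -, ⟨_, _, hadj⟩, hn⟩
      simp only [← Fin.ext_iff] at hn
      rcases Sym2.eq_iff.1 he with ⟨rfl, rfl⟩ | ⟨rfl, rfl⟩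
      · exact ⟨hadj, hn⟩
      · exact ⟨hadj.symm, fun h => hn (by tauto)⟩
    · rintro ⟨hadj, hn⟩
      rcases lt_or_gt_of_ne hadj.ne with hab | hab
      · exact key a b hab hadj hn
      · rw [Sym2.eq_swap]
        exact key b a hab hadj.symm (by tauto)
  rw [hker, hE] at hlab
  set σ₂ := cu.exec σ₁ with hσ₂
  have h₂ : Inp f G w D σ₂ := h₁.exec rfl
  have hs₂ : σ₂.var .s = s := (St.exec_var rfl _).trans hs₁
  ext v
  have hexec : sideProg.exec σ = (St.forr .v .n (.store .inA (.v .v)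
        (.eq (.ld .lab (.ld .leaf (.v .v))) (.ld .lab (.v .s))))).exec σ₂ := rfl
  rw [Finset.mem_coe, mem_bits, zero_add, hexec, St.exec_fill rfl _ (by rw [h₂.var_n]; exact v.2)]
  have hh := holds_eq (a := .ld .lab (.ld .leaf (.v .v))) (b := .ld .lab (.v .s))
    (σ := σ₂.setVar .v v)
  rw [Ex.Holds] at hh
  rw [hh]
  simp only [eval_ld, eval_v, Mem.setVar_arr, Mem.setVar_var, if_pos, h₂.leaf_eq,
    reduceCtorEq, if_false, hs₂]
  have : Setoid.ker (labels m σ₂) s (D.leaf v) ↔ v ∈ D.side s t := by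
    rw [hlab, joined_bot_iff_reachable]
    rfl
  rw [← this, Setoid.ker_def, eq_comm]
  rfl

/-! ### Digits -/

/-- Write the digits of `q` in base `n + 1` to the array `dig`. -/
def decode : St :=
  .forr .j .len (.seq
    (.assign .quo (.sum .k₁ .num (.le (.mul .nn (.add (.v .k₁) (.c 1))) (.v .q))))
    (.seq (.store .dig (.v .j) (.sub (.v .q) (.mul .nn (.v .quo)))) (.assign .q (.v .quo))))

lemma sum_le_eq_div {N q M : ℕ} (hN : 0 < N) (hq : q ≤ M) :
    ∑ i ∈ Finset.range M, (1 - (N * (i + 1) - q)) = q / N := by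
  have h : ∀ i, 1 - (N * (i + 1) - q) = if i < q / N then 1 else 0 := by
    intro i
    have : i < q / N ↔ N * (i + 1) ≤ q := by
      rw [← Nat.succ_le_iff, Nat.le_div_iff_mul_le hN, mul_comm]
    split_ifs with hi
    · have := this.1 hi; omega
    · have := mt this.2 hi; omega
  have hqM : q / N ≤ M := (Nat.div_le_self _ _).trans hq
  rw [Finset.sum_congr rfl fun i _ => h i, ← Finset.sum_filter, Finset.sum_const, smul_eq_mul,
    mul_one]
  have : (Finset.range M).filter (· < q / N) = Finset.range (q / N) := by
    ext i; simp; omega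
  rw [this, Finset.card_range]

theorem decode_spec {N q : ℕ} (hN : 0 < N) (hnn : σ.var .nn = N) (hq : σ.var .q = q)
    (hM : q ≤ σ.var .num) {j : ℕ} (hj : j < σ.var .len) :
    (decode.exec σ).arr .dig j = q / N ^ j % N := by
  have := St.exec_forr' (x := .j) (y := .len) (σ := σ) (c := .seq
    (.assign .quo (.sum .k₁ .num (.le (.mul .nn (.add (.v .k₁) (.c 1))) (.v .q))))
    (.seq (.store .dig (.v .j) (.sub (.v .q) (.mul .nn (.v .quo)))) (.assign .q (.v .quo))))
    (fun i ρ => ρ.var .q = q / N ^ i ∧ ∀ j < i, ρ.arr .dig j = q / N ^ j % N)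
    (fun i ρ k h => by simpa using h) (by simpa using hq) fun i hi ρ hF h hx => ?_
  · exact this.2 j hj
  · have h₁ : ρ.var .nn = N := (hF.var _ rfl).trans hnn
    have h₂ : ρ.var .num = σ.var .num := hF.var _ rfl
    have hle : q / N ^ i ≤ σ.var .num := (Nat.div_le_self _ _).trans hM
    have hquo : (Ex.sum .k₁ .num (.le (.mul .nn (.add (.v .k₁) (.c 1))) (.v .q))).eval ρ =
        q / N ^ i / N := by
      rw [← sum_le_eq_div hN hle, ← h₂, ← h.1]
      simp [Ex.le, h₁]
    simp only [St.exec, hquo]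
    have hdd : q / N ^ i / N = q / N ^ (i + 1) := by rw [Nat.div_div_eq_div_mul, pow_succ]
    refine ⟨by simp [hdd], fun j hj => ?_⟩
    simp only [Mem.setVar_arr, Mem.setArr_arr, true_and, eval_v, Mem.setVar_var, reduceCtorEq,
      if_false, hx, eval_sub, eval_mul, h.1, h₁, if_true]
    by_cases hji : j = i
    · subst hji
      rw [if_pos rfl, Nat.mod_def]
    · rw [if_neg hji, h.2 j (by omega)]

/-- Every sequence of digits is the sequence of digits of some number. -/
lemma exists_digits {N L : ℕ} (g : ℕ → ℕ) (hg : ∀ j < L, g j < N) :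
    ∃ q < N ^ L, ∀ j < L, q / N ^ j % N = g j := by
  let q := finFunctionFinEquiv fun j : Fin L => (⟨g j, hg j j.2⟩ : Fin N)
  refine ⟨q, q.2, fun j hj => ?_⟩
  have := congrArg (fun F => ((F ⟨j, hj⟩ : Fin N) : ℕ))
    (finFunctionFinEquiv.symm_apply_apply fun j : Fin L => (⟨g j, hg j j.2⟩ : Fin N))
  exact this

/-- A set of at most `ℓ` vertices is listed by `ℓ` digits, where `n` stands for no vertex. -/
lemma exists_listing {n ℓ : ℕ} (S : Finset (Fin n)) (hS : S.card ≤ ℓ) :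
    ∃ u : ℕ → ℕ, (∀ j, u j ≤ n) ∧ (∀ v : Fin n, v ∈ S ↔ ∃ j < ℓ, u j = v) ∧
      ∀ j j', u j = u j' → u j < n → j = j' := by
  let e := S.equivFin
  refine ⟨fun j => if h : j < S.card then (e.symm ⟨j, h⟩ : Fin n) else n, fun j => ?_,
    fun v => ⟨fun hv => ?_, ?_⟩, fun j j' h hlt => ?_⟩
  · dsimp only
    split_ifs
    · exact Fin.is_le'
    · exact le_rfl
  · refine ⟨e ⟨v, hv⟩, (e ⟨v, hv⟩).2.trans_le hS, ?_⟩
    simp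
  · rintro ⟨j, -, hj⟩
    dsimp only at hj
    split_ifs at hj with h
    · rw [← Fin.ext hj]
      exact (e.symm ⟨j, h⟩).2
    · exact (v.2.ne hj.symm).elim
  · dsimp only at h hlt
    by_cases hj : j < S.card
    · by_cases hj' : j' < S.card
      · rw [dif_pos hj, dif_pos hj'] at h
        have := e.symm.injective (Subtype.ext (Fin.ext h))
        simpa using this
      · rw [dif_pos hj, dif_neg hj'] at h
        rw [dif_pos hj, h] at hlt
        exact (lt_irrefl _ hlt).elim
    · rw [dif_neg hj] at hlt
      exact (lt_irrefl _ hlt).elim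

/-! ### Testing the width -/

/-- Membership in the current side (`b = true`) or in its complement. -/
def onSide (b : Bool) (e : Ex) : Ex := if b then .ld .inA e else .nt (.ld .inA e)

/-- The first `kap` digits list an irredundant set of the current side or its complement. -/
def irredundantCond (b : Bool) : Ex :=
  .al .k₁ .kap (.an (onSide b (.ld .dig (.v .k₁)))
    (.an (.al .k₂ .kap (.nt (gadj (.ld .dig (.v .k₁)) (.ld .dig (.v .k₂)))))
      (.ex .k₃ .n (.an (.nt (onSide b (.v .k₃))) (.an (gadj (.ld .dig (.v .k₁)) (.v .k₃))
        (.al .k₂ .kap (.or (.eq (.v .k₂) (.v .k₁))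
          (.nt (gadj (.ld .dig (.v .k₂)) (.v .k₃))))))))))

/-- The set `A` (`b = true`) or its complement. -/
def sideSet (b : Bool) (A : Set (Fin n)) : Set (Fin n) := if b then A else Aᶜ

lemma holds_onSide {A : Set (Fin n)} (hA : (bits n σ .inA 0 : Set (Fin n)) = A)
    {b : Bool} {e : Ex} (he : e.eval σ < n) :
    (onSide b e).Holds σ ↔ (⟨e.eval σ, he⟩ : Fin n) ∈ sideSet b A := by
  subst hA
  cases b <;> simp [onSide, sideSet]

/-- The first `p` entries of `d` list an irredundant subset of `A`. -/
def Lists (G : SimpleGraph (Fin n)) (A : Set (Fin n)) (p : ℕ) (d : ℕ → ℕ) : Prop :=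
  ∃ u : Fin p → Fin n, (∀ i : Fin p, d i = u i) ∧ (∀ i, u i ∈ A) ∧
    (∀ i j, ¬ G.Adj (u i) (u j)) ∧ ∀ i, ∃ y, y ∉ A ∧ G.Adj (u i) y ∧ ∀ j, G.Adj (u j) y → j = i

theorem holds_irredundantCond (h : Inp f G w D σ) {A : Set (Fin n)}
    (hA : (bits n σ .inA 0 : Set (Fin n)) = A) {b : Bool} {p : ℕ} (hp : σ.var .kap = p) :
    (irredundantCond b).Holds σ ↔ Lists G (sideSet b A) p (σ.arr .dig) := by
  -- Every listed digit has a neighbour, so it is a vertex and not the digit `n`.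
  have hlt : (irredundantCond b).Holds σ → ∀ i < p, σ.arr .dig i < n := by
    intro hh i hi
    simp only [irredundantCond, holds_al, hp] at hh
    have := hh i hi
    simp only [holds_an, holds_ex] at this
    obtain ⟨-, -, y, hy, -, hadj, -⟩ := this
    rw [Mem.setVar_var, if_neg (by simp), h.var_n] at hy
    rw [((h.setVar (x := .k₁) i).setVar (x := .k₃) y).holds_gadj (by simpa using hy)] at hadj
    obtain ⟨hu, -⟩ := hadj
    simpa using hu
  have key : (hd : ∀ i < p, σ.arr .dig i < n) → ((irredundantCond b).Holds σ ↔
      ∀ i (hi : i < p), (⟨_, hd i hi⟩ : Fin n) ∈ sideSet b A ∧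
        (∀ j (hj : j < p), ¬ G.Adj ⟨_, hd i hi⟩ ⟨_, hd j hj⟩) ∧
        ∃ (y : ℕ) (hy : y < n), (⟨y, hy⟩ : Fin n) ∉ sideSet b A ∧ G.Adj ⟨_, hd i hi⟩ ⟨y, hy⟩ ∧
          ∀ j (hj : j < p), j = i ∨ ¬ G.Adj ⟨_, hd j hj⟩ ⟨y, hy⟩) := by
    intro hd
    simp only [irredundantCond, holds_al, hp]
    refine forall_congr' fun i => forall_congr' fun hi => ?_
    have hI := h.setVar (x := .k₁) i
    simp only [holds_an, holds_ex, holds_al, holds_nt, holds_or, holds_eq]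
    have hdi : (Ex.ld .dig (.v .k₁)).eval (σ.setVar .k₁ i) < n := by simpa using hd i hi
    rw [holds_onSide (σ := σ.setVar .k₁ i) (A := A) hA hdi]
    refine and_congr (by simp) (and_congr ?_ ?_)
    · rw [Mem.setVar_var, if_neg (by simp), hp]
      refine forall_congr' fun j => forall_congr' fun hj => ?_
      rw [(hI.setVar (x := .k₂) j).holds_gadj (by simpa using hd j hj)]
      simp [hd i hi]
    · rw [Mem.setVar_var, if_neg (by simp), h.var_n]
      refine exists_congr fun y => ?_
      rw [← exists_prop]
      refine exists_congr fun hy => ?_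
      have hI' := hI.setVar (x := .k₃) y
      have hyn : (Ex.v .k₃).eval ((σ.setVar .k₁ i).setVar .k₃ y) < n := by simpa using hy
      rw [holds_onSide (σ := (σ.setVar .k₁ i).setVar .k₃ y) (A := A) hA hyn,
        hI'.holds_gadj hyn]
      refine and_congr (by simp) (and_congr (by simp [hd i hi]) ?_)
      simp only [Mem.setVar_var, reduceCtorEq, if_false, hp]
      refine forall_congr' fun j => forall_congr' fun hj => ?_
      rw [(hI'.setVar (x := .k₂) j).holds_gadj (by simpa using hy)]
      simp [hd j hj]
  constructor
  · intro hh
    have hd := hlt hh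
    rw [key hd] at hh
    refine ⟨fun i => ⟨_, hd i i.2⟩, fun i => rfl, fun i => (hh i i.2).1,
      fun i j => (hh i i.2).2.1 j j.2, fun i => ?_⟩
    obtain ⟨y, hy, h1, h2, h3⟩ := (hh i i.2).2.2
    exact ⟨⟨y, hy⟩, h1, h2, fun j hj => Fin.ext ((h3 j j.2).resolve_right fun h => h hj)⟩
  · rintro ⟨u, hu, h1, h2, h3⟩
    have hd : ∀ i < p, σ.arr .dig i < n := fun i hi => by rw [hu ⟨i, hi⟩]; exact (u _).2
    have hdu : ∀ i (hi : i < p), (⟨_, hd i hi⟩ : Fin n) = u ⟨i, hi⟩ := fun i hi =>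
      Fin.ext (hu ⟨i, hi⟩)
    rw [key hd]
    intro i hi
    rw [hdu i hi]
    refine ⟨h1 _, fun j hj => by rw [hdu j hj]; exact h2 _ _, ?_⟩
    obtain ⟨y, hy₁, hy₂, hy₃⟩ := h3 ⟨i, hi⟩
    refine ⟨y, y.2, hy₁, hy₂, fun j hj => ?_⟩
    rw [hdu j hj]
    by_cases hji : j = i
    · exact Or.inl hji
    · exact Or.inr fun hadj => hji (Fin.ext_iff.1 (hy₃ ⟨j, hj⟩ hadj))

lemma lists_congr {A : Set (Fin n)} {p : ℕ} {d d' : ℕ → ℕ} (h : ∀ i < p, d i = d' i) :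
    Lists G A p d ↔ Lists G A p d' := by
  refine exists_congr fun u => and_congr_left fun _ => forall_congr' fun i => ?_
  rw [h i i.2]

/-- The irredundant sets of size `p` are the sets listed by digits. -/
lemma hasIrredundant_iff_lists {A : Set (Fin n)} {p L : ℕ} (hp : p ≤ L) (hn : 0 < n) :
    HasIrredundant G A p ↔
      ∃ q < (n + 1) ^ L, Lists G A p fun j => q / (n + 1) ^ j % (n + 1) := by
  constructor
  · rintro ⟨R, ⟨hA, hind, hpriv⟩, hR⟩
    let e := R.equivFinOfCardEq hR
    obtain ⟨q, hq, hd⟩ := exists_digits (N := n + 1) (L := L)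
      (fun j => if h : j < p then (e.symm ⟨j, h⟩ : Fin n) else 0) fun j _ => by
        split_ifs
        · omega
        · omega
    refine ⟨q, hq, fun i => e.symm i, fun i => ?_, fun i => hA _ (e.symm i).2,
      fun i j => hind _ (e.symm i).2 _ (e.symm j).2, fun i => ?_⟩
    · exact (hd i (i.2.trans_le hp)).trans (dif_pos i.2)
    · obtain ⟨y, hy, hadj, hy'⟩ := hpriv _ (e.symm i).2
      exact ⟨y, hy, hadj, fun j hj => e.symm.injective (Subtype.ext (hy' _ (e.symm j).2 hj))⟩
  · rintro ⟨q, -, u, -, hA, hind, hpriv⟩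
    have hu : Function.Injective u := fun i j hij => by
      obtain ⟨y, -, hadj, hy⟩ := hpriv j
      exact hy i (hij ▸ hadj)
    refine ⟨Finset.univ.map ⟨u, hu⟩, ⟨?_, ?_, ?_⟩, by simp⟩
    · simpa using hA
    · simpa using hind
    · simp only [Finset.mem_map, Finset.mem_univ, true_and, Function.Embedding.coeFn_mk,
        forall_exists_index, forall_apply_eq_imp_iff]
      intro i
      obtain ⟨y, hy, hadj, hy'⟩ := hpriv i
      exact ⟨y, hy, hadj, fun j hj => by rw [hy' j hj]⟩

/-- Set `c₁` and `c₂` to nonzero values if the current side and its complement, respectively,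
contain an irredundant set whose size is the value of `kap`. -/
def searchProg : St :=
  .seq (.assign .c₁ (.c 0)) (.seq (.assign .c₂ (.c 0))
    (.forr .tau .num (.seq (.assign .q (.v .tau)) (.seq decode
      (.seq (.ite (irredundantCond true) (.assign .c₁ (.c 1)) .skip)
        (.ite (irredundantCond false) (.assign .c₂ (.c 1)) .skip))))))

theorem searchProg_spec (h : Inp f G w D σ) {A : Set (Fin n)}
    (hA : (bits n σ .inA 0 : Set (Fin n)) = A) {p : ℕ} (hp : σ.var .kap = p)
    (hpl : p ≤ σ.var .len) (hnum : σ.var .num = (n + 1) ^ σ.var .len) (hn : 0 < n) :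
    ((searchProg.exec σ).var .c₁ ≠ 0 ↔ HasIrredundant G A p) ∧
      ((searchProg.exec σ).var .c₂ ≠ 0 ↔ HasIrredundant G Aᶜ p) := by
  set L : (b : Bool) → ℕ → Prop := fun b q =>
    Lists G (sideSet b A) p fun j => q / (n + 1) ^ j % (n + 1) with hL
  have := St.exec_forr' (x := .tau) (y := .num) (σ := (σ.setVar .c₁ 0).setVar .c₂ 0)
    (c := .seq (.assign .q (.v .tau)) (.seq decode
      (.seq (.ite (irredundantCond true) (.assign .c₁ (.c 1)) .skip)
        (.ite (irredundantCond false) (.assign .c₂ (.c 1)) .skip))))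
    (fun k ρ => (ρ.var .c₁ ≠ 0 ↔ ∃ q < k, L true q) ∧ (ρ.var .c₂ ≠ 0 ↔ ∃ q < k, L false q))
    (fun i ρ k h => by simpa using h) (by simp) fun i hi ρ hF hI hx => ?_
  · have he : searchProg.exec σ = _ := rfl
    rw [hasIrredundant_iff_lists hpl hn, hasIrredundant_iff_lists hpl hn, he, ← hnum]
    exact this
  · set ρ₁ := ρ.setVar .q (ρ.var .tau) with hρ₁
    set ρ₂ := decode.exec ρ₁ with hρ₂
    set ρ₃ := (St.ite (irredundantCond true) (.assign .c₁ (.c 1)) .skip).exec ρ₂ with hρ₃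
    have hρ : Inp f G w D ρ := ((h.setVar (x := .c₁) 0).setVar (x := .c₂) 0).frame hF rfl
    have h₂ : Inp f G w D ρ₂ := (hρ.setVar (x := .q) _).exec rfl
    have h₃ : Inp f G w D ρ₃ := h₂.exec rfl
    have hlen : ρ₁.var .len = σ.var .len := hF.var .len rfl
    have hnum' : ρ₁.var .num = σ.var .num := hF.var .num rfl
    have hi' : i < σ.var .num := hi
    have hdig : ∀ j < p, ρ₂.arr .dig j = i / (n + 1) ^ j % (n + 1) := fun j hj =>
      decode_spec (Nat.succ_pos n) (by simp [hρ₁, hρ.var_nn]) (by simp [hρ₁, hx])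
        (by rw [hnum']; omega) (by omega)
    have hside : ∀ θ : Mem, θ.arr .inA = σ.arr .inA → (bits n θ .inA 0 : Set (Fin n)) = A :=
      fun θ hθ => by
        rw [← hA, bits_congr (ρ := σ) (b := .inA) (q := 0) fun v _ => by rw [hθ]]
    have ha₂ : ρ₂.arr .inA = σ.arr .inA := (St.exec_arr rfl _).trans (hF.arr .inA rfl)
    have ha₃ : ρ₃.arr .inA = σ.arr .inA := (St.exec_arr rfl _).trans ha₂
    have hd₃ : ρ₃.arr .dig = ρ₂.arr .dig := St.exec_arr rfl _
    have hk₂ : ρ₂.var .kap = p := (St.exec_var rfl _).trans ((hF.var .kap rfl).trans hp)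
    have hk₃ : ρ₃.var .kap = p := (St.exec_var rfl _).trans hk₂
    have hc₁ : (irredundantCond true).Holds ρ₂ ↔ L true i := by
      rw [holds_irredundantCond h₂ (hside _ ha₂) hk₂, lists_congr hdig]
    have hc₂ : (irredundantCond false).Holds ρ₃ ↔ L false i := by
      rw [holds_irredundantCond h₃ (hside _ ha₃) hk₃, hd₃, lists_congr hdig]
    have hv₁ : ρ₂.var .c₁ = ρ.var .c₁ := St.exec_var rfl _
    have hv₂ : ρ₃.var .c₂ = ρ.var .c₂ := (St.exec_var rfl _).trans (St.exec_var rfl _)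
    have hex : ∀ b, (∃ q < i + 1, L b q) ↔ (∃ q < i, L b q) ∨ L b i := fun b => by
      simp only [Nat.lt_succ_iff_lt_or_eq, or_and_right, exists_or, exists_eq_left]
    have hexec : (St.seq (.assign .q (.v .tau)) (.seq decode
      (.seq (.ite (irredundantCond true) (.assign .c₁ (.c 1)) .skip)
        (.ite (irredundantCond false) (.assign .c₂ (.c 1)) .skip)))).exec ρ =
      (St.ite (irredundantCond false) (.assign .c₂ (.c 1)) .skip).exec ρ₃ := rfl
    rw [hexec]
    refine ⟨?_, ?_⟩
    · rw [St.exec_var rfl, hρ₃, exec_ite, hex, ← hI.1, ← hc₁]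
      split_ifs with hh
      · simp [St.exec, hh]
      · simp [St.exec, hv₁, hh]
    · rw [exec_ite, hex, ← hI.2, ← hc₂]
      split_ifs with hh
      · simp [St.exec, hh]
      · simp [St.exec, hv₂, hh]

/-- Set `flag` to a nonzero value if both sides of some tree edge contain irredundant sets whose
size is the value of `kap`. -/
def checkProg : St :=
  .seq (.assign .flag (.c 0)) (.forr .s .m (.forr .t .m (.ite (tadj (.v .s) (.v .t))
    (.seq sideProg (.seq searchProg
      (.ite (.an (.v .c₁) (.v .c₂)) (.assign .flag (.c 1)) .skip))) .skip)))

theorem checkProg_spec (h : Inp f G w D σ) {p : ℕ} (hp : σ.var .kap = p)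
    (hpl : p ≤ σ.var .len) (hnum : σ.var .num = (n + 1) ^ σ.var .len) (hn : 0 < n) :
    (checkProg.exec σ).var .flag ≠ 0 ↔ ∃ s t, D.tree.Adj s t ∧
      HasIrredundant G (D.side s t) p ∧ HasIrredundant G (D.side s t)ᶜ p := by
  set B : ℕ → ℕ → Prop := fun s t => ∃ (hs : s < m) (ht : t < m), D.tree.Adj ⟨s, hs⟩ ⟨t, ht⟩ ∧
    HasIrredundant G (D.side ⟨s, hs⟩ ⟨t, ht⟩) p ∧ HasIrredundant G (D.side ⟨s, hs⟩ ⟨t, ht⟩)ᶜ p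
    with hB
  have hm : σ.var .m = m := h.var_m
  have := St.exec_forr' (x := .s) (y := .m) (σ := σ.setVar .flag 0)
    (c := .forr .t .m (.ite (tadj (.v .s) (.v .t))
    (.seq sideProg (.seq searchProg
      (.ite (.an (.v .c₁) (.v .c₂)) (.assign .flag (.c 1)) .skip))) .skip))
    (fun k ρ => ρ.var .flag ≠ 0 ↔ ∃ s < k, ∃ t < m, B s t)
    (fun i ρ k h => by simpa using h) (by simp) fun i hi ρ hF hI hx => ?_
  · have he : checkProg.exec σ = _ := rfl
    rw [he]
    refine Iff.trans this ?_
    simp only [Mem.setVar_var, reduceCtorEq, if_false, hm, hB]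
    constructor
    · rintro ⟨s, -, t, -, hs, ht, h⟩
      exact ⟨_, _, h⟩
    · rintro ⟨s, t, h⟩
      exact ⟨s, s.2, t, t.2, s.2, t.2, h⟩
  have hi' : i < m := by simpa [hm] using hi
  have hρ : Inp f G w D ρ := (h.setVar (x := .flag) 0).frame hF rfl
  have hin := St.exec_forr' (x := .t) (y := .m) (σ := ρ)
    (c := .ite (tadj (.v .s) (.v .t))
    (.seq sideProg (.seq searchProg
      (.ite (.an (.v .c₁) (.v .c₂)) (.assign .flag (.c 1)) .skip))) .skip)
    (fun k ρ => ρ.var .flag ≠ 0 ↔ (∃ s < i, ∃ t < m, B s t) ∨ ∃ t < k, B i t)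
    (fun i ρ k h => by simpa using h) (by simpa using hI) fun j hj θ hF' hJ hy => ?_
  · rw [hin, hρ.var_m]
    simp only [Nat.lt_succ_iff_lt_or_eq, or_and_right, exists_or, exists_eq_left]
  have hj' : j < m := by simpa [hρ.var_m] using hj
  have hθ : Inp f G w D θ := hρ.frame hF' rfl
  have hs : θ.var .s = i := (hF'.var .s rfl).trans hx
  have hadj := hθ.holds_tadj (u := .v .s) (v := .v .t) (by simpa [hs] using hi')
    (by simpa [hy] using hj')
  simp only [eval_v, hs, hy] at hadj
  have hex : (∃ t < j + 1, B i t) ↔ (∃ t < j, B i t) ∨ B i j := by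
    simp only [Nat.lt_succ_iff_lt_or_eq, or_and_right, exists_or, exists_eq_left]
  rw [hex, ← or_assoc, ← hJ, exec_ite]
  split_ifs with hh
  · rw [hadj] at hh
    set θ₁ := sideProg.exec θ with hθ₁
    set θ₂ := searchProg.exec θ₁ with hθ₂
    have h₁ : Inp f G w D θ₁ := hθ.exec rfl
    have hv : ∀ x, x.lim = true → θ₁.var x = σ.var x := fun x hxl => by
      have hx₁ : θ₁.var x = θ.var x := St.exec_var (St.writes_of_lim rfl hxl) _
      have hx₂ : θ.var x = ρ.var x := hF'.var x (St.writes_of_lim rfl hxl)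
      have hx₃ : ρ.var x = (σ.setVar .flag 0).var x := hF.var x (St.writes_of_lim rfl hxl)
      rw [hx₁, hx₂, hx₃, Mem.setVar_var, if_neg (fun e => by simp [e, Reg.lim] at hxl)]
    have hside : (bits n θ₁ .inA 0 : Set (Fin n)) = D.side ⟨i, hi'⟩ ⟨j, hj'⟩ :=
      sideProg_spec hθ (s := ⟨i, hi'⟩) (t := ⟨j, hj'⟩) hs hy
    obtain ⟨g₁, g₂⟩ := searchProg_spec h₁ hside ((hv .kap rfl).trans hp)
      (by rw [hv .len rfl]; exact hpl) (by rw [hv .num rfl, hv .len rfl]; exact hnum) hn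
    have hflag : θ₂.var .flag = θ.var .flag := (St.exec_var rfl _).trans (St.exec_var rfl _)
    have hBij : B i j ↔ θ₂.var .c₁ ≠ 0 ∧ θ₂.var .c₂ ≠ 0 := by
      rw [g₁, g₂]
      exact ⟨fun ⟨_, _, _, h⟩ => h, fun h => ⟨hi', hj', hh, h⟩⟩
    have hexec : (St.seq sideProg (.seq searchProg
      (.ite (.an (.v .c₁) (.v .c₂)) (.assign .flag (.c 1)) .skip))).exec θ =
      (St.ite (.an (.v .c₁) (.v .c₂)) (.assign .flag (.c 1)) .skip).exec θ₂ := rfl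
    rw [hexec, exec_ite, hBij]
    simp only [holds_an, holds_v]
    split_ifs with hc
    · simp [St.exec, hc]
    · simp [St.exec, hc, hflag]
  · rw [hadj] at hh
    have : ¬ B i j := fun ⟨_, _, h, _⟩ => hh h
    simp [St.exec, this]

end Input

/-! ### Tests described by digits -/

section Tests

variable {n f ℓ : ℕ}

/-- The labels whose kernel is the discrete relation for feedback vertex sets (`f ≠ 0`), and the
indiscrete relation for independent sets (`f = 0`). -/
def base (n f : ℕ) (v : Fin n) : ℕ := if f ≠ 0 then v else 0

lemma ker_base (hf : f ≠ 0) : Setoid.ker (base n f) = ⊥ :=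
  Setoid.ker_eq_bot_iff.2 fun u v h => Fin.ext (by simpa [base, hf] using h)

lemma ker_base_zero : Setoid.ker (base n 0) = ⊤ := by
  ext u v
  simp [Setoid.ker_def, base]

open Classical in
/-- The test with data listed by `d`: the kind of the test, followed by three blocks of `ℓ` entries
for the vertices of `bd`, their labels, and the vertices of `R`. -/
noncomputable def digitTest (n f ℓ : ℕ) (d : ℕ → ℕ) : Test (Fin n) where
  outer := d 0 ≠ 0
  bd := {v | ∃ j < ℓ, d (1 + j) = v}
  lab v := if f ≠ 0 then
    (if ∃ j < ℓ, d (1 + j) = v then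
      ∑ j ∈ Finset.range ℓ, if d (1 + j) = v then d (1 + ℓ + j) else 0 else v) else 0
  R := {u | ∃ j < ℓ, d (1 + ℓ + ℓ + j) = u}

lemma digitTest_congr {d d' : ℕ → ℕ} (h : ∀ j < 3 * ℓ + 1, d j = d' j) :
    digitTest n f ℓ d = digitTest n f ℓ d' := by
  have h₀ := h 0 (by omega)
  have h₁ : ∀ j < ℓ, d (1 + j) = d' (1 + j) := fun j hj => h _ (by omega)
  have h₂ : ∀ j < ℓ, d (1 + ℓ + j) = d' (1 + ℓ + j) := fun j hj => h _ (by omega)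
  have h₃ : ∀ j < ℓ, d (1 + ℓ + ℓ + j) = d' (1 + ℓ + ℓ + j) := fun j hj => h _ (by omega)
  have hb : ∀ v : ℕ, (∃ j < ℓ, d (1 + j) = v) ↔ ∃ j < ℓ, d' (1 + j) = v := fun v =>
    exists_congr fun j => and_congr_right fun hj => by rw [h₁ j hj]
  have hr : ∀ v : ℕ, (∃ j < ℓ, d (1 + ℓ + ℓ + j) = v) ↔ ∃ j < ℓ, d' (1 + ℓ + ℓ + j) = v :=
    fun v => exists_congr fun j => and_congr_right fun hj => by rw [h₃ j hj]
  have hs : ∀ v : ℕ, ∑ j ∈ Finset.range ℓ, (if d (1 + j) = v then d (1 + ℓ + j) else 0) =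
      ∑ j ∈ Finset.range ℓ, if d' (1 + j) = v then d' (1 + ℓ + j) else 0 := fun v =>
    Finset.sum_congr rfl fun j hj => by
      rw [h₁ j (Finset.mem_range.1 hj), h₂ j (Finset.mem_range.1 hj)]
  simp only [digitTest, h₀, hb, hr, hs]

/-- The tests of the exchange property are described by digits. -/
lemma exists_digitTest_eq (hn : 0 < n) (outer : Prop) {bd R : Finset (Fin n)}
    (l : Fin n → Fin n) (hbd : bd.card ≤ ℓ) (hR : R.card ≤ ℓ) :
    ∃ q < (n + 1) ^ (3 * ℓ + 1), digitTest n f ℓ (fun j => q / (n + 1) ^ j % (n + 1)) =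
      Test.mk' outer bd R l (base n f) := by
  classical
  obtain ⟨u, hun, hu, huinj⟩ := exists_listing bd hbd
  obtain ⟨r, hrn, hr, -⟩ := exists_listing R hR
  set g : ℕ → ℕ := fun j => if j = 0 then (if outer then 1 else 0) else
    if j - 1 < ℓ then u (j - 1) else if j - 1 - ℓ < ℓ then
      (if h : u (j - 1 - ℓ) < n then (l ⟨_, h⟩ : ℕ) else 0) else r (j - 1 - ℓ - ℓ) with hg
  obtain ⟨q, hq, hd⟩ := exists_digits (N := n + 1) (L := 3 * ℓ + 1) g fun j _ => by
    simp only [hg]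
    split_ifs
    · omega
    · omega
    · exact Nat.lt_succ_of_le (hun _)
    · omega
    · omega
    · exact Nat.lt_succ_of_le (hrn _)
  refine ⟨q, hq, (digitTest_congr hd).trans ?_⟩
  have h₁ : ∀ j < ℓ, g (1 + j) = u j := fun j hj => by
    simp only [hg]
    rw [if_neg (by omega), Nat.add_sub_cancel_left, if_pos hj]
  have h₂ : ∀ j < ℓ, g (1 + ℓ + j) = if h : u j < n then (l ⟨_, h⟩ : ℕ) else 0 := fun j hj => by
    simp only [hg]
    have : 1 + ℓ + j - 1 - ℓ = j := by omega
    rw [if_neg (by omega), if_neg (by omega), if_pos (by omega)]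
    simp only [this]
  have h₃ : ∀ j < ℓ, g (1 + ℓ + ℓ + j) = r j := fun j hj => by
    simp only [hg]
    rw [if_neg (by omega), if_neg (by omega), if_neg (by omega)]
    congr 1
    omega
  have hbv : ∀ v : Fin n, (∃ j < ℓ, g (1 + j) = v) ↔ v ∈ bd := fun v => by
    rw [hu]
    exact exists_congr fun j => and_congr_right fun hj => by rw [h₁ j hj]
  simp only [digitTest, Test.mk', Test.mk.injEq]
  refine ⟨?_, ?_, ?_, ?_⟩
  · by_cases ho : outer <;> simp [hg, ho]
  · ext v
    exact hbv v
  · funext v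
    simp only [hbv, base]
    split_ifs with hf hv
    · obtain ⟨j, hj, hjv⟩ := (hu v).1 hv
      rw [Finset.sum_eq_single_of_mem j (Finset.mem_range.2 hj)]
      · rw [h₁ j hj, if_pos hjv, h₂ j hj, dif_pos (by rw [hjv]; exact v.2)]
        congr 2
        exact Fin.ext hjv
      · intro i hi hij
        rw [Finset.mem_range] at hi
        rw [h₁ i hi, if_neg]
        intro hiv
        exact hij (huinj i j (hiv.trans hjv.symm) (by rw [hiv]; exact v.2))
    · rfl
    · rfl
  · ext v
    rw [Finset.mem_coe, hr]
    exact exists_congr fun j => and_congr_right fun hj => by rw [h₃ j hj]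

lemma completeTests_digitTest (hn : 0 < n) {G : SimpleGraph (Fin n)} {A : Set (Fin n)} {κ : ℕ}
    (hκ : ¬ HasIrredundant G A (κ + 1) ∨ ¬ HasIrredundant G Aᶜ (κ + 1)) :
    CompleteTests (Setoid.ker (base n f)) G A
      fun q : Fin ((n + 1) ^ (3 * (4 * κ) + 1)) =>
        digitTest n f (4 * κ) fun j => q / (n + 1) ^ j % (n + 1) := by
  intro X Y hX hY hg
  have hb : Setoid.ker (base n f) = ⊥ ∨ Setoid.ker (base n f) = ⊤ := by
    by_cases hf : f = 0
    · exact Or.inr (hf ▸ ker_base_zero)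
    · exact Or.inl (ker_base hf)
  obtain ⟨outer, bd, R, l, hbd, hR, hp, hx⟩ := exists_test _ hb hκ hX hY hg
  obtain ⟨q, hq, he⟩ := exists_digitTest_eq (f := f) hn outer l hbd hR
  exact ⟨⟨q, hq⟩, by simpa only [he] using hp, by simpa only [he] using hx⟩

end Tests

/-! ### Testing candidates -/

section Search

variable {n m f : ℕ} {G : SimpleGraph (Fin n)} {w : Fin n → ℕ}
  {D : BranchDecomposition (Fin n) (Fin m)} {A : Set (Fin n)} {T : Test (Fin n)} {σ ρ : Mem}

/-- The memory describes the cut `A` and the test `T`. -/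
structure TestIn (G : SimpleGraph (Fin n)) (A : Set (Fin n)) (T : Test (Fin n)) (σ : Mem) :
    Prop where
  side : (bits n σ .inA 0 : Set (Fin n)) = A
  bd : (bits n σ .bd 0 : Set (Fin n)) = T.bd
  lab : ∀ v : Fin n, σ.arr .lab₀ v = T.lab v
  alw : (bits n σ .alw 0 : Set (Fin n)) = T.allowed G A

/-- The condition that `v` is in the block for `bd`. -/
def inBd : Ex := .ex .k₁ .ell (.eq (.ld .dig (.add (.c 1) (.v .k₁))) (.v .v))

/-- The entry with number `k₁` of the block for `R`. -/
def inR : Ex := .ld .dig (.add (.add (.add (.c 1) (.v .ell)) (.v .ell)) (.v .k₁))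

/-- Prepare the test described by `dig` for the cut described by `inA`. -/
def setupTest : St :=
  .seq (.forr .v .n (.store .bd (.v .v) inBd))
    (.seq (.forr .v .n (.store .lab₀ (.v .v) (.ite (.v .fvs) (.ite inBd
        (.sum .k₁ .ell (.ite (.eq (.ld .dig (.add (.c 1) (.v .k₁))) (.v .v))
          (.ld .dig (.add (.add (.c 1) (.v .ell)) (.v .k₁))) (.c 0))) (.v .v)) (.c 0))))
      (.forr .v .n (.store .alw (.v .v) (.an (.ld .inA (.v .v)) (.or inBd
        (.ite (.ld .dig (.c 0)) (.al .k₁ .ell (.nt (gadj inR (.v .v))))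
          (.al .k₂ .n (.or (.ld .inA (.v .k₂)) (.or (.nt (gadj (.v .v) (.v .k₂)))
            (.ex .k₁ .ell (gadj inR (.v .k₂))))))))))))

lemma holds_inBd {ℓ : ℕ} (hℓ : σ.var .ell = ℓ) {v : ℕ} :
    inBd.Holds (σ.setVar .v v) ↔ ∃ j < ℓ, σ.arr .dig (1 + j) = v := by
  simp [inBd, hℓ]

theorem setupTest_spec {ℓ : ℕ} (h : Inp f G w D σ) (hℓ : σ.var .ell = ℓ)
    (hA : (bits n σ .inA 0 : Set (Fin n)) = A) :
    TestIn G A (digitTest n f ℓ (σ.arr .dig)) (setupTest.exec σ) := by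
  set c₁ := St.forr .v .n (.store .bd (.v .v) inBd) with hc₁
  set c₂ := St.forr .v .n (.store .lab₀ (.v .v) (.ite (.v .fvs) (.ite inBd
        (.sum .k₁ .ell (.ite (.eq (.ld .dig (.add (.c 1) (.v .k₁))) (.v .v))
          (.ld .dig (.add (.add (.c 1) (.v .ell)) (.v .k₁))) (.c 0))) (.v .v)) (.c 0))) with hc₂
  set c₃ := St.forr .v .n (.store .alw (.v .v) (.an (.ld .inA (.v .v)) (.or inBd
        (.ite (.ld .dig (.c 0)) (.al .k₁ .ell (.nt (gadj inR (.v .v))))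
          (.al .k₂ .n (.or (.ld .inA (.v .k₂)) (.or (.nt (gadj (.v .v) (.v .k₂)))
            (.ex .k₁ .ell (gadj inR (.v .k₂)))))))))) with hc₃
  set σ₁ := c₁.exec σ with hσ₁
  set σ₂ := c₂.exec σ₁ with hσ₂
  have hexec : setupTest.exec σ = c₃.exec σ₂ := rfl
  have h₁ : Inp f G w D σ₁ := h.exec rfl
  have h₂ : Inp f G w D σ₂ := h₁.exec rfl
  have hd₁ : σ₁.arr .dig = σ.arr .dig := St.exec_arr rfl _
  have hd₂ : σ₂.arr .dig = σ.arr .dig := (St.exec_arr rfl _).trans hd₁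
  have hℓ₁ : σ₁.var .ell = ℓ := (St.exec_var rfl _).trans hℓ
  have hℓ₂ : σ₂.var .ell = ℓ := (St.exec_var rfl _).trans hℓ₁
  have hi₂ : σ₂.arr .inA = σ.arr .inA := (St.exec_arr rfl _).trans (St.exec_arr rfl _)
  rw [hexec]
  have hmem : ∀ v : Fin n, σ.arr .inA v ≠ 0 ↔ v ∈ A := fun v => by simp [← hA]
  refine ⟨?_, ?_, fun v => ?_, ?_⟩
  · rw [← hA]
    congr 1
    refine bits_congr fun v _ => ?_
    rw [hc₃, St.exec_arr rfl, hi₂]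
  · ext v
    have : (c₃.exec σ₂).arr .bd = σ₁.arr .bd := (St.exec_arr rfl _).trans (St.exec_arr rfl _)
    rw [Finset.mem_coe, mem_bits, zero_add, this, hσ₁, hc₁,
      St.exec_fill rfl _ (by rw [h.var_n]; exact v.2)]
    exact holds_inBd hℓ
  · have : (c₃.exec σ₂).arr .lab₀ = σ₂.arr .lab₀ := St.exec_arr rfl _
    rw [this, hσ₂, hc₂, St.exec_fill rfl _ (by rw [h₁.var_n]; exact v.2)]
    simp only [eval_ite, holds_v, holds_inBd hℓ₁, hd₁, Mem.setVar_var, reduceCtorEq, if_false,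
      h₁.var_fvs, digitTest, eval_sum, hℓ₁, holds_eq, eval_ld, eval_add, eval_c, eval_v,
      Mem.setVar_arr, if_true]
  · ext v
    rw [Finset.mem_coe, mem_bits, zero_add, hc₃, St.exec_fill rfl _ (by rw [h₂.var_n]; exact v.2)]
    have hbd : inBd.Holds (σ₂.setVar .v v) ↔ v ∈ (digitTest n f ℓ (σ.arr .dig)).bd := by
      rw [holds_inBd hℓ₂, hd₂]; rfl
    have hR : ∀ (θ : Mem) (x : Ex) (hx : x.eval θ < n), Inp f G w D θ → θ.arr .dig = σ.arr .dig →
        θ.var .ell = ℓ → θ.var .k₁ < ℓ →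
        ((gadj inR x).Holds θ ↔ ∃ u, σ.arr .dig (1 + ℓ + ℓ + θ.var .k₁) = (u : Fin n) ∧
          G.Adj u ⟨x.eval θ, hx⟩) := by
      intro θ x hx hθ hd hl hk
      rw [hθ.holds_gadj hx]
      simp only [inR, eval_ld, eval_add, eval_c, eval_v, hd, hl]
      constructor
      · rintro ⟨hu, hadj⟩
        exact ⟨_, rfl, hadj⟩
      · rintro ⟨u, hu, hadj⟩
        exact ⟨by rw [hu]; exact u.2, by simpa only [hu] using hadj⟩
    have hI := h₂.setVar (x := .v) v
    have hR₁ : (Ex.al .k₁ .ell (.nt (gadj inR (.v .v)))).Holds (σ₂.setVar .v v) ↔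
        ∀ u ∈ (digitTest n f ℓ (σ.arr .dig)).R, ¬ G.Adj u v := by
      simp only [holds_al, holds_nt, Mem.setVar_var, reduceCtorEq, if_false, hℓ₂]
      constructor
      · rintro hh u ⟨j, hj, hju⟩ hadj
        refine hh j hj ((hR ((σ₂.setVar .v v).setVar .k₁ j) (.v .v) (by simp) (hI.setVar j)
          hd₂ (by simpa using hℓ₂) (by simpa using hj)).2
          ⟨u, by simpa using hju, by simpa using hadj⟩)
      · intro hh j hj hg
        obtain ⟨u, hju, hadj⟩ := (hR ((σ₂.setVar .v v).setVar .k₁ j) (.v .v) (by simp) (hI.setVar j)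
          hd₂ (by simpa using hℓ₂) (by simpa using hj)).1 hg
        exact hh u ⟨j, hj, by simpa using hju⟩ (by simpa using hadj)
    have hR₂ : (Ex.al .k₂ .n (.or (.ld .inA (.v .k₂)) (.or (.nt (gadj (.v .v) (.v .k₂)))
            (.ex .k₁ .ell (gadj inR (.v .k₂)))))).Holds (σ₂.setVar .v v) ↔
        ∀ y, y ∉ A → G.Adj v y → ∃ u ∈ (digitTest n f ℓ (σ.arr .dig)).R, G.Adj u y := by
      simp only [holds_al, Mem.setVar_var, reduceCtorEq, if_false, h₂.var_n]
      rw [Fin.forall_iff]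
      refine forall_congr' fun y => forall_congr' fun hy => ?_
      have hI' := hI.setVar (x := .k₂) y
      simp only [holds_or, holds_ld, holds_nt, eval_v, Mem.setVar_arr, Mem.setVar_var, if_true, hi₂,
        hmem ⟨y, hy⟩, holds_ex, hℓ₂, reduceCtorEq, if_false]
      rw [hI'.holds_gadj (by simpa using hy), or_iff_not_imp_left, or_iff_not_imp_left, not_not]
      refine imp_congr Iff.rfl (imp_congr (by simp) ?_)
      constructor
      · rintro ⟨j, hj, hg⟩
        obtain ⟨u, hju, hadj⟩ := (hR (((σ₂.setVar .v v).setVar .k₂ y).setVar .k₁ j) (.v .k₂)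
          (by simpa using hy) (hI'.setVar j) hd₂ (by simpa using hℓ₂) (by simpa using hj)).1 hg
        exact ⟨u, ⟨j, hj, by simpa using hju⟩, by simpa using hadj⟩
      · rintro ⟨u, ⟨j, hj, hju⟩, hadj⟩
        exact ⟨j, hj, (hR (((σ₂.setVar .v v).setVar .k₂ y).setVar .k₁ j) (.v .k₂)
          (by simpa using hy) (hI'.setVar j) hd₂ (by simpa using hℓ₂) (by simpa using hj)).2
          ⟨u, by simpa using hju, by simpa using hadj⟩⟩
    rw [eval_ne_zero, holds_an, holds_or, hbd, holds_ite, hR₁, hR₂]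
    simp only [holds_ld, eval_v, eval_c, Mem.setVar_var, if_true, Mem.setVar_arr, hi₂, hmem, hd₂,
      Test.allowed, Unblocked, Set.mem_ofPred_eq]
    refine and_congr_right fun _ => or_congr_right ?_
    have ho : (digitTest n f ℓ (σ.arr .dig)).outer ↔ σ.arr .dig 0 ≠ 0 := Iff.rfl
    by_cases h0 : σ.arr .dig 0 ≠ 0
    · rw [if_pos (ho.2 h0)]
      simp [h0]
    · rw [if_neg (mt ho.1 h0)]
      simp [not_not.1 h0]

/-- The conditions on the best candidate found so far, when all members of `C` have been tried. -/
structure Search (f : ℕ) (G : SimpleGraph (Fin n)) (w : Fin n → ℕ)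
    (D : BranchDecomposition (Fin n) (Fin m)) (A : Set (Fin n)) (T : Test (Fin n))
    (C : Set (Finset (Fin n))) (σ : Mem) : Prop where
  inp : Inp f G w D σ
  test : TestIn G A T σ
  val : σ.var .best = ∑ v ∈ bits n σ .best 0, w v
  passes : bits n σ .best 0 = ∅ ∨ T.Passes G A (bits n σ .best 0)
  max : ∀ X ∈ C, T.Passes G A X → ∑ v ∈ X, w v ≤ σ.var .best

/-- The statement writes neither the cut nor the test. -/
def St.keepsTest (c : St) : Bool :=
  !c.stores .inA && !c.stores .bd && !c.stores .lab₀ && !c.stores .alw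

lemma TestIn.frame {c : St} (h : TestIn G A T σ) (hF : Frame c σ ρ) (hc : c.keepsTest = true) :
    TestIn G A T ρ := by
  simp only [St.keepsTest, Bool.and_eq_true, Bool.not_eq_true'] at hc
  obtain ⟨⟨⟨h1, h2⟩, h3⟩, h4⟩ := hc
  have hb : ∀ a, ρ.arr a = σ.arr a → bits n ρ a 0 = bits n σ a 0 := fun a ha =>
    bits_congr fun v _ => by rw [ha]
  exact ⟨by rw [hb _ (hF.arr _ h1), h.side], by rw [hb _ (hF.arr _ h2), h.bd],
    fun v => by rw [hF.arr _ h3, h.lab], by rw [hb _ (hF.arr _ h4), h.alw]⟩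

lemma Search.frame {C : Set (Finset (Fin n))} {c : St} (h : Search f G w D A T C σ)
    (hF : Frame c σ ρ) (h₁ : c.pure = true) (h₂ : c.keepsTest = true)
    (h₃ : c.writes .best = false) (h₄ : c.stores .best = false) : Search f G w D A T C ρ := by
  have hb : bits n ρ .best 0 = bits n σ .best 0 := bits_congr fun v _ => by rw [hF.arr _ h₄]
  refine ⟨h.inp.frame hF h₁, h.test.frame hF h₂, ?_, ?_, ?_⟩
  · rw [hb, hF.var _ h₃, h.val]
  · rw [hb]; exact h.passes
  · rw [hF.var _ h₃]; exact h.max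

lemma Search.setVar {C : Set (Finset (Fin n))} (h : Search f G w D A T C σ) {x : Reg} (k : ℕ)
    (hx : (St.assign x (.c 0)).pure = true := by rfl)
    (hx' : (St.assign x (.c 0)).writes .best = false := by rfl) :
    Search f G w D A T C (σ.setVar x k) :=
  h.frame (c := .assign x (.c 0)) ((Frame.refl _ _).setVar (by simp [St.writes]) k) hx rfl hx' rfl

lemma Search.mono {C C' : Set (Finset (Fin n))} (h : Search f G w D A T C σ)
    (hC : ∀ X ∈ C', X ∈ C) : Search f G w D A T C' σ :=
  ⟨h.inp, h.test, h.val, h.passes, fun X hX => h.max X (hC X hX)⟩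

/-- Start a new search. -/
def clearBest : St :=
  .seq (.assign .best (.c 0)) (.forr .v .n (.store .best (.v .v) (.c 0)))

lemma clearBest_spec (h : Inp f G w D σ) (hT : TestIn G A T σ) :
    Search f G w D A T ∅ (clearBest.exec σ) := by
  have h₁ : Inp f G w D (σ.setVar .best 0) := h.setVar 0
  have hb : bits n (clearBest.exec σ) .best 0 = ∅ := by
    ext v
    have he : clearBest.exec σ =
      (St.forr .v .n (.store .best (.v .v) (.c 0))).exec (σ.setVar .best 0) := rfl
    rw [mem_bits, zero_add, he, St.exec_fill rfl _ (by rw [h₁.var_n]; exact v.2)]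
    simp
  have hv : (clearBest.exec σ).var .best = 0 :=
    (St.exec_var (c := .forr .v .n (.store .best (.v .v) (.c 0))) rfl (σ.setVar .best 0)).trans
      (by simp)
  refine ⟨h.exec rfl, hT.frame (St.frame _ _) rfl, ?_, Or.inl hb, by simp⟩
  rw [hb, hv, Finset.sum_empty]

/-- The edges of the candidate that matter for the test, each with one orientation. -/
def candEdge : Ex :=
  .an (gadj (.v .x) (.v .y)) (.an (.ld .cand (.v .x))
    (.or (.an (.ld .cand (.v .y)) (.lt (.v .x) (.v .y)))
      (.an (.nt (.ld .cand (.v .y))) (.an (.ld .bd (.v .y)) (.nt (.ld .inA (.v .y)))))))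

/-- Replace the best candidate by the current candidate if the latter passes the test and has
larger weight. -/
def tryCand : St :=
  .seq (.assign .wgt (.sum .v .n (.ite (.ld .cand (.v .v)) (.ld .wt (.v .v)) (.c 0))))
    (.seq (.assign .ok (.al .v .n (.or (.nt (.ld .cand (.v .v))) (.ld .alw (.v .v)))))
      (.seq (.forr .v .n (.store .lab (.v .v) (.ld .lab₀ (.v .v))))
        (.seq (unite .n candEdge)
          (.ite (.an (.v .ok) (.lt (.v .best) (.v .wgt)))
            (.seq (.assign .best (.v .wgt))
              (.forr .v .n (.store .best (.v .v) (.ld .cand (.v .v)))))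
            .skip))))

/-- The invariant of a search extends to the candidate just tried. -/
theorem tryCand_spec {C : Set (Finset (Fin n))} (h : Search f G w D A T C σ) :
    Search f G w D A T (insert (bits n σ .cand 0) C) (tryCand.exec σ) := by
  set X := bits n σ .cand 0 with hX
  set c₁ := St.assign .wgt (.sum .v .n (.ite (.ld .cand (.v .v)) (.ld .wt (.v .v)) (.c 0))) with hc₁
  set c₂ := St.assign .ok (.al .v .n (.or (.nt (.ld .cand (.v .v))) (.ld .alw (.v .v)))) with hc₂
  set c₃ := St.forr .v .n (.store .lab (.v .v) (.ld .lab₀ (.v .v))) with hc₃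
  set c₅ := St.seq (.assign .best (.v .wgt))
    (.forr .v .n (.store .best (.v .v) (.ld .cand (.v .v)))) with hc₅
  set σ₁ := c₁.exec σ with hσ₁
  set σ₂ := c₂.exec σ₁ with hσ₂
  set σ₃ := c₃.exec σ₂ with hσ₃
  set σ₄ := (unite .n candEdge).exec σ₃ with hσ₄
  have hexec : tryCand.exec σ =
      (St.ite (.an (.v .ok) (.lt (.v .best) (.v .wgt))) c₅ .skip).exec σ₄ := rfl
  have hmem : ∀ v : Fin n, σ.arr .cand v ≠ 0 ↔ v ∈ X := fun v => by simp [hX]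
  have h₁ : Search f G w D A T C σ₁ := h.frame (St.frame _ _) rfl rfl rfl rfl
  have h₂ : Search f G w D A T C σ₂ := h₁.frame (St.frame _ _) rfl rfl rfl rfl
  have h₃ : Search f G w D A T C σ₃ := h₂.frame (St.frame _ _) rfl rfl rfl rfl
  have h₄ : Search f G w D A T C σ₄ := h₃.frame (St.frame _ _) rfl rfl rfl rfl
  have hcand₁ : σ₁.arr .cand = σ.arr .cand := rfl
  have hcand₃ : σ₃.arr .cand = σ.arr .cand := St.exec_arr rfl _
  have hcand₄ : σ₄.arr .cand = σ.arr .cand := (St.exec_arr rfl _).trans hcand₃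
  have hwgt : σ₄.var .wgt = ∑ v ∈ X, w v := by
    have : σ₄.var .wgt = σ₁.var .wgt :=
      (St.exec_var rfl _).trans ((St.exec_var rfl _).trans (St.exec_var rfl _))
    rw [this, hσ₁, hc₁, St.exec, Mem.setVar_var, if_pos rfl, eval_sum, h.inp.var_n,
      Finset.sum_range, hX, bits, Finset.sum_filter]
    refine Finset.sum_congr rfl fun v _ => ?_
    simp [h.inp.wt_eq]
  have hok₃ : σ₃.var .ok ≠ 0 ↔ (X : Set (Fin n)) ⊆ T.allowed G A := by
    have : σ₃.var .ok = σ₂.var .ok := St.exec_var rfl _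
    rw [this, hσ₂, hc₂, St.exec, Mem.setVar_var, if_pos rfl]
    rw [eval_ne_zero, holds_al, h₁.inp.var_n, ← h.test.alw, Set.subset_def, Fin.forall_iff]
    refine forall_congr' fun v => forall_congr' fun hv => ?_
    have ha₁ : σ₁.arr .alw = σ.arr .alw := rfl
    simp only [holds_or, holds_nt, holds_ld, eval_v, Mem.setVar_var, if_true, Mem.setVar_arr,
      hcand₁, hmem ⟨v, hv⟩, ha₁, Finset.mem_coe, mem_bits, zero_add]
    rw [or_iff_not_imp_left, not_not]
  have hlab₃ : labels n σ₃ = T.lab := by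
    funext v
    rw [labels, hσ₃, hc₃, St.exec_fill rfl _ (by rw [h₂.inp.var_n]; exact v.2)]
    simpa using h₂.test.lab v
  obtain ⟨-, hok⟩ := unite_spec (r := .n) (e := candEdge) rfl h₃.inp.var_n
    (fun i j => ∃ (hi : i < n) (hj : j < n), G.Adj ⟨i, hi⟩ ⟨j, hj⟩ ∧ (⟨i, hi⟩ : Fin n) ∈ X ∧
      (((⟨j, hj⟩ : Fin n) ∈ X ∧ i < j) ∨
        ((⟨j, hj⟩ : Fin n) ∉ X ∧ (⟨j, hj⟩ : Fin n) ∈ T.bd ∧ (⟨j, hj⟩ : Fin n) ∉ A)))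
    (by
      rintro i j ⟨hi, hj, -, hiX, h₁⟩ ⟨hj', hi', -, hjX, h₂⟩
      rcases h₁ with h₁ | h₁
      · rcases h₂ with h₂ | h₂
        · omega
        · exact h₂.1 hiX
      · exact h₁.1 hjX)
    (fun θ hF hx hy => by
      have hθ := h₃.frame hF rfl rfl rfl rfl
      have hcθ : θ.arr .cand = σ.arr .cand := (hF.arr _ rfl).trans hcand₃
      have hbd : ∀ v : Fin n, θ.arr .bd v ≠ 0 ↔ v ∈ T.bd := fun v => by simp [← hθ.test.bd]
      have hA : ∀ v : Fin n, θ.arr .inA v ≠ 0 ↔ v ∈ A := fun v => by simp [← hθ.test.side]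
      simp only [candEdge, holds_an, holds_or, holds_nt, holds_ld, holds_lt, eval_v, hcθ,
        hmem ⟨_, hx⟩, hmem ⟨_, hy⟩, hbd ⟨_, hy⟩, hA ⟨_, hy⟩,
        hθ.inp.holds_gadj (u := .v .x) (v := .v .y) hy]
      constructor
      · rintro ⟨⟨_, h1⟩, h2⟩
        exact ⟨hx, hy, h1, h2⟩
      · rintro ⟨_, _, h1, h2⟩
        exact ⟨⟨hx, h1⟩, h2⟩)
  have hE : pairEdges n (fun i j => ∃ (hi : i < n) (hj : j < n), G.Adj ⟨i, hi⟩ ⟨j, hj⟩ ∧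
      (⟨i, hi⟩ : Fin n) ∈ X ∧ (((⟨j, hj⟩ : Fin n) ∈ X ∧ i < j) ∨
        ((⟨j, hj⟩ : Fin n) ∉ X ∧ (⟨j, hj⟩ : Fin n) ∈ T.bd ∧ (⟨j, hj⟩ : Fin n) ∉ A))) =
      testEdges G A T.bd X := by
    ext e
    constructor
    · rintro ⟨i, j, rfl, _, _, hadj, hi, hj⟩
      refine ⟨i, j, rfl, hadj, hi, ?_⟩
      rcases hj with hj | hj
      · exact Or.inl hj.1
      · exact Or.inr hj.2
    · rintro ⟨i, j, rfl, hadj, hi, hj⟩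
      by_cases hjX : j ∈ X
      · rcases lt_or_gt_of_ne hadj.ne with hlt | hlt
        · exact ⟨i, j, rfl, i.2, j.2, hadj, hi, Or.inl ⟨hjX, hlt⟩⟩
        · exact ⟨j, i, Sym2.eq_swap, j.2, i.2, hadj.symm, hjX, Or.inl ⟨hi, hlt⟩⟩
      · exact ⟨i, j, rfl, i.2, j.2, hadj, hi, Or.inr ⟨hjX, hj.resolve_left hjX⟩⟩
  rw [hok₃, hlab₃, hE] at hok
  have hok₄ : σ₄.var .ok ≠ 0 ↔ T.Passes G A X := hok
  rw [hexec, exec_ite]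
  have hcond : (Ex.an (.v .ok) (.lt (.v .best) (.v .wgt))).Holds σ₄ ↔
      T.Passes G A X ∧ σ₄.var .best < ∑ v ∈ X, w v := by
    rw [holds_an, holds_v, holds_lt, eval_v, eval_v, hok₄, hwgt]
  split_ifs with hc <;> rw [hcond] at hc
  · obtain ⟨hp, hlt⟩ := hc
    set σ₅ := σ₄.setVar .best (σ₄.var .wgt) with hσ₅
    have he : c₅.exec σ₄ = (St.forr .v .n (.store .best (.v .v) (.ld .cand (.v .v)))).exec σ₅ := rfl
    have hn₅ : σ₅.var .n = n := by simp [hσ₅, h₄.inp.var_n]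
    have hb : bits n (c₅.exec σ₄) .best 0 = X := by
      ext v
      rw [mem_bits, zero_add, he, St.exec_fill rfl _ (by rw [hn₅]; exact v.2)]
      simp only [eval_ld, eval_v, Mem.setVar_arr, Mem.setVar_var, if_true]
      rw [← hmem, ← hcand₄]
      rfl
    have hbv : (c₅.exec σ₄).var .best = ∑ v ∈ X, w v := by
      rw [he, St.exec_var rfl]
      simp [hσ₅, hwgt]
    refine ⟨h₄.inp.exec rfl, h₄.test.frame (St.frame _ _) rfl, ?_, ?_, ?_⟩
    · rw [hb, hbv]
    · rw [hb]; exact Or.inr hp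
    · rw [hbv]
      rintro Y (rfl | hY) hYp
      · exact le_rfl
      · exact (h₄.max Y hY hYp).trans hlt.le
  · refine ⟨h₄.inp, h₄.test, h₄.val, h₄.passes, ?_⟩
    rintro Y (rfl | hY) hYp
    · change _ ≤ σ₄.var .best
      by_contra hcon
      exact hc ⟨hYp, not_le.1 hcon⟩
    · exact h₄.max Y hY hYp

end Search

/-! ### Families of partial solutions -/

section Families

variable {n m f : ℕ} {G : SimpleGraph (Fin n)} {w : Fin n → ℕ}
  {D : BranchDecomposition (Fin n) (Fin m)} {A : Set (Fin n)} {T : Test (Fin n)} {σ ρ : Mem}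

/-- The address in `fam` of the partial solution with number `τ` for the tree edge `st`. -/
def slot (σ : Mem) (s t τ : ℕ) : ℕ := σ.var .n * (σ.var .num * (σ.var .m * s + t) + τ)

/-- The expression for `slot`. -/
def slotEx (s t τ : Reg) : Ex :=
  .mul .n (.add (.mul .num (.add (.mul .m (.v s)) (.v t))) (.v τ))

@[simp]
lemma eval_slotEx {s t τ : Reg} : (slotEx s t τ).eval σ = slot σ (σ.var s) (σ.var t) (σ.var τ) :=
  rfl

/-- The family of partial solutions stored for the tree edge `st`. -/
def family (n : ℕ) (σ : Mem) (s t : ℕ) : Set (Finset (Fin n)) :=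
  {X | ∃ τ < σ.var .num, X = bits n σ .fam (slot σ s t τ)}

lemma mul_add_inj {a x x' b b' : ℕ} (hb : b < a) (hb' : b' < a) (h : a * x + b = a * x' + b') :
    x = x' ∧ b = b' := by
  have ha : 0 < a := by omega
  have hx : x = x' := by
    have := congrArg (· / a) h
    simpa [Nat.mul_add_div ha, Nat.div_eq_of_lt hb, Nat.div_eq_of_lt hb'] using this
  subst hx
  exact ⟨rfl, by omega⟩

lemma slot_congr {s t τ : ℕ} (hn : ρ.var .n = σ.var .n) (hm : ρ.var .m = σ.var .m)
    (hM : ρ.var .num = σ.var .num) : slot ρ s t τ = slot σ s t τ := by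
  simp [slot, hn, hm, hM]

lemma slot_inj {s t τ s' t' τ' v v' : ℕ} (ht : t < σ.var .m) (ht' : t' < σ.var .m)
    (hτ : τ < σ.var .num) (hτ' : τ' < σ.var .num) (hv : v < σ.var .n) (hv' : v' < σ.var .n)
    (h : slot σ s t τ + v = slot σ s' t' τ' + v') : s = s' ∧ t = t' ∧ τ = τ' := by
  obtain ⟨h₁, -⟩ := mul_add_inj hv hv' h
  obtain ⟨h₂, h₃⟩ := mul_add_inj hτ hτ' h₁
  obtain ⟨h₄, h₅⟩ := mul_add_inj ht ht' h₂
  exact ⟨h₄, h₅, h₃⟩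

lemma family_congr {c : St} (hF : Frame c σ ρ) (hc : c.stores .fam = false)
    (hn : c.writes .n = false) (hm : c.writes .m = false) (hM : c.writes .num = false) (s t : ℕ) :
    family n ρ s t = family n σ s t := by
  have hb : ∀ p, bits n ρ .fam p = bits n σ .fam p := fun p =>
    bits_congr fun v _ => by rw [hF.arr _ hc]
  simp only [family, hb, slot_congr (hF.var _ hn) (hF.var _ hm) (hF.var _ hM), hF.var _ hM]

lemma family_eq {s t : ℕ} (hn : ρ.var .n = σ.var .n) (hm : ρ.var .m = σ.var .m)
    (hM : ρ.var .num = σ.var .num)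
    (h : ∀ τ < σ.var .num, bits n ρ .fam (slot σ s t τ) = bits n σ .fam (slot σ s t τ)) :
    family n ρ s t = family n σ s t := by
  ext X
  simp only [family, Set.mem_ofPred_eq, hM, slot_congr hn hm hM]
  exact exists_congr fun τ => and_congr_right fun hτ => by rw [h τ hτ]

/-- Let the candidate be the union of the sets described by the segments of `fam` starting at
`p₁` and `p₂`. -/
def unionCand : St :=
  .forr .v .n (.store .cand (.v .v)
    (.or (.ld .fam (.add (.v .p₁) (.v .v))) (.ld .fam (.add (.v .p₂) (.v .v)))))

lemma bits_unionCand (hn : σ.var .n = n) : bits n (unionCand.exec σ) .cand 0 =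
    bits n σ .fam (σ.var .p₁) ∪ bits n σ .fam (σ.var .p₂) := by
  ext v
  rw [mem_bits, zero_add, unionCand, St.exec_fill rfl _ (by rw [hn]; exact v.2), Finset.mem_union,
    mem_bits, mem_bits]
  rw [eval_ne_zero]
  simp

/-- Try the unions of the members of the families for the tree edges `a₁b₁` and `a₂b₂`. -/
def tryUnions (a₁ b₁ a₂ b₂ : Reg) : St :=
  .forr .i .num (.forr .j .num (.seq (.assign .p₁ (slotEx a₁ b₁ .i))
    (.seq (.assign .p₂ (slotEx a₂ b₂ .j)) (.seq unionCand tryCand))))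

/-- The hypothesis `hr` says that the registers naming the tree edges are not used as counters. -/
theorem tryUnions_spec {a₁ b₁ a₂ b₂ : Reg} {C : Set (Finset (Fin n))}
    (h : Search f G w D A T C σ)
    (hr : ∀ x ∈ [a₁, b₁, a₂, b₂], (tryUnions .n .n .n .n).writes x = false) :
    Search f G w D A T (C ∪ unions (family n σ (σ.var a₁) (σ.var b₁))
      (family n σ (σ.var a₂) (σ.var b₂))) ((tryUnions a₁ b₁ a₂ b₂).exec σ) := by
  set U : ℕ → ℕ → Finset (Fin n) := fun i j =>
    bits n σ .fam (slot σ (σ.var a₁) (σ.var b₁) i) ∪ bits n σ .fam (slot σ (σ.var a₂) (σ.var b₂) j)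
    with hU
  set body := St.seq (.assign .p₁ (slotEx a₁ b₁ .i))
    (.seq (.assign .p₂ (slotEx a₂ b₂ .j)) (.seq unionCand tryCand)) with hbody
  have hr' : ∀ x ∈ [a₁, b₁, a₂, b₂], x ≠ .p₁ ∧ x ≠ .p₂ ∧ x ≠ .i ∧ x ≠ .j := by
    intro x hx
    refine ⟨?_, ?_, ?_, ?_⟩ <;> rintro rfl <;> exact absurd (hr _ hx) (by decide)
  have hout := St.exec_forr' (x := .i) (y := .num) (c := .forr .j .num body) (σ := σ)
    (fun k ρ => Search f G w D A T (C ∪ {X | ∃ i < k, ∃ j < σ.var .num, X = U i j}) ρ)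
    (fun i ρ k h => h.setVar k) (by simpa using h) fun i hi ρ hF h' hx => ?_
  · refine hout.mono ?_
    rintro X (hX | ⟨X₁, ⟨i, hi, rfl⟩, X₂, ⟨j, hj, rfl⟩, rfl⟩)
    · exact Or.inl hX
    · exact Or.inr ⟨i, hi, j, hj, rfl⟩
  have hM : ρ.var .num = σ.var .num := hF.var .num rfl
  have hin := St.exec_forr' (x := .j) (y := .num) (c := body) (σ := ρ)
    (fun k ρ => Search f G w D A T ((C ∪ {X | ∃ i' < i, ∃ j < σ.var .num, X = U i' j}) ∪
      {X | ∃ j < k, X = U i j}) ρ)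
    (fun i ρ k h => h.setVar k) (by simpa using h') fun j hj θ hF' h'' hy => ?_
  · refine hin.mono ?_
    rintro X (hX | ⟨i', hi', j, hj, rfl⟩)
    · exact Or.inl (Or.inl hX)
    · rcases Nat.lt_succ_iff_lt_or_eq.1 hi' with hlt | rfl
      · exact Or.inl (Or.inr ⟨i', hlt, j, hj, rfl⟩)
      · exact Or.inr ⟨j, by rwa [hM], rfl⟩
  set θ₁ := (θ.setVar .p₁ ((slotEx a₁ b₁ .i).eval θ)) with hθ₁
  set θ₂ := (θ₁.setVar .p₂ ((slotEx a₂ b₂ .j).eval θ₁)) with hθ₂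
  set θ₃ := unionCand.exec θ₂ with hθ₃
  have hexec : body.exec θ = tryCand.exec θ₃ := rfl
  have h₂ : Search f G w D A T ((C ∪ {X | ∃ i' < i, ∃ j < σ.var .num, X = U i' j}) ∪
      {X | ∃ k < j, X = U i k}) θ₂ := (h''.setVar _).setVar _
  have h₃ := h₂.frame (c := unionCand) (St.frame _ _) rfl rfl rfl rfl
  have hs : ∀ x ∈ [a₁, b₁, a₂, b₂], θ.var x = σ.var x := fun x hx => by
    have hx := hr x hx
    have hx' : (St.forr .j .num body).writes x = false := by
      simp only [tryUnions, St.writes, Bool.or_eq_false_iff] at hx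
      simpa [hbody, St.writes] using hx.2
    rw [hF'.var x hx', hF.var x (by simpa [hbody, tryUnions, St.writes] using hx)]
  have hi' : θ.var .i = i := (hF'.var .i rfl).trans hx
  have hslot : ∀ θ' : Mem, θ'.var .n = θ.var .n → θ'.var .m = θ.var .m →
      θ'.var .num = θ.var .num → ∀ s t τ, slot θ' s t τ = slot σ s t τ := fun θ' e₁ e₂ e₃ s t τ =>
    slot_congr (by rw [e₁, hF'.var .n rfl, hF.var .n rfl])
      (by rw [e₂, hF'.var .m rfl, hF.var .m rfl])
      (by rw [e₃, hF'.var .num rfl, hM])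
  have hfam : θ₂.arr .fam = σ.arr .fam := (hF'.arr .fam rfl).trans (hF.arr .fam rfl)
  have hp₁ : θ₂.var .p₁ = slot σ (σ.var a₁) (σ.var b₁) i := by
    rw [hθ₂, Mem.setVar_var, if_neg (by simp), hθ₁, Mem.setVar_var, if_pos rfl, eval_slotEx, hi',
      hs a₁ (by simp), hs b₁ (by simp), hslot θ rfl rfl rfl]
  have hp₂ : θ₂.var .p₂ = slot σ (σ.var a₂) (σ.var b₂) j := by
    have e : ∀ x, x ≠ .p₁ → θ₁.var x = θ.var x := fun x hx => by simp [hθ₁, hx]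
    rw [hθ₂, Mem.setVar_var, if_pos rfl, eval_slotEx, e a₂ (hr' a₂ (by simp)).1,
      e b₂ (hr' b₂ (by simp)).1, e .j (by simp), hy, hs a₂ (by simp), hs b₂ (by simp),
      hslot θ₁ (e _ (by simp)) (e _ (by simp)) (e _ (by simp))]
  have hc : bits n θ₃ .cand 0 = U i j := by
    rw [hθ₃, bits_unionCand h₂.inp.var_n, hp₁, hp₂, hU]
    congr 1 <;> exact bits_congr fun v _ => by rw [hfam]
  rw [hexec]
  refine (tryCand_spec h₃).mono ?_
  rintro X (hX | ⟨k, hk, rfl⟩)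
  · exact Or.inr (Or.inl hX)
  · rcases Nat.lt_succ_iff_lt_or_eq.1 hk with hlt | rfl
    · exact Or.inr (Or.inr ⟨k, hlt, rfl⟩)
    · exact Or.inl hc.symm

/-! ### Computing the family of a tree edge -/

/-- The set of the vertex with leaf `s`, or the empty set if `s` is not a leaf. -/
def atLeaf (D : BranchDecomposition (Fin n) (Fin m)) (s : Fin m) : Finset (Fin n) :=
  Finset.univ.filter fun v => D.leaf v = s

/-- The candidates for the family of the tree edge `st`: the vertex at the leaf `s` and the unions
of partial solutions for the two further edges at `s`. -/
def candidates (D : BranchDecomposition (Fin n) (Fin m)) (σ : Mem) (s t : Fin m) :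
    Set (Finset (Fin n)) :=
  {X | X = atLeaf D s ∨ ∃ a b : Fin m, (D.tree.Adj s a ∧ D.tree.Adj s b ∧ a ≠ b ∧ a ≠ t ∧ b ≠ t) ∧
    X ∈ unions (family n σ a s) (family n σ b s)}

lemma represents_candidates {r : Setoid (Fin n)} {s t : Fin m} (h : D.tree.Adj s t)
    (hc : ∀ a, D.tree.Adj s a → a ≠ t → Represents r G w (D.side a s) (family n σ a s)) :
    Represents r G w (D.side s t) (insert ∅ (candidates D σ s t)) := by
  rcases BranchDecomposition.leaf_or_children h with
    ⟨v, hv, hs, -⟩ | ⟨-, a, b, ha, hb, hab, hat, hbt, hs, hd⟩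
  · rw [hs]
    refine (represents_singleton v).mono (Set.insert_subset_insert ?_)
    rintro _ rfl
    refine Or.inl ?_
    ext u
    rw [Finset.mem_singleton, atLeaf, Finset.mem_filter, ← hv, D.leaf_injective.eq_iff]
    simp
  · rw [hs]
    exact ((hc a ha hat).union (hc b hb hbt) hd).mono fun X hX =>
      Or.inr (Or.inr ⟨a, b, ⟨ha, hb, hab, hat, hbt⟩, hX⟩)

/-- The two further neighbours `a` and `b` of the node `s`. -/
def childCond : Ex :=
  .an (.an (tadj (.v .s) (.v .a)) (tadj (.v .s) (.v .b))) (.an (.nt (.eq (.v .a) (.v .b)))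
    (.an (.nt (.eq (.v .a) (.v .t))) (.nt (.eq (.v .b) (.v .t)))))

/-- Find a heaviest candidate passing the current test. -/
def tryCandidates : St :=
  .seq clearBest (.seq (.forr .v .n (.store .cand (.v .v) (.eq (.ld .leaf (.v .v)) (.v .s))))
    (.seq tryCand (.forr .a .m (.forr .b .m
      (.ite childCond (tryUnions .a .s .b .s) .skip)))))

theorem tryCandidates_spec (h : Inp f G w D σ) (hT : TestIn G A T σ) {s t : Fin m}
    (hs : σ.var .s = s) (ht : σ.var .t = t) :
    Search f G w D A T (candidates D σ s t) (tryCandidates.exec σ) := by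
  set c := St.forr .v .n (.store .cand (.v .v) (.eq (.ld .leaf (.v .v)) (.v .s))) with hc
  set σ₁ := clearBest.exec σ with hσ₁
  set σ₂ := c.exec σ₁ with hσ₂
  set σ₃ := tryCand.exec σ₂ with hσ₃
  have h₁ : Search f G w D A T ∅ σ₁ := clearBest_spec h hT
  have h₂ : Search f G w D A T ∅ σ₂ := h₁.frame (St.frame _ _) rfl rfl rfl rfl
  have hcand : bits n σ₂ .cand 0 = atLeaf D s := by
    ext v
    have hs₁ : σ₁.var .s = s := (St.exec_var rfl _).trans hs
    rw [mem_bits, zero_add, hσ₂, hc, St.exec_fill rfl _ (by rw [h₁.inp.var_n]; exact v.2), atLeaf,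
      Finset.mem_filter]
    rw [eval_ne_zero]
    simp [h₁.inp.leaf_eq, hs₁, Fin.ext_iff]
  have h₃ : Search f G w D A T {atLeaf D s} σ₃ := by
    have := tryCand_spec h₂
    rwa [hcand, insert_empty_eq] at this
  -- The pairs of nodes considered by the two loops.
  set Q : ℕ → ℕ → Set (Finset (Fin n)) := fun a b => {X | ∃ (ha : a < m) (hb : b < m),
    (D.tree.Adj s ⟨a, ha⟩ ∧ D.tree.Adj s ⟨b, hb⟩ ∧ a ≠ b ∧ a ≠ t ∧ b ≠ t) ∧
      X ∈ unions (family n σ a s) (family n σ b s)} with hQ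
  have hfam₃ : ∀ (c : St) (ρ : Mem), Frame c σ₃ ρ → c.stores .fam = false → c.writes .n = false →
      c.writes .m = false → c.writes .num = false → ∀ s t, family n ρ s t = family n σ s t := by
    intro c ρ hF e₁ e₂ e₃ e₄ s t
    rw [family_congr hF e₁ e₂ e₃ e₄, hσ₃, family_congr (St.frame tryCand σ₂) rfl rfl rfl rfl, hσ₂,
      family_congr (St.frame _ σ₁) rfl rfl rfl rfl, hσ₁,
      family_congr (St.frame clearBest σ) rfl rfl rfl rfl]
  have hs₃ : σ₃.var .s = s :=
    (St.exec_var rfl _).trans ((St.exec_var rfl _).trans ((St.exec_var rfl _).trans hs))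
  have ht₃ : σ₃.var .t = t :=
    (St.exec_var rfl _).trans ((St.exec_var rfl _).trans ((St.exec_var rfl _).trans ht))
  have hout := St.exec_forr' (x := .a) (y := .m) (σ := σ₃)
    (c := .forr .b .m (.ite childCond (tryUnions .a .s .b .s) .skip))
    (fun k ρ => Search f G w D A T ({atLeaf D s} ∪ {X | ∃ a < k, ∃ b < m, X ∈ Q a b}) ρ)
    (fun i ρ k h => h.setVar k) (by simpa using h₃) fun a ha ρ hF h' hx => ?_
  · have hexec : tryCandidates.exec σ = _ := rfl
    rw [hexec]
    refine hout.mono ?_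
    rintro X (hX | ⟨a, b, hab, hX⟩)
    · exact Or.inl hX
    · refine Or.inr ⟨a, by rw [h₃.inp.var_m]; exact a.2, b, b.2, a.2, b.2, ?_, hX⟩
      simpa [Fin.ext_iff] using hab
  rw [h₃.inp.var_m] at ha
  have hin := St.exec_forr' (x := .b) (y := .m) (σ := ρ)
    (c := .ite childCond (tryUnions .a .s .b .s) .skip)
    (fun k ρ => Search f G w D A T (({atLeaf D s} ∪ {X | ∃ a' < a, ∃ b < m, X ∈ Q a' b}) ∪
      {X | ∃ b < k, X ∈ Q a b}) ρ)
    (fun i ρ k h => h.setVar k) (by simpa using h') fun b hb θ hF' h'' hy => ?_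
  · refine hin.mono ?_
    rintro X (hX | ⟨a', ha', b, hb, hX⟩)
    · exact Or.inl (Or.inl hX)
    · rcases Nat.lt_succ_iff_lt_or_eq.1 ha' with hlt | rfl
      · exact Or.inl (Or.inr ⟨a', hlt, b, hb, hX⟩)
      · exact Or.inr ⟨b, by rwa [h'.inp.var_m], hX⟩
  rw [h'.inp.var_m] at hb
  have hsθ : θ.var .s = s := (hF'.var .s rfl).trans ((hF.var .s rfl).trans hs₃)
  have htθ : θ.var .t = t := (hF'.var .t rfl).trans ((hF.var .t rfl).trans ht₃)
  have haθ : θ.var .a = a := (hF'.var .a rfl).trans hx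
  have hfam : ∀ s t, family n θ s t = family n σ s t := fun s t => by
    rw [family_congr hF' rfl rfl rfl rfl]
    exact hfam₃ _ _ hF rfl rfl rfl rfl s t
  have hcond : childCond.Holds θ ↔ D.tree.Adj s ⟨a, ha⟩ ∧ D.tree.Adj s ⟨b, hb⟩ ∧ a ≠ b ∧
      a ≠ t ∧ b ≠ t := by
    have e₁ := h''.inp.holds_tadj (u := .v .s) (v := .v .a) (by simp [hsθ])
      (by simpa [haθ] using ha)
    have e₂ := h''.inp.holds_tadj (u := .v .s) (v := .v .b) (by simp [hsθ]) (by simpa [hy] using hb)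
    simp only [eval_v, hsθ, haθ, hy] at e₁ e₂
    simp only [childCond, holds_an, holds_nt, holds_eq, eval_v, haθ, hy, htθ, e₁, e₂, and_assoc]
  rw [exec_ite]
  split_ifs with hh
  · have := tryUnions_spec (a₁ := .a) (b₁ := .s) (a₂ := .b) (b₂ := .s) h''
      (fun x hx => by
        simp only [List.mem_cons, List.not_mem_nil, or_false] at hx
        rcases hx with rfl | rfl | rfl | rfl <;> rfl)
    rw [haθ, hsθ, hy, hfam, hfam] at this
    refine this.mono ?_
    rintro X (hX | ⟨b', hb', hX⟩)
    · exact Or.inl (Or.inl hX)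
    · rcases Nat.lt_succ_iff_lt_or_eq.1 hb' with hlt | rfl
      · exact Or.inl (Or.inr ⟨b', hlt, hX⟩)
      · obtain ⟨_, _, _, hX⟩ := hX
        exact Or.inr hX
  · refine h''.mono ?_
    rintro X (hX | ⟨b', hb', hX⟩)
    · exact Or.inl hX
    · rcases Nat.lt_succ_iff_lt_or_eq.1 hb' with hlt | rfl
      · exact Or.inr ⟨b', hlt, hX⟩
      · obtain ⟨_, _, hab, hX⟩ := hX
        exact absurd (hcond.2 hab) hh

/-- Compute the family for the tree edge `st` whose side is described by `inA`, one partial solution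
for each test. -/
def prune : St :=
  .forr .tau .num (.seq (.assign .q (.v .tau)) (.seq decode (.seq setupTest (.seq tryCandidates
    (.seq (.assign .p₁ (slotEx .s .t .tau))
      (.forr .v .n (.store .fam (.add (.v .p₁) (.v .v)) (.ld .best (.v .v)))))))))

/-- The register values depending on the tentative width `κ`: the sets described by a test have at
most `4 * κ` elements, so that it has `3 * (4 * κ) + 1` digits, and `num` is the number of tests. -/
structure Par (n κ : ℕ) (σ : Mem) : Prop where
  ell : σ.var .ell = 4 * κ
  len : σ.var .len = 3 * (4 * κ) + 1
  num : σ.var .num = (n + 1) ^ (3 * (4 * κ) + 1)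

lemma Par.frame {c : St} {κ : ℕ} (h : Par n κ σ) (hF : Frame c σ ρ) (hc : c.ok = true) :
    Par n κ ρ :=
  ⟨(hF.var _ (St.writes_of_lim hc rfl)).trans h.ell,
    (hF.var _ (St.writes_of_lim hc rfl)).trans h.len,
    (hF.var _ (St.writes_of_lim hc rfl)).trans h.num⟩

/-- Pruning leaves the families of the other tree edges alone and, if the families of the children
are representative, makes the family of `st` representative. -/
theorem prune_spec {κ : ℕ} (h : Inp f G w D σ) (hn : 0 < n) (hP : Par n κ σ) {s t : Fin m}
    (hs : σ.var .s = s) (ht : σ.var .t = t) (hst : D.tree.Adj s t)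
    (hA : (bits n σ .inA 0 : Set (Fin n)) = D.side s t) :
    (∀ s' t' : Fin m, (s', t') ≠ (s, t) →
      family n (prune.exec σ) s' t' = family n σ s' t') ∧
    ((¬ HasIrredundant G (D.side s t) (κ + 1) ∨ ¬ HasIrredundant G (D.side s t)ᶜ (κ + 1)) →
      (∀ a, D.tree.Adj s a → a ≠ t →
        Represents (Setoid.ker (base n f)) G w (D.side a s) (family n σ a s)) →
      Represents (Setoid.ker (base n f)) G w (D.side s t) (family n (prune.exec σ) s t)) := by
  set A := D.side s t with hAdef
  set M := σ.var .num with hM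
  set K : Mem → ℕ → Finset (Fin n) := fun ρ τ => bits n ρ .fam (slot σ s t τ) with hK
  set Te : ℕ → Test (Fin n) := fun τ =>
    digitTest n f (4 * κ) fun j => τ / (n + 1) ^ j % (n + 1) with hTe
  set I : ℕ → Mem → Prop := fun k ρ =>
    (∀ s' t' : Fin m, (s', t') ≠ (s, t) → family n ρ s' t' = family n σ s' t') ∧
    ∀ τ < k, (K ρ τ = ∅ ∨ (Te τ).Passes G A (K ρ τ)) ∧
      ∀ X ∈ candidates D σ s t, (Te τ).Passes G A X → ∑ v ∈ X, w v ≤ ∑ v ∈ K ρ τ, w v with hI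
  have hmain : I M (prune.exec σ) := by
    refine St.exec_forr' I (fun i ρ k hi => ?_) ⟨fun _ _ _ => rfl, fun τ hτ => absurd hτ (by simp)⟩
      fun i hi ρ hF hIρ hx => ?_
    · refine ⟨fun s' t' hne => ?_, hi.2⟩
      rw [family_congr (c := .assign .tau (.c 0)) ((Frame.refl _ ρ).setVar rfl k) rfl rfl rfl rfl]
      exact hi.1 s' t' hne
    set ρ₁ := ρ.setVar .q (ρ.var .tau) with hρ₁
    set ρ₂ := decode.exec ρ₁ with hρ₂
    set ρ₃ := setupTest.exec ρ₂ with hρ₃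
    set ρ₄ := tryCandidates.exec ρ₃ with hρ₄
    set ρ₅ := ρ₄.setVar .p₁ ((slotEx .s .t .tau).eval ρ₄) with hρ₅
    set c := St.forr .v .n (.store .fam (.add (.v .p₁) (.v .v)) (.ld .best (.v .v))) with hc
    change I (i + 1) (c.exec ρ₅)
    have g₀ : Inp f G w D ρ := h.frame hF rfl
    have g₁ : Inp f G w D ρ₁ := g₀.setVar _
    have g₂ : Inp f G w D ρ₂ := g₁.exec rfl
    have g₃ : Inp f G w D ρ₃ := g₂.exec rfl
    have p₀ : Par n κ ρ := hP.frame hF rfl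
    have p₂ : Par n κ ρ₂ := Par.frame (σ := ρ₁) (c := decode)
      ⟨p₀.ell, p₀.len, p₀.num⟩ (St.frame _ _) rfl
    have hA₂ : (bits n ρ₂ .inA 0 : Set (Fin n)) = A := by
      rw [← hA]
      congr 1
      refine bits_congr fun v _ => ?_
      rw [hρ₂, St.exec_arr rfl]
      exact congrFun (hF.arr .inA rfl) _
    have htest : TestIn G A (Te i) ρ₃ := by
      have := setupTest_spec g₂ p₂.ell hA₂
      rwa [digitTest_congr (d' := fun j => i / (n + 1) ^ j % (n + 1)) fun j hj => ?_] at this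
      refine decode_spec (Nat.succ_pos n) g₁.var_nn (by simp [hρ₁, hx]) ?_ ?_
      · rw [show ρ₁.var .num = M from hF.var .num rfl]
        exact hi.le
      · rwa [show ρ₁.var .len = _ from p₀.len]
    have hs₃ : ρ₃.var .s = s := by
      rw [hρ₃, St.exec_var rfl, hρ₂, St.exec_var rfl, hρ₁, Mem.setVar_var, if_neg (by simp),
        hF.var .s rfl, hs]
    have ht₃ : ρ₃.var .t = t := by
      rw [hρ₃, St.exec_var rfl, hρ₂, St.exec_var rfl, hρ₁, Mem.setVar_var, if_neg (by simp),
        hF.var .t rfl, ht]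
    have hsearch := tryCandidates_spec g₃ htest hs₃ ht₃
    rw [← hρ₄] at hsearch
    -- The families of the children of `s` have not changed.
    have hf₃ : ∀ s' t', family n ρ₃ s' t' = family n ρ s' t' := fun s' t' => by
      rw [hρ₃, family_congr (St.frame setupTest ρ₂) rfl rfl rfl rfl, hρ₂,
        family_congr (St.frame decode ρ₁) rfl rfl rfl rfl]
      rfl
    have hcand : candidates D ρ₃ s t = candidates D σ s t := by
      ext X
      refine or_congr_right (exists_congr fun a => exists_congr fun b => and_congr_right ?_)
      rintro ⟨ha, hb, -⟩
      rw [hf₃, hf₃, hIρ.1 a s (fun h => ha.ne (Prod.ext_iff.1 h).1.symm),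
        hIρ.1 b s (fun h => hb.ne (Prod.ext_iff.1 h).1.symm)]
    rw [hcand] at hsearch
    have hlim : ∀ x, x.lim = true → ρ₄.var x = σ.var x := fun x hxl => by
      rw [hρ₄, St.exec_var (St.writes_of_lim rfl hxl), hρ₃, St.exec_var (St.writes_of_lim rfl hxl),
        hρ₂, St.exec_var (St.writes_of_lim rfl hxl), hρ₁, Mem.setVar_var,
        if_neg (fun e => by simp [e, Reg.lim] at hxl)]
      exact hF.var x (St.writes_of_lim rfl hxl)
    have hlimρ : ∀ x, x.lim = true → ρ.var x = σ.var x := fun x hxl =>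
      hF.var x (St.writes_of_lim rfl hxl)
    have hfam₅ : ρ₅.arr .fam = ρ.arr .fam := by
      rw [hρ₅, Mem.setVar_arr, hρ₄, St.exec_arr rfl, hρ₃, St.exec_arr rfl, hρ₂, St.exec_arr rfl,
        hρ₁, Mem.setVar_arr]
    have hp₁ : ρ₅.var .p₁ = slot σ s t i := by
      have e₁ : ρ₄.var .s = s := by rw [hρ₄, St.exec_var rfl, hs₃]
      have e₂ : ρ₄.var .t = t := by rw [hρ₄, St.exec_var rfl, ht₃]
      have e₃ : ρ₄.var .tau = i := by
        rw [hρ₄, St.exec_var rfl, hρ₃, St.exec_var rfl, hρ₂, St.exec_var rfl, hρ₁, Mem.setVar_var,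
          if_neg (by simp), hx]
      rw [hρ₅, Mem.setVar_var, if_pos rfl, eval_slotEx, e₁, e₂, e₃,
        slot_congr (hlim _ rfl) (hlim _ rfl) (hlim _ rfl)]
    have hn₅ : ρ₅.var .n = n := by
      rw [hρ₅, Mem.setVar_var, if_neg (by simp), hlim .n rfl, h.var_n]
    set θ := c.exec ρ₅ with hθ
    have hlimθ : ∀ x, x.lim = true → θ.var x = σ.var x := fun x hxl => by
      rw [hθ, St.exec_var (St.writes_of_lim rfl hxl), hρ₅, Mem.setVar_var,
        if_neg (fun e => by simp [e, Reg.lim] at hxl), hlim x hxl]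
    have hfamθ := St.exec_fillAt (x := .v) (y := .n) (p := .p₁) (a := .fam) (e := .ld .best (.v .v))
      (by decide) rfl ρ₅
    rw [← hc, ← hθ, hp₁, hn₅, hfam₅] at hfamθ
    -- Only the segment with the current number is written.
    have hother : ∀ (s' t' : Fin m) (τ' : ℕ), τ' < M → ¬ (s' = s ∧ t' = t ∧ τ' = i) →
        bits n θ .fam (slot σ s' t' τ') = bits n ρ .fam (slot σ s' t' τ') := by
      intro s' t' τ' hτ' hne
      refine bits_congr fun v hv => ?_
      rw [hfamθ]
      dsimp only
      rw [if_neg]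
      rintro ⟨hle, hlt⟩
      obtain ⟨v', hv'⟩ := Nat.exists_eq_add_of_le hle
      obtain ⟨e₁, e₂, e₃⟩ := slot_inj (by rw [h.var_m]; exact t'.2) (by rw [h.var_m]; exact t.2)
        hτ' hi (by rwa [h.var_n]) (by rw [h.var_n]; omega) hv'
      exact hne ⟨Fin.ext e₁, Fin.ext e₂, e₃⟩
    have hnew : K θ i = bits n ρ₄ .best 0 := by
      refine bits_congr fun v hv => ?_
      rw [hfamθ]
      dsimp only
      rw [if_pos ⟨by omega, by omega⟩]
      simp [hρ₅]
    refine ⟨fun s' t' hne => ?_, fun τ hτ => ?_⟩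
    · rw [← hIρ.1 s' t' hne]
      have hM' : ρ.var .num = M := hlimρ _ rfl
      have e : ∀ x, x.lim = true → θ.var x = ρ.var x := fun x hxl =>
        (hlimθ x hxl).trans (hlimρ x hxl).symm
      refine family_eq (e _ rfl) (e _ rfl) (e _ rfl) fun τ' hτ' => ?_
      rw [slot_congr (hlimρ _ rfl) (hlimρ _ rfl) (hlimρ _ rfl)]
      exact hother s' t' τ' (hM' ▸ hτ') fun hh => hne (by rw [hh.1, hh.2.1])
    · rcases Nat.lt_succ_iff_lt_or_eq.1 hτ with hlt | rfl
      · have : K θ τ = K ρ τ := hother s t τ (hlt.trans hi) fun hh => by omega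
        rw [this]
        exact hIρ.2 τ hlt
      · rw [hnew]
        refine ⟨hsearch.passes, fun X hX hXp => ?_⟩
        rw [← hsearch.val]
        exact hsearch.max X hX hXp
  refine ⟨hmain.1, fun hκ hc => ?_⟩
  have hlim : ∀ x, x.lim = true → (prune.exec σ).var x = σ.var x := fun x hxl =>
    St.exec_var (St.writes_of_lim rfl hxl) _
  have hMn : M = (n + 1) ^ (3 * (4 * κ) + 1) := hP.num
  refine ((represents_candidates hst hc).prune (K := fun τ => K (prune.exec σ) τ)
    (completeTests_digitTest (f := f) hn hκ) (fun τ => (hmain.2 τ (by rw [hMn]; exact τ.2)).1)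
    fun τ => (hmain.2 τ (by rw [hMn]; exact τ.2)).2).mono ?_
  rintro _ ⟨τ, rfl⟩
  exact ⟨τ, by rw [hlim _ rfl, ← hM, hMn]; exact τ.2,
    by rw [slot_congr (hlim _ rfl) (hlim _ rfl) (hlim _ rfl)]⟩

end Families

section Rounds

variable {n m f κ : ℕ} {G : SimpleGraph (Fin n)} {w : Fin n → ℕ}
  {D : BranchDecomposition (Fin n) (Fin m)} {σ ρ : Mem}

/-! ### Dynamic programming along the tree -/

/-- Compute the families for all tree edges; after `i` rounds they are correct for the edges with at
most `i` nodes on their side. -/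
def rounds : St :=
  .forr .rd .m (.forr .s .m (.forr .t .m (.ite (tadj (.v .s) (.v .t)) (.seq sideProg prune) .skip)))

/-- Every tree edge has a side without irredundant sets of more than `κ` elements. -/
def SmallCuts (G : SimpleGraph (Fin n)) (D : BranchDecomposition (Fin n) (Fin m)) (κ : ℕ) : Prop :=
  ∀ s t, D.tree.Adj s t → ¬ HasIrredundant G (D.side s t) (κ + 1) ∨
    ¬ HasIrredundant G (D.side s t)ᶜ (κ + 1)

/-- All families are representative in the end: the children of a tree edge have fewer nodes on
their sides, and a family which has become representative remains so when it is recomputed. -/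
theorem rounds_spec (h : Inp f G w D σ) (hn : 0 < n) (hP : Par n κ σ) (hκ : SmallCuts G D κ)
    {s t : Fin m} (hst : D.tree.Adj s t) :
    Represents (Setoid.ker (base n f)) G w (D.side s t) (family n (rounds.exec σ) s t) := by
  set body := St.ite (tadj (.v .s) (.v .t)) (.seq sideProg prune) .skip with hbody
  set R : Mem → Fin m → Fin m → Prop := fun ρ s t =>
    Represents (Setoid.ker (base n f)) G w (D.side s t) (family n ρ s t) with hR
  -- In round `r`, the edges before `(i, j)` have been treated.
  set J : ℕ → ℕ → ℕ → Mem → Prop := fun r i j ρ => ∀ s t : Fin m, D.tree.Adj s t →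
    ((D.nodeSide s t).ncard ≤ r ∨
      ((D.nodeSide s t).ncard ≤ r + 1 ∧ ((s : ℕ) < i ∨ ((s : ℕ) = i ∧ (t : ℕ) < j)))) → R ρ s t
    with hJ
  have hJset : ∀ (x : Reg) (k : ℕ), (St.assign x (.c 0)).ok = true → ∀ r i j ρ, J r i j ρ →
      J r i j (ρ.setVar x k) := by
    intro x k hx r i j ρ hJρ s t hst hc
    have := hJρ s t hst hc
    simp only [hR] at this ⊢
    rwa [family_congr (c := .assign x (.c 0)) ((Frame.refl _ ρ).setVar (by simp [St.writes]) k) rfl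
      (St.writes_of_lim hx rfl) (St.writes_of_lim hx rfl) (St.writes_of_lim hx rfl)]
  have hm := h.var_m
  have hrounds := St.exec_forr' (x := .rd) (y := .m) (σ := σ) (c := .forr .s .m (.forr .t .m body))
    (fun r ρ => J r 0 0 ρ) (fun r ρ k hI => hJset .rd k rfl _ _ _ _ hI) ?_
    fun r hr ρ₁ hF₁ hI₁ hx₁ => ?_
  · refine hrounds s t hst (Or.inl ?_)
    have := Set.ncard_le_ncard (Set.subset_univ (D.nodeSide s t))
    simpa [hm, Set.ncard_univ] using this
  · intro s t _ hc
    have h0 : 0 < (D.nodeSide s t).ncard :=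
      (Set.ncard_pos (Set.toFinite _)).2 ⟨s, D.self_mem_nodeSide s t⟩
    omega
  have g₁ : Inp f G w D ρ₁ := h.frame hF₁ rfl
  have hs := St.exec_forr' (x := .s) (y := .m) (σ := ρ₁) (c := .forr .t .m body)
    (fun i ρ => J r i 0 ρ) (fun i ρ k hI => hJset .s k rfl _ _ _ _ hI) hI₁
    fun i hi ρ₂ hF₂ hI₂ hx₂ => ?_
  · rw [g₁.var_m] at hs
    refine fun s t hst hc => hs s t hst ?_
    have := s.2
    omega
  rw [g₁.var_m] at hi
  have g₂ : Inp f G w D ρ₂ := g₁.frame hF₂ rfl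
  have ht := St.exec_forr' (x := .t) (y := .m) (σ := ρ₂) (c := body)
    (fun j ρ => J r i j ρ) (fun j ρ k hI => hJset .t k rfl _ _ _ _ hI) hI₂
    fun j hj ρ₃ hF₃ hI₃ hx₃ => ?_
  · rw [g₂.var_m] at ht
    refine fun s t hst hc => ht s t hst ?_
    have := t.2
    omega
  rw [g₂.var_m] at hj
  have g₃ : Inp f G w D ρ₃ := g₂.frame hF₃ rfl
  have p₃ : Par n κ ρ₃ := ((hP.frame hF₁ rfl).frame hF₂ rfl).frame hF₃ rfl
  have hs₃ : ρ₃.var .s = i := (hF₃.var .s rfl).trans hx₂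
  have hadj := g₃.holds_tadj (u := .v .s) (v := .v .t) (by simpa [hs₃] using hi)
    (by simpa [hx₃] using hj)
  simp only [eval_v, hs₃, hx₃] at hadj
  rw [hbody, exec_ite]
  split_ifs with hh
  · rw [hadj] at hh
    set ρ₄ := sideProg.exec ρ₃ with hρ₄
    have hexec : (St.seq sideProg prune).exec ρ₃ = prune.exec ρ₄ := rfl
    have g₄ : Inp f G w D ρ₄ := g₃.exec rfl
    have p₄ : Par n κ ρ₄ := p₃.frame (St.frame sideProg ρ₃) rfl
    have hs₄ : ρ₄.var .s = i := by rw [hρ₄, St.exec_var rfl, hs₃]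
    have ht₄ : ρ₄.var .t = j := by rw [hρ₄, St.exec_var rfl, hx₃]
    have hfam : ∀ s t, family n ρ₄ s t = family n ρ₃ s t := fun s t =>
      family_congr (St.frame sideProg ρ₃) rfl rfl rfl rfl s t
    obtain ⟨hother, hnew⟩ := prune_spec (s := ⟨i, hi⟩) (t := ⟨j, hj⟩) g₄ hn p₄ hs₄ ht₄ hh
      (sideProg_spec g₃ (s := ⟨i, hi⟩) (t := ⟨j, hj⟩) hs₃ hx₃)
    rw [hexec]
    intro s t hst hc
    by_cases hst' : (s, t) = (⟨i, hi⟩, ⟨j, hj⟩)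
    · obtain ⟨rfl, rfl⟩ := Prod.mk.inj hst'
      refine hnew (hκ _ _ hh) fun a ha hat => ?_
      rw [hfam]
      have hlt := BranchDecomposition.ncard_nodeSide_lt ha hat
      exact hI₃ a _ ha.symm (Or.inl (by omega))
    · simp only [hR]
      rw [hother s t hst', hfam]
      refine hI₃ s t hst ?_
      have : ¬ ((s : ℕ) = i ∧ (t : ℕ) = j) := fun e =>
        hst' (Prod.ext (Fin.ext e.1) (Fin.ext e.2))
      omega
  · rw [hadj] at hh
    intro s t hst hc
    refine hI₃ s t hst ?_
    have : ¬ ((s : ℕ) = i ∧ (t : ℕ) = j) := by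
      rintro ⟨rfl, rfl⟩
      exact hh hst
    omega

/-! ### Combining the two sides of an edge -/

/-- The test without conditions on the other side of the cut, for the trivial cut. -/
def trivialTest (n f : ℕ) : Test (Fin n) := ⟨True, ∅, base n f, ∅⟩

lemma allowed_trivialTest : (trivialTest n f).allowed G Set.univ = Set.univ := by
  ext v
  simp [Test.allowed, trivialTest, Unblocked]

lemma passes_trivialTest {X : Set (Fin n)} :
    (trivialTest n f).Passes G Set.univ X ↔ Good (Setoid.ker (base n f)) G X := by
  have hE : testEdges G Set.univ (trivialTest n f).bd X = edgesIn G X := by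
    ext e
    constructor
    · rintro ⟨x, y, rfl, hadj, hx, hy | hy⟩
      · exact mk_mem_edgesIn.2 ⟨hadj, hx, hy⟩
      · exact (hy.2 trivial).elim
    · induction e with | h x y =>
      intro he
      obtain ⟨hadj, hx, hy⟩ := mk_mem_edgesIn.1 he
      exact ⟨x, y, rfl, hadj, hx, Or.inl hy⟩
  rw [Test.Passes, hE, allowed_trivialTest]
  exact and_iff_right (Set.subset_univ _)

/-- Prepare the test without conditions. -/
def setupTrivial : St :=
  .seq (.forr .v .n (.store .inA (.v .v) (.c 1))) (.seq (.forr .v .n (.store .bd (.v .v) (.c 0)))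
    (.seq (.forr .v .n (.store .lab₀ (.v .v) (.ite (.v .fvs) (.v .v) (.c 0))))
      (.forr .v .n (.store .alw (.v .v) (.c 1)))))

lemma setupTrivial_spec (h : Inp f G w D σ) :
    TestIn G Set.univ (trivialTest n f) (setupTrivial.exec σ) := by
  set c₁ := St.forr .v .n (.store .inA (.v .v) (.c 1)) with hc₁
  set c₂ := St.forr .v .n (.store .bd (.v .v) (.c 0)) with hc₂
  set c₃ := St.forr .v .n (.store .lab₀ (.v .v) (.ite (.v .fvs) (.v .v) (.c 0))) with hc₃
  set c₄ := St.forr .v .n (.store .alw (.v .v) (.c 1)) with hc₄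
  set σ₁ := c₁.exec σ with hσ₁
  set σ₂ := c₂.exec σ₁ with hσ₂
  set σ₃ := c₃.exec σ₂ with hσ₃
  have hexec : setupTrivial.exec σ = c₄.exec σ₃ := rfl
  have h₁ : Inp f G w D σ₁ := h.exec rfl
  have h₂ : Inp f G w D σ₂ := h₁.exec rfl
  have h₃ : Inp f G w D σ₃ := h₂.exec rfl
  rw [hexec]
  refine ⟨?_, ?_, fun v => ?_, ?_⟩
  · ext v
    rw [Finset.mem_coe, mem_bits, zero_add, hc₄, St.exec_arr rfl, hσ₃, hc₃, St.exec_arr rfl, hσ₂,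
      hc₂, St.exec_arr rfl, hσ₁, hc₁, St.exec_fill rfl _ (by rw [h.var_n]; exact v.2)]
    simp
  · ext v
    rw [Finset.mem_coe, mem_bits, zero_add, hc₄, St.exec_arr rfl, hσ₃, hc₃, St.exec_arr rfl, hσ₂,
      hc₂, St.exec_fill rfl _ (by rw [h₁.var_n]; exact v.2)]
    simp [trivialTest]
  · rw [hc₄, St.exec_arr rfl, hσ₃, hc₃, St.exec_fill rfl _ (by rw [h₂.var_n]; exact v.2)]
    simp [trivialTest, base, h₂.var_fvs]
  · ext v
    rw [Finset.mem_coe, mem_bits, zero_add, hc₄, St.exec_fill rfl _ (by rw [h₃.var_n]; exact v.2),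
      allowed_trivialTest]
    simp

/-- Find a heaviest good set; the output is this set or its complement. -/
def combine : St :=
  .seq setupTrivial (.seq clearBest
    (.seq (.forr .v .n (.store .cand (.v .v) (.c 1)))
    (.seq (.ite (.le (.v .m) (.c 1)) tryCand .skip)
    (.seq (.forr .s .m (.forr .t .m (.ite (tadj (.v .s) (.v .t)) (tryUnions .s .t .t .s) .skip)))
      (.forr .v .n (.store .out (.v .v)
        (.ite (.v .fvs) (.nt (.ld .best (.v .v))) (.ld .best (.v .v)))))))))

lemma card_eq_one_of_no_edge (D : BranchDecomposition (Fin n) (Fin m))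
    (h : ∀ s t, ¬ D.tree.Adj s t) : m = 1 := by
  have hc := D.isTree.connected
  have : Subsingleton (Fin m) := ⟨fun s t => by
    obtain ⟨p⟩ := hc.preconnected s t
    cases p with
    | nil => rfl
    | cons hadj _ => exact (h _ _ hadj).elim⟩
  obtain ⟨s⟩ := hc.nonempty
  simpa using Fintype.card_eq_one_iff.2 ⟨s, fun t => Subsingleton.elim t s⟩

lemma good_of_subsingleton [Subsingleton (Fin n)] {r : Setoid (Fin n)} (X : Set (Fin n)) :
    Good r G X := by
  have : edgesIn G X = ∅ := by
    ext e
    induction e with | h x y =>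
    simp [Subsingleton.elim x y]
  rw [Good, this]
  exact forestOver_empty

/-- A heaviest good set is found by combining the families of the two sides of any tree edge. If
there is no tree edge, then there is only one vertex, and the set of all vertices is tried. -/
theorem combine_spec (h : Inp f G w D σ)
    (hrep : ∀ s t, D.tree.Adj s t →
      Represents (Setoid.ker (base n f)) G w (D.side s t) (family n σ s t)) :
    ∃ B : Finset (Fin n), Good (Setoid.ker (base n f)) G B ∧
      (∀ S : Finset (Fin n), Good (Setoid.ker (base n f)) G S → ∑ v ∈ S, w v ≤ ∑ v ∈ B, w v) ∧
      bits n (combine.exec σ) .out 0 = if f ≠ 0 then Bᶜ else B := by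
  set T := trivialTest n f with hT
  set cc := St.forr .v .n (.store .cand (.v .v) (.c 1)) with hcc
  set cl := St.ite (.le (.v .m) (.c 1)) tryCand .skip with hcl
  set cu := St.forr .s .m (.forr .t .m (.ite (tadj (.v .s) (.v .t)) (tryUnions .s .t .t .s) .skip))
    with hcu
  set co := St.forr .v .n (.store .out (.v .v)
        (.ite (.v .fvs) (.nt (.ld .best (.v .v))) (.ld .best (.v .v)))) with hco
  set σ₁ := setupTrivial.exec σ with hσ₁
  set σ₂ := clearBest.exec σ₁ with hσ₂
  set σ₃ := cc.exec σ₂ with hσ₃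
  set σ₄ := cl.exec σ₃ with hσ₄
  set σ₅ := cu.exec σ₄ with hσ₅
  have hexec : combine.exec σ = co.exec σ₅ := rfl
  have h₁ : Inp f G w D σ₁ := h.exec rfl
  have h₂ : Search f G w D Set.univ T ∅ σ₂ := clearBest_spec h₁ (setupTrivial_spec h)
  have h₃ : Search f G w D Set.univ T ∅ σ₃ := h₂.frame (St.frame _ _) rfl rfl rfl rfl
  have hcand : bits n σ₃ .cand 0 = Finset.univ := by
    ext v
    rw [mem_bits, zero_add, hσ₃, hcc, St.exec_fill rfl _ (by rw [h₂.inp.var_n]; exact v.2)]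
    simp
  have h₄ : Search f G w D Set.univ T {X | m ≤ 1 ∧ X = Finset.univ} σ₄ := by
    rw [hσ₄, hcl, exec_ite]
    have hc : (Ex.le (.v .m) (.c 1)).Holds σ₃ ↔ m ≤ 1 := by simp [h₃.inp.var_m]
    split_ifs with hh
    · refine (tryCand_spec h₃).mono ?_
      rintro X ⟨-, rfl⟩
      rw [hcand]
      exact Set.mem_insert _ _
    · refine h₃.mono ?_
      rintro X ⟨hm, -⟩
      exact (hh (hc.2 hm)).elim
  have hfam₄ : ∀ s t, family n σ₄ s t = family n σ s t := by
    intro s t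
    rw [hσ₄, family_congr (St.frame cl σ₃) rfl rfl rfl rfl, hσ₃,
      family_congr (St.frame cc σ₂) rfl rfl rfl rfl, hσ₂,
      family_congr (St.frame clearBest σ₁) rfl rfl rfl rfl, hσ₁,
      family_congr (St.frame setupTrivial σ) rfl rfl rfl rfl]
  set Q : ℕ → ℕ → Set (Finset (Fin n)) := fun s t => {X | ∃ (hs : s < m) (ht : t < m),
    D.tree.Adj ⟨s, hs⟩ ⟨t, ht⟩ ∧ X ∈ unions (family n σ s t) (family n σ t s)} with hQ
  set C₀ : Set (Finset (Fin n)) := {X | m ≤ 1 ∧ X = Finset.univ} with hC₀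
  have h₅ : Search f G w D Set.univ T (C₀ ∪ {X | ∃ s < m, ∃ t < m, X ∈ Q s t}) σ₅ := by
    have hout := St.exec_forr' (x := .s) (y := .m) (σ := σ₄)
      (c := .forr .t .m (.ite (tadj (.v .s) (.v .t)) (tryUnions .s .t .t .s) .skip))
      (fun k ρ => Search f G w D Set.univ T (C₀ ∪ {X | ∃ s < k, ∃ t < m, X ∈ Q s t}) ρ)
      (fun i ρ k h => h.setVar k) (by simpa using h₄) fun i hi ρ hF h' hx => ?_
    · rwa [h₄.inp.var_m] at hout
    rw [h₄.inp.var_m] at hi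
    have hin := St.exec_forr' (x := .t) (y := .m) (σ := ρ)
      (c := .ite (tadj (.v .s) (.v .t)) (tryUnions .s .t .t .s) .skip)
      (fun k ρ => Search f G w D Set.univ T ((C₀ ∪ {X | ∃ s < i, ∃ t < m, X ∈ Q s t}) ∪
        {X | ∃ t < k, X ∈ Q i t}) ρ)
      (fun i ρ k h => h.setVar k) (by simpa using h') fun j hj θ hF' h'' hy => ?_
    · refine hin.mono ?_
      rintro X (hX | ⟨s, hs, t, ht, hX⟩)
      · exact Or.inl (Or.inl hX)
      · rcases Nat.lt_succ_iff_lt_or_eq.1 hs with hlt | rfl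
        · exact Or.inl (Or.inr ⟨s, hlt, t, ht, hX⟩)
        · exact Or.inr ⟨t, by rwa [h'.inp.var_m], hX⟩
    rw [h'.inp.var_m] at hj
    have hsθ : θ.var .s = i := (hF'.var .s rfl).trans hx
    have hfam : ∀ s t, family n θ s t = family n σ s t := fun s t => by
      rw [family_congr hF' rfl rfl rfl rfl, family_congr hF rfl rfl rfl rfl, hfam₄]
    have hadj := h''.inp.holds_tadj (u := .v .s) (v := .v .t) (by simpa [hsθ] using hi)
      (by simpa [hy] using hj)
    simp only [eval_v, hsθ, hy] at hadj
    rw [exec_ite]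
    split_ifs with hh
    · have := tryUnions_spec (a₁ := .s) (b₁ := .t) (a₂ := .t) (b₂ := .s) h''
        (fun x hx => by
          simp only [List.mem_cons, List.not_mem_nil, or_false] at hx
          rcases hx with rfl | rfl | rfl | rfl <;> rfl)
      rw [hsθ, hy, hfam, hfam] at this
      refine this.mono ?_
      rintro X (hX | ⟨t, ht, hX⟩)
      · exact Or.inl (Or.inl hX)
      · rcases Nat.lt_succ_iff_lt_or_eq.1 ht with hlt | rfl
        · exact Or.inl (Or.inr ⟨t, hlt, hX⟩)
        · obtain ⟨_, _, _, hX⟩ := hX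
          exact Or.inr hX
    · refine h''.mono ?_
      rintro X (hX | ⟨t, ht, hX⟩)
      · exact Or.inl hX
      · rcases Nat.lt_succ_iff_lt_or_eq.1 ht with hlt | rfl
        · exact Or.inr ⟨t, hlt, hX⟩
        · obtain ⟨_, _, hab, hX⟩ := hX
          exact absurd (hadj.2 hab) hh
  set B := bits n σ₅ .best 0 with hB
  refine ⟨B, ?_, fun S hS => ?_, ?_⟩
  · rcases h₅.passes with h0 | hp
    · rw [← hB] at h0
      have : edgesIn G (B : Set (Fin n)) = ∅ := by
        ext e
        induction e with | h x y => simp [h0]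
      rw [Good, this]
      exact forestOver_empty
    · exact passes_trivialTest.1 hp
  · rw [hB, ← h₅.val]
    by_cases hedge : ∃ s t, D.tree.Adj s t
    · obtain ⟨s, t, hst⟩ := hedge
      have hr := hrep t s hst.symm
      rw [← BranchDecomposition.side_compl hst] at hr
      obtain ⟨X, hX, hw, hg⟩ := (hrep s t hst).exists_union hr S hS
      exact hw.trans (h₅.max X (Or.inr ⟨s, s.2, t, t.2, s.2, t.2, hst, hX⟩)
        (passes_trivialTest.2 hg))
    · simp only [not_exists] at hedge
      have hm := card_eq_one_of_no_edge D hedge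
      have : Subsingleton (Fin n) := by
        subst hm
        exact D.leaf_injective.subsingleton
      exact (Finset.sum_le_sum_of_subset (Finset.subset_univ S)).trans
        (h₅.max Finset.univ (Or.inl ⟨hm.le, rfl⟩) (passes_trivialTest.2 (good_of_subsingleton _)))
  · ext v
    rw [mem_bits, zero_add, hexec, hco, St.exec_fill rfl _ (by rw [h₅.inp.var_n]; exact v.2),
      eval_ne_zero, holds_ite]
    simp only [holds_v, holds_nt, holds_ld, eval_v, Mem.setVar_var, if_true, Mem.setVar_arr,
      reduceCtorEq, if_false, h₅.inp.var_fvs]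
    split_ifs with hf
    · simp [hf, hB]
    · simp [not_not.1 hf, hB]

end Rounds

/-! ### Running time -/

/-- `f` is bounded by a polynomial. -/
def PolyBounded (f : ℕ → ℕ) : Prop := ∃ K d, ∀ W, f W ≤ K * (W + 1) ^ d

lemma polyBounded_const (k : ℕ) : PolyBounded fun _ => k := ⟨k, 0, fun W => by simp⟩

lemma polyBounded_id : PolyBounded fun W => W := ⟨1, 1, fun W => by simp⟩

lemma PolyBounded.add {f g : ℕ → ℕ} (hf : PolyBounded f) (hg : PolyBounded g) :
    PolyBounded fun W => f W + g W := by
  obtain ⟨K, d, hK⟩ := hf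
  obtain ⟨K', d', hK'⟩ := hg
  refine ⟨K + K', d + d', fun W => ?_⟩
  rw [add_mul]
  refine Nat.add_le_add ((hK W).trans ?_) ((hK' W).trans ?_)
  · exact Nat.mul_le_mul_left _ (Nat.pow_le_pow_right (Nat.succ_pos W) (by omega))
  · exact Nat.mul_le_mul_left _ (Nat.pow_le_pow_right (Nat.succ_pos W) (by omega))

lemma PolyBounded.mul {f g : ℕ → ℕ} (hf : PolyBounded f) (hg : PolyBounded g) :
    PolyBounded fun W => f W * g W := by
  obtain ⟨K, d, hK⟩ := hf
  obtain ⟨K', d', hK'⟩ := hg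
  refine ⟨K * K', d + d', fun W => ?_⟩
  rw [pow_add, mul_mul_mul_comm]
  exact Nat.mul_le_mul (hK W) (hK' W)

lemma Ex.polyBounded_time (e : Ex) : PolyBounded fun W => e.time W := by
  induction e with
  | c k => exact polyBounded_const 2
  | v x => exact polyBounded_const 2
  | ld a e ih => exact ih.add (polyBounded_const 3)
  | add e₁ e₂ ih₁ ih₂ => exact (ih₁.add ih₂).add (polyBounded_const 4)
  | sub e₁ e₂ ih₁ ih₂ => exact (ih₁.add ih₂).add (polyBounded_const 4)
  | ite e e₁ e₂ ih ih₁ ih₂ => exact ((ih.add ih₁).add ih₂).add (polyBounded_const 2)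
  | mul y e ih =>
    exact ih.add ((polyBounded_id.mul (polyBounded_const 12)).add (polyBounded_const 8))
  | sum x y e ih =>
    exact (polyBounded_id.mul (ih.add (polyBounded_const 12))).add (polyBounded_const 12)

lemma St.polyBounded_time (c : St) : PolyBounded fun W => c.time W := by
  induction c with
  | skip => exact polyBounded_const 1
  | assign x e => exact e.polyBounded_time.add (polyBounded_const 2)
  | store a i e => exact (i.polyBounded_time.add e.polyBounded_time).add (polyBounded_const 3)
  | seq c d ihc ihd => exact ihc.add ihd
  | ite e c d ihc ihd => exact ((e.polyBounded_time.add ihc).add ihd).add (polyBounded_const 2)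
  | forr x y c ih =>
    exact (polyBounded_id.mul (ih.add (polyBounded_const 8))).add (polyBounded_const 6)

/-- Started in a state holding `σ`, the program for `c` computes `c.exec σ` in time `c.time W`. -/
def Correct (c : St) (σ : Mem) (W : ℕ) : Prop :=
  ∀ τ, Holding σ τ → ∃ τ', Halts c.comp τ (c.time W) τ' ∧ Holding (c.exec σ) τ'

lemma Correct.seq {c d : St} {σ : Mem} {W : ℕ} (hc : Correct c σ W)
    (hd : Correct d (c.exec σ) W) : Correct (.seq c d) σ W := by
  intro τ hτ
  obtain ⟨τ₁, h₁, g₁⟩ := hc τ hτ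
  obtain ⟨τ₂, h₂, g₂⟩ := hd τ₁ g₁
  exact ⟨τ₂, h₁.seq h₂, g₂⟩

lemma correct_of_ok {c : St} (hc : c.ok) {σ : Mem} {W : ℕ} (hW : σ.Bounded W) : Correct c σ W :=
  fun _ hτ => c.comp_halts hc hτ hW

lemma correct_assign {x : Reg} {e : Ex} (he : e.ok) {σ : Mem} {W : ℕ} (hW : σ.Bounded W) :
    Correct (.assign x e) σ W := fun _ hτ => St.assign_halts x e he hτ hW

lemma Mem.Bounded.setVar_le {σ : Mem} {W : ℕ} (h : σ.Bounded W) (x : Reg) {k : ℕ} (hk : k ≤ W) :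
    (σ.setVar x k).Bounded W := by
  intro y hy
  rw [Mem.setVar_var]
  split_ifs
  · exact hk
  · exact h y hy

/-! ### The algorithm -/

section Main

variable {n m f κ W : ℕ} {G : SimpleGraph (Fin n)} {w : Fin n → ℕ}
  {D : BranchDecomposition (Fin n) (Fin m)} {σ ρ : Mem}

/-- Compute the power of `n + 1` with exponent `len` in `pow`. -/
def powerProg : St :=
  .seq (.assign .pow (.c 1)) (.forr .j .len (.assign .pow (.mul .nn (.v .pow))))

lemma powerProg_spec : (powerProg.exec σ).var .pow = σ.var .nn ^ σ.var .len := by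
  have := St.exec_forr' (x := .j) (y := .len) (σ := σ.setVar .pow 1)
    (c := .assign .pow (.mul .nn (.v .pow))) (fun i ρ => ρ.var .pow = σ.var .nn ^ i)
    (fun i ρ k h => by simpa using h) (by simp) fun i hi ρ hF h hx => ?_
  · exact this
  · have hnn : ρ.var .nn = σ.var .nn := hF.var .nn rfl
    simp [St.exec, h, hnn, pow_succ']

/-- Set the parameters for the tentative width `kap - 1`. -/
def setPar : St :=
  .seq (.assign .ell (.add (.add (.sub (.v .kap) (.c 1)) (.sub (.v .kap) (.c 1)))
      (.add (.sub (.v .kap) (.c 1)) (.sub (.v .kap) (.c 1)))))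
    (.seq (.assign .len (.add (.add (.v .ell) (.v .ell)) (.add (.v .ell) (.c 1))))
      (.seq powerProg (.assign .num (.v .pow))))

/-- Set the parameters for the tentative width, test it, and increase it if it is too small. -/
def widthStep : St :=
  .seq setPar (.seq checkProg (.assign .kap (.add (.v .kap) (.ite (.v .flag) (.c 1) (.c 0)))))

lemma setPar_spec (h : Inp f G w D σ) (hk : σ.var .kap = κ + 1) (hW : σ.Bounded W)
    (hlen : 3 * (4 * κ) + 1 ≤ W) (hnum : (n + 1) ^ (3 * (4 * κ) + 1) ≤ W) :
    Correct setPar σ W ∧ Inp f G w D (setPar.exec σ) ∧ Par n κ (setPar.exec σ) ∧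
      (setPar.exec σ).Bounded W ∧ (setPar.exec σ).var .kap = κ + 1 := by
  set σ₁ := σ.setVar .ell (4 * κ) with hσ₁
  set σ₂ := σ₁.setVar .len (3 * (4 * κ) + 1) with hσ₂
  set σ₃ := powerProg.exec σ₂ with hσ₃
  set σ₄ := σ₃.setVar .num ((n + 1) ^ (3 * (4 * κ) + 1)) with hσ₄
  have e₁ : (St.assign .ell (.add (.add (.sub (.v .kap) (.c 1)) (.sub (.v .kap) (.c 1)))
      (.add (.sub (.v .kap) (.c 1)) (.sub (.v .kap) (.c 1))))).exec σ = σ₁ := by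
    simp only [St.exec, eval_add, eval_sub, eval_v, eval_c, hk, hσ₁]
    congr 1
    omega
  have e₂ : (St.assign .len (.add (.add (.v .ell) (.v .ell)) (.add (.v .ell) (.c 1)))).exec σ₁ =
      σ₂ := by
    simp only [St.exec, eval_add, eval_v, eval_c, hσ₂]
    congr 1
    simp [hσ₁]
    omega
  have e₄ : (St.assign .num (.v .pow)).exec σ₃ = σ₄ := by
    simp only [St.exec, eval_v, hσ₄]
    congr 1
    rw [hσ₃, powerProg_spec]
    simp [hσ₂, hσ₁, h.var_nn]
  have hexec : setPar.exec σ = σ₄ := by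
    rw [← e₄, hσ₃, ← e₂, ← e₁]
    rfl
  have b₁ : σ₁.Bounded W := hW.setVar_le _ (by omega)
  have b₂ : σ₂.Bounded W := b₁.setVar_le _ hlen
  have b₃ : σ₃.Bounded W := b₂.exec rfl
  rw [hexec]
  refine ⟨?_, ?_, ⟨?_, ?_, ?_⟩, b₃.setVar_le _ hnum, ?_⟩
  · refine (correct_assign rfl hW).seq ?_
    rw [e₁]
    refine (correct_assign rfl b₁).seq ?_
    rw [e₂]
    exact (correct_of_ok rfl b₂).seq (correct_assign rfl b₃)
  · have h₂ : Inp f G w D σ₂ := (h.setVar (x := .ell) _).setVar (x := .len) _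
    have h₃ : Inp f G w D σ₃ := h₂.exec rfl
    exact h₃.setVar (x := .num) _
  · simp [hσ₄, hσ₃, St.exec_var (c := powerProg) (z := .ell) rfl, hσ₂, hσ₁]
  · simp [hσ₄, hσ₃, St.exec_var (c := powerProg) (z := .len) rfl, hσ₂]
  · simp [hσ₄]
  · simp [hσ₄, hσ₃, St.exec_var (c := powerProg) (z := .kap) rfl, hσ₂, hσ₁, hk]

lemma widthStep_spec (h : Inp f G w D σ) (hn : 0 < n) (hk : σ.var .kap = κ + 1)
    (hW : σ.Bounded W) (hlen : 3 * (4 * κ) + 1 ≤ W) (hnum : (n + 1) ^ (3 * (4 * κ) + 1) ≤ W) :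
    Correct widthStep σ W ∧ Inp f G w D (widthStep.exec σ) ∧ Par n κ (widthStep.exec σ) ∧
      ((widthStep.exec σ).var .flag ≠ 0 ↔ ∃ s t, D.tree.Adj s t ∧
        HasIrredundant G (D.side s t) (κ + 1) ∧ HasIrredundant G (D.side s t)ᶜ (κ + 1)) ∧
      (widthStep.exec σ).var .kap = κ + 1 + (if (widthStep.exec σ).var .flag ≠ 0 then 1 else 0) ∧
      (κ + 1 + (if (widthStep.exec σ).var .flag ≠ 0 then 1 else 0) ≤ W →
        (widthStep.exec σ).Bounded W) := by
  obtain ⟨c₁, h₁, p₁, b₁, k₁⟩ := setPar_spec h hk hW hlen hnum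
  set σ₁ := setPar.exec σ with hσ₁
  set σ₂ := checkProg.exec σ₁ with hσ₂
  have h₂ : Inp f G w D σ₂ := h₁.exec rfl
  have p₂ : Par n κ σ₂ := p₁.frame (St.frame checkProg σ₁) rfl
  have b₂ : σ₂.Bounded W := b₁.exec rfl
  have k₂ : σ₂.var .kap = κ + 1 := by rw [hσ₂, St.exec_var rfl, k₁]
  have hexec : widthStep.exec σ =
      σ₂.setVar .kap (κ + 1 + if σ₂.var .flag ≠ 0 then 1 else 0) := by
    have : widthStep.exec σ = (St.assign .kap (.add (.v .kap)
      (.ite (.v .flag) (.c 1) (.c 0)))).exec σ₂ := rfl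
    rw [this, St.exec, eval_add, eval_ite, eval_v, k₂]
    rfl
  have hflag : (widthStep.exec σ).var .flag = σ₂.var .flag := by rw [hexec]; simp
  rw [hflag, hexec]
  refine ⟨c₁.seq ((correct_of_ok rfl b₁).seq (correct_assign rfl b₂)), h₂.setVar (x := .kap) _,
    ⟨?_, ?_, ?_⟩, ?_, by simp, fun hle => b₂.setVar_le _ hle⟩
  · simpa using p₂.ell
  · simpa using p₂.len
  · simpa using p₂.num
  · refine checkProg_spec h₁ k₁ ?_ ?_ hn
    · rw [p₁.len]; omega
    · rw [p₁.num, p₁.len]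

/-- The loop looking for the width. -/
def widthLoop : Cmd := .loop (.var Reg.flag.code) widthStep.comp

/-- The loop ends with a tentative width that is at most the width, but at which the cuts are
small. -/
theorem widthLoop_spec {k : ℕ} (hn : 0 < n) (hk : D.width (omim G) ≤ k)
    (hlen : 3 * (4 * k) + 1 ≤ W) (hnum : (n + 1) ^ (3 * (4 * k) + 1) ≤ W) (hkW : k + 1 ≤ W) :
    ∀ d κ, κ + d = k → ∀ σ τ, Holding σ τ → Inp f G w D σ → σ.var .kap = κ + 1 →
      σ.var .flag ≠ 0 → σ.Bounded W → ∃ κ' σ' τ',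
        Halts widthLoop τ ((d + 1) * (widthStep.time W + 2) + 2) τ' ∧ Holding σ' τ' ∧
        Inp f G w D σ' ∧ Par n κ' σ' ∧ σ'.Bounded W ∧ SmallCuts G D κ' := by
  intro d
  induction d with
  | zero =>
    intro κ hκ σ τ hτ h hkap hflag hW
    obtain rfl : κ = k := by omega
    obtain ⟨hc, h₁, p₁, f₁, -, b₁⟩ := widthStep_spec h hn hkap hW hlen hnum
    have hf : ¬ (widthStep.exec σ).var .flag ≠ 0 := by
      rw [f₁]
      rintro ⟨s, t, hst, g₁, g₂⟩
      have := le_width_of_hasIrredundant hst g₁ g₂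
      omega
    obtain ⟨τ₁, ⟨t₁, ht₁, hr₁⟩, hh₁⟩ := hc τ hτ
    refine ⟨κ, _, τ₁, ⟨_, ?_, .loopTrue ?_ hr₁ (.loopFalse ?_)⟩, hh₁, h₁, p₁, b₁ ?_, ?_⟩
    · simp only [Expr.cost]; omega
    · rw [Expr.eval, hτ.1]; exact hflag
    · rw [Expr.eval, hh₁.1]; exact not_not.1 hf
    · rw [if_neg hf]; omega
    · intro s t hst
      by_contra hcon
      rw [not_or, not_not, not_not] at hcon
      exact hf (f₁.2 ⟨s, t, hst, hcon⟩)
  | succ d ih =>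
    intro κ hκ σ τ hτ h hkap hflag hW
    have hle : 3 * (4 * κ) + 1 ≤ 3 * (4 * k) + 1 := by omega
    obtain ⟨hc, h₁, p₁, f₁, k₁, b₁⟩ := widthStep_spec h hn hkap hW (hle.trans hlen)
      ((Nat.pow_le_pow_right (Nat.succ_pos n) hle).trans hnum)
    obtain ⟨τ₁, ⟨t₁, ht₁, hr₁⟩, hh₁⟩ := hc τ hτ
    by_cases hf : (widthStep.exec σ).var .flag ≠ 0
    · rw [if_pos hf] at k₁ b₁
      obtain ⟨κ', σ', τ', ⟨t', ht', hr'⟩, hres⟩ := ih (κ + 1) (by omega) _ τ₁ hh₁ h₁ k₁ hf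
        (b₁ (by omega))
      refine ⟨κ', σ', τ', ⟨_, ?_, .loopTrue ?_ hr₁ hr'⟩, hres⟩
      · simp only [Expr.cost]
        rw [Nat.succ_mul (d + 1)]
        omega
      · rw [Expr.eval, hτ.1]; exact hflag
    · refine ⟨κ, _, τ₁, ⟨_, ?_, .loopTrue ?_ hr₁ (.loopFalse ?_)⟩, hh₁, h₁, p₁, b₁ ?_, ?_⟩
      · simp only [Expr.cost]
        rw [Nat.succ_mul (d + 1)]
        omega
      · rw [Expr.eval, hτ.1]; exact hflag
      · rw [Expr.eval, hh₁.1]; exact not_not.1 hf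
      · rw [if_neg hf]; omega
      · intro s t hst
        by_contra hcon
        rw [not_or, not_not, not_not] at hcon
        exact hf (f₁.2 ⟨s, t, hst, hcon⟩)

/-- The initialization for the problem `f`. -/
def start (f : ℕ) : St :=
  .seq (.assign .fvs (.c f)) (.seq (.assign .nn (.add (.v .n) (.c 1)))
    (.seq (.assign .kap (.c 1)) (.assign .flag (.c 1))))

/-- The algorithm for maximum weight independent sets (`f = 0`) or minimum weight feedback vertex
sets (`f ≠ 0`). -/
def algorithm (f : ℕ) : Cmd :=
  .seq (start f).comp (.seq widthLoop (.seq rounds.comp combine.comp))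

/-- A bound for the running time of the algorithm if all loops are bounded by `W`. -/
def totalTime (f W : ℕ) : ℕ :=
  (start f).time W + ((W * (widthStep.time W + 2) + 2) + (rounds.time W + combine.time W))

lemma polyBounded_totalTime (f : ℕ) : PolyBounded (totalTime f) :=
  (start f).polyBounded_time.add (((polyBounded_id.mul (widthStep.polyBounded_time.add
    (polyBounded_const 2))).add (polyBounded_const 2)).add
      (rounds.polyBounded_time.add combine.polyBounded_time))

/-- The memory for the input. -/
noncomputable def inputMem (G : SimpleGraph (Fin n)) (w : Fin n → ℕ)
    (D : BranchDecomposition (Fin n) (Fin m)) : Mem :=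
  ⟨fun x => (inputState G w D).var x.code, fun a => (inputState G w D).arr a.code⟩

theorem algorithm_spec (f : ℕ) {k : ℕ} (hn : 0 < n) (hk : D.width (omim G) ≤ k)
    (hlen : 3 * (4 * k) + 1 ≤ W) (hnum : (n + 1) ^ (3 * (4 * k) + 1) ≤ W) (hkW : k + 1 ≤ W)
    (hnW : n + 1 ≤ W) (hmW : m ≤ W) :
    ∃ (τ : State) (B : Finset (Fin n)), Halts (algorithm f) (inputState G w D) (totalTime f W) τ ∧
      Good (Setoid.ker (base n f)) G B ∧
      (∀ S : Finset (Fin n), Good (Setoid.ker (base n f)) G S → ∑ v ∈ S, w v ≤ ∑ v ∈ B, w v) ∧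
      outputSet n τ = if f ≠ 0 then Bᶜ else B := by
  set σ₀ := inputMem G w D with hσ₀
  have hold₀ : Holding σ₀ (inputState G w D) := ⟨fun _ => rfl, fun _ => rfl⟩
  have b₀ : σ₀.Bounded W := by
    intro y hy
    cases y with
    | n => exact (Nat.le_succ n).trans hnW
    | m => exact hmW
    | nn | kap | ell | len | num => exact Nat.zero_le _
    | _ => simp [Reg.lim] at hy
  set σ₁ := (((σ₀.setVar .fvs f).setVar .nn (n + 1)).setVar .kap 1).setVar .flag 1 with hσ₁
  have hexec : (start f).exec σ₀ = σ₁ := rfl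
  have b₀' : (σ₀.setVar .fvs f).Bounded W := b₀.setVar rfl f
  have b₀'' : ((σ₀.setVar .fvs f).setVar .nn (n + 1)).Bounded W := b₀'.setVar_le _ hnW
  have b₀₃ : (((σ₀.setVar .fvs f).setVar .nn (n + 1)).setVar .kap 1).Bounded W :=
    b₀''.setVar_le _ (by omega)
  have b₁ : σ₁.Bounded W := b₀₃.setVar rfl 1
  have h₁ : Inp f G w D σ₁ := ⟨rfl, rfl, rfl, rfl, rfl, rfl, rfl, rfl⟩
  have hc : Correct (start f) σ₀ W := (correct_assign rfl b₀).seq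
    ((correct_assign rfl b₀').seq ((correct_assign rfl b₀'').seq (correct_assign rfl b₀₃)))
  obtain ⟨τ₁, r₁, hold₁⟩ := hc _ hold₀
  rw [hexec] at hold₁
  obtain ⟨κ, σ₂, τ₂, r₂, hold₂, h₂, p₂, b₂, hκ⟩ := widthLoop_spec hn hk hlen hnum hkW k 0
    (Nat.zero_add k) σ₁ τ₁ hold₁ h₁ rfl Nat.one_ne_zero b₁
  obtain ⟨τ₃, r₃, hold₃⟩ := rounds.comp_halts rfl hold₂ b₂
  obtain ⟨τ₄, r₄, hold₄⟩ := combine.comp_halts rfl hold₃ (b₂.exec rfl)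
  obtain ⟨B, hB, hmax, hout⟩ := combine_spec (h₂.exec (c := rounds) rfl) fun s t hst =>
    rounds_spec h₂ hn p₂ hκ hst
  refine ⟨τ₄, B, (r₁.seq (r₂.seq (r₃.seq r₄))).mono ?_, hB, hmax, ?_⟩
  · have : (k + 1) * (widthStep.time W + 2) ≤ W * (widthStep.time W + 2) :=
      Nat.mul_le_mul_right _ hkW
    simp only [totalTime]
    omega
  · rw [← hout]
    ext v
    have : τ₄.arr 4 = (combine.exec (rounds.exec σ₂)).arr .out := hold₄.2 .out
    simp [outputSet, this]

/-- The algorithm runs in time `n ^ O(k)`. -/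
theorem exists_time_bound (f : ℕ) : ∃ c : ℕ, ∀ (n m k : ℕ) (G : SimpleGraph (Fin n))
    (w : Fin n → ℕ) (D : BranchDecomposition (Fin n) (Fin m)), D.width (omim G) = k →
    ∃ (t : ℕ) (τ : State) (B : Finset (Fin n)), Run (algorithm f) (inputState G w D) t τ ∧
      t ≤ c * n ^ (c * max k 1) ∧ Good (Setoid.ker (base n f)) G B ∧
      (∀ S : Finset (Fin n), Good (Setoid.ker (base n f)) G S → ∑ v ∈ S, w v ≤ ∑ v ∈ B, w v) ∧
      outputSet n τ = if f ≠ 0 then Bᶜ else B := by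
  obtain ⟨K, d, hT⟩ := polyBounded_totalTime f
  -- The summand `K * 5 ^ d` is for `n = 1`, where `W + 1` below is `5`.
  refine ⟨K * 5 ^ d + 29 * d, fun n m k G w D hk => ?_⟩
  have hcard := D.card_add_two_le
  rw [Fintype.card_fin, Fintype.card_fin] at hcard
  have hn : 0 < n := by omega
  -- This bounds the number of tests, the number of digits, and the number of tree nodes.
  set W := (n + 1) ^ (12 * k + 2) with hWdef
  have hlin : 12 * k + 2 < W := Nat.lt_pow_self (by omega)
  have hsq : (n + 1) ^ 2 ≤ W := Nat.pow_le_pow_right (by omega) (by omega)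
  obtain ⟨τ, B, ⟨t, ht, hr⟩, hres⟩ := algorithm_spec (W := W) (w := w) f hn hk.le (by omega)
    (Nat.pow_le_pow_right (by omega) (by omega)) (by omega) (by nlinarith) (by nlinarith)
  refine ⟨t, τ, B, hr, ?_, hres⟩
  have ht' := ht.trans (hT W)
  rcases Nat.lt_or_ge 1 n with h1 | h1
  · have hk1 : 12 * k + 2 ≤ 14 * max k 1 := by omega
    have hn2 : n + 1 ≤ n ^ 2 := by nlinarith
    have hW1 : W + 1 ≤ n ^ (29 * max k 1) := by
      have e₁ : W ≤ n ^ (2 * (14 * max k 1)) := by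
        rw [pow_mul]
        exact (Nat.pow_le_pow_right (by omega) hk1).trans (Nat.pow_le_pow_left hn2 _)
      have e₂ : 0 < n ^ (2 * (14 * max k 1)) := by positivity
      calc W + 1 ≤ 2 * n ^ (2 * (14 * max k 1)) := by omega
        _ ≤ n * n ^ (2 * (14 * max k 1)) := Nat.mul_le_mul_right _ h1
        _ = n ^ (2 * (14 * max k 1) + 1) := (pow_succ' _ _).symm
        _ ≤ n ^ (29 * max k 1) := Nat.pow_le_pow_right hn (by omega)
    calc t ≤ K * (W + 1) ^ d := ht'
      _ ≤ K * (n ^ (29 * max k 1)) ^ d := Nat.mul_le_mul_left _ (Nat.pow_le_pow_left hW1 _)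
      _ = K * n ^ (29 * d * max k 1) := by rw [← pow_mul]; congr 2; ring
      _ ≤ (K * 5 ^ d + 29 * d) * n ^ ((K * 5 ^ d + 29 * d) * max k 1) := by
        refine Nat.mul_le_mul ?_ (Nat.pow_le_pow_right hn ?_)
        · exact (Nat.le_mul_of_pos_right K (by positivity)).trans (Nat.le_add_right _ _)
        · exact Nat.mul_le_mul_right _ (Nat.le_add_left _ _)
  · -- For `n = 1` the tree has no edge, so that `k = 0`.
    obtain rfl : n = 1 := by omega
    have hm : m ≤ 1 := by omega
    have hk0 : k = 0 := by
      classical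
      rw [← hk, BranchDecomposition.width, (Finset.sup_eq_bot_iff _ _).2]
      · rfl
      · intro p hp
        have : Subsingleton (Fin m) := Fin.subsingleton_iff_le_one.2 hm
        have hadj := (Finset.mem_filter.1 hp).2
        exact (hadj.ne (Subsingleton.elim _ _)).elim
    subst hk0
    have hW4 : W = 4 := by norm_num [hWdef]
    rw [hW4] at ht'
    rw [one_pow, mul_one]
    exact ht'.trans (Nat.le_add_right _ _)

end Main

end RAM

theorem theorem1 :
    (∃ (P : RAM.Cmd) (c : ℕ), ∀ (n m k : ℕ) (G : SimpleGraph (Fin n)) (w : Fin n → ℕ)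
      (D : OMim.BranchDecomposition (Fin n) (Fin m)), D.width (OMim.omim G) = k →
        ∃ (t : ℕ) (σ : RAM.State), RAM.Run P (OMim.inputState G w D) t σ ∧
          t ≤ c * n ^ (c * max k 1) ∧
          OMim.IsMaxWeightIndepSet G w (OMim.outputSet n σ)) ∧
    (∃ (P : RAM.Cmd) (c : ℕ), ∀ (n m k : ℕ) (G : SimpleGraph (Fin n)) (w : Fin n → ℕ)
      (D : OMim.BranchDecomposition (Fin n) (Fin m)), D.width (OMim.omim G) = k →
        ∃ (t : ℕ) (σ : RAM.State), RAM.Run P (OMim.inputState G w D) t σ ∧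
          t ≤ c * n ^ (c * max k 1) ∧
          OMim.IsMinWeightFeedbackVertexSet G w (OMim.outputSet n σ)) := by
  constructor
  · obtain ⟨c, hc⟩ := RAM.exists_time_bound 0
    refine ⟨RAM.algorithm 0, c, fun n m k G w D hk => ?_⟩
    obtain ⟨t, σ, B, hr, ht, hB, hmax, hout⟩ := hc n m k G w D hk
    rw [RAM.ker_base_zero, OMim.good_top_iff] at hB
    rw [if_neg (by simp)] at hout
    refine ⟨t, σ, hr, ht, ?_⟩
    rw [hout]
    refine ⟨hB, fun S hS => hmax S ?_⟩
    rwa [RAM.ker_base_zero, OMim.good_top_iff]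
  · obtain ⟨c, hc⟩ := RAM.exists_time_bound 1
    refine ⟨RAM.algorithm 1, c, fun n m k G w D hk => ?_⟩
    obtain ⟨t, σ, B, hr, ht, hB, hmax, hout⟩ := hc n m k G w D hk
    rw [RAM.ker_base one_ne_zero, OMim.good_bot_iff] at hB
    rw [if_pos one_ne_zero] at hout
    refine ⟨t, σ, hr, ht, ?_⟩
    rw [hout]
    have hfvs : ∀ S : Finset (Fin n), OMim.IsFeedbackVertexSet G S ↔
        OMim.Good ⊥ G ((Sᶜ : Finset (Fin n)) : Set (Fin n)) := fun S => by
      rw [OMim.good_bot_iff, OMim.IsFeedbackVertexSet, Finset.coe_compl]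
    refine ⟨?_, fun S hS => ?_⟩
    · rw [hfvs, compl_compl, OMim.good_bot_iff]
      exact hB
    · have h₁ := hmax Sᶜ (by rw [RAM.ker_base one_ne_zero]; exact (hfvs S).1 hS)
      have h₂ := Finset.sum_add_sum_compl S w
      have h₃ := Finset.sum_add_sum_compl B w
      omega
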